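/- Let $(M,g)$ be a smooth Riemannian manifold of dimension $n=5$ or $n=14$, with Levi-Civita connection $\nabla^{LC}$, and let $\Upsilon$ be a smooth covariant 3-tensor field on $M$ whose components in every orthonormal frame satisfy (summing over repeated indices) (i) $\Upsilon_{ijk}$ is totally symmetric; (ii) $\Upsilon_{ijj}=0$; (iii) $\Upsilon_{jki}\Upsilon_{lmi}+\Upsilon_{lji}\Upsilon_{kmi}+\Upsilon_{kli}\Upsilon_{jmi}=g_{jk}g_{lm}+g_{lj}g_{km}+g_{kl}g_{jm}$. (Such a $\Upsilon$ reduces the structure group of $M$ to its pointwise stabilizer $H$, which has the Lie algebra $\mathfrak h=\mathfrak{so}(3)$ for $n=5$ and $\mathfrak h=\mathfrak{sp}(3)$ for $n=14$; one calls $(M,g,\Upsilon)$ an $SO(3)$, respectively $Sp(3)$, structure.) An $\mathfrak h$-valued connection is a smooth linear connection $\nabla$ on $TM$ with $\nabla g=0$ and $\nabla\Upsilon=0$. A characteristic connection of $(M,g,\Upsilon)$ is an $\mathfrak h$-valued connection $\nabla$ for which there is a smooth 3-form $T$ with $\Gamma^{LC}=\Gamma+\tfrac12T$, that is, $$g(Z,\nabla^{LC}_XY)=g(Z,\nabla_XY)+\tfrac12\,T(Z,Y,X)\quad\text{for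 all vector fields }X,Y,Z$$ (equivalently, the torsion of $\nabla$ is totally skew-symmetric, and equals $T$). Then $(M,g,\Upsilon)$ admits a characteristic connection if and only if it is nearly integrable, i.e. $(\nabla^{LC}_v\Upsilon)(v,v,v)=0$ for every smooth vector field $v$ on $M$. Moreover, the characteristic connection and its 3-form $T$ are unique whenever they exist. -/

import Mathlib

open Bundle FiberBundle VectorField
open scoped Manifold ContDiff

section HkStructures

variable {E : Type*} [NormedAddCommGroup E] [NormedSpace ℝ E] [FiniteDimensional ℝ E]
  {H : Type*} [TopologicalSpace H] {I : ModelWithCorners ℝ E H}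
  {M : Type*} [TopologicalSpace M] [ChartedSpace H M]
  [IsManifold I ∞ M] [RiemannianBundle (fun x : M ↦ TangentSpace I x)]

/-! ### The Levi-Civita connection, built from the Koszul formula -/

/-- The right-hand side of the Koszul formula for `g(∇_X Y, Z)` at `x`. -/
noncomputable def koszulForm (X Y Z : Π x : M, TangentSpace I x) (x : M) : ℝ :=
  (mvfderiv I (fun p ↦ inner ℝ (Y p) (Z p)) x (X x)
    + mvfderiv I (fun p ↦ inner ℝ (X p) (Z p)) x (Y x)
    - mvfderiv I (fun p ↦ inner ℝ (X p) (Y p)) x (Z x)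
    + inner ℝ (mlieBracket I X Y x) (Z x)
    - inner ℝ (mlieBracket I X Z x) (Y x)
    - inner ℝ (mlieBracket I Y Z x) (X x)) / 2

variable [IsContMDiffRiemannianBundle I ∞ E (fun x : M ↦ TangentSpace I x)]

theorem mdifferentiableAt_inner {X Y : Π x : M, TangentSpace I x} {x : M}
    (hX : MDiffAt (T% X) x) (hY : MDiffAt (T% Y) x) :
    MDiffAt (fun p ↦ inner ℝ (X p) (Y p)) x :=
  haveI : IsContMDiffRiemannianBundle I 1 E (fun x : M ↦ TangentSpace I x) :=
    .of_le (n := ∞) (by simp)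
  MDifferentiableAt.inner_bundle (F := E) (E := fun x : M ↦ TangentSpace I x) (b := id) hX hY

theorem koszulForm_tensorial_left (Y Z : Π x : M, TangentSpace I x) {x : M}
    (hY : MDiffAt (T% Y) x) (hZ : MDiffAt (T% Z) x) :
    TensorialAt I E (fun X ↦ koszulForm X Y Z x) x where
  smul {f X} hf hX := by
    have h1 := mvfderiv_fun_mul hf (mdifferentiableAt_inner hX hZ)
    have h2 := mvfderiv_fun_mul hf (mdifferentiableAt_inner hX hY)
    simp only [koszulForm, Pi.smul_apply', inner_smul_left, inner_smul_right, inner_add_left,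
      map_smul, h1, h2, mlieBracket_smul_left hf hX, RCLike.conj_to_real, add_apply, smul_apply,
      smul_eq_mul]
    rw [real_inner_comm (X x) (mlieBracket I Y Z x)]
    simp
    simp only [real_inner_comm]
    ring
  add {X X'} hX hX' := by
    have h1 := mvfderiv_fun_add (mdifferentiableAt_inner hX hZ) (mdifferentiableAt_inner hX' hZ)
    have h2 := mvfderiv_fun_add (mdifferentiableAt_inner hX hY) (mdifferentiableAt_inner hX' hY)
    simp [koszulForm, inner_add_left, inner_add_right, h1, h2, mlieBracket_add_left hX hX']
    ring

theorem koszulForm_tensorial_right (X Y : Π x : M, TangentSpace I x) {x : M}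
    (hX : MDiffAt (T% X) x) (hY : MDiffAt (T% Y) x) :
    TensorialAt I E (fun Z ↦ koszulForm X Y Z x) x where
  smul {f Z} hf hZ := by
    have h1 := mvfderiv_fun_mul hf (mdifferentiableAt_inner hX hZ)
    have h2 := mvfderiv_fun_mul hf (mdifferentiableAt_inner hY hZ)
    simp [koszulForm, inner_smul_left, inner_smul_right, inner_add_left,
      h1, h2, mlieBracket_smul_right hf hZ]
    simp only [real_inner_comm]
    ring
  add {Z Z'} hZ hZ' := by
    have h1 := mvfderiv_fun_add (mdifferentiableAt_inner hX hZ) (mdifferentiableAt_inner hX hZ')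
    have h2 := mvfderiv_fun_add (mdifferentiableAt_inner hY hZ) (mdifferentiableAt_inner hY hZ')
    simp [koszulForm, inner_add_left, inner_add_right, h1, h2, mlieBracket_add_right hZ hZ']
    ring

theorem koszulForm_add_mid {X Y Y' Z : Π x : M, TangentSpace I x} {x : M}
    (hX : MDiffAt (T% X) x) (hY : MDiffAt (T% Y) x) (hY' : MDiffAt (T% Y') x)
    (hZ : MDiffAt (T% Z) x) :
    koszulForm X (Y + Y') Z x = koszulForm X Y Z x + koszulForm X Y' Z x := by
  have h1 := mvfderiv_fun_add (mdifferentiableAt_inner hX hY) (mdifferentiableAt_inner hX hY')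
  have h2 := mvfderiv_fun_add (mdifferentiableAt_inner hY hZ) (mdifferentiableAt_inner hY' hZ)
  simp [koszulForm, inner_add_left, inner_add_right, h1, h2, mlieBracket_add_left hY hY',
    mlieBracket_add_right hY hY']
  ring

theorem koszulForm_smul_mid {f : M → ℝ} {X Y Z : Π x : M, TangentSpace I x} {x : M}
    (hf : MDiffAt f x) (hX : MDiffAt (T% X) x) (hY : MDiffAt (T% Y) x) (hZ : MDiffAt (T% Z) x) :
    koszulForm X (f • Y) Z x
      = f x * koszulForm X Y Z x + mvfderiv I f x (X x) * inner ℝ (Y x) (Z x) := by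
  have h1 := mvfderiv_fun_mul hf (mdifferentiableAt_inner hX hY)
  have h2 := mvfderiv_fun_mul hf (mdifferentiableAt_inner hY hZ)
  simp [koszulForm, inner_smul_left, inner_smul_right, inner_add_left,
      h1, h2, mlieBracket_smul_right hf hY, mlieBracket_smul_left hf hY]
  simp only [real_inner_comm]
  ring

/-- Raising the second index of a bilinear form on `T_x M`: `g(tangentSharp x B v, w) = B(v, w)`. -/
noncomputable def tangentSharp (x : M)
    (B : TangentSpace I x →L[ℝ] TangentSpace I x →L[ℝ] ℝ) :
    TangentSpace I x →L[ℝ] TangentSpace I x :=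
  haveI : FiniteDimensional ℝ (TangentSpace I x) := inferInstanceAs (FiniteDimensional ℝ E)
  haveI : CompleteSpace (TangentSpace I x) := FiniteDimensional.complete ℝ _
  LinearMap.toContinuousLinearMap
    { toFun v := (InnerProductSpace.toDual ℝ (TangentSpace I x)).symm (B v)
      map_add' v w := by simp
      map_smul' c v := by simp }

theorem inner_tangentSharp (x : M) (B : TangentSpace I x →L[ℝ] TangentSpace I x →L[ℝ] ℝ)
    (v w : TangentSpace I x) : inner ℝ (tangentSharp x B v) w = B v w := by
  have : FiniteDimensional ℝ (TangentSpace I x) := inferInstanceAs (FiniteDimensional ℝ E)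
  have : CompleteSpace (TangentSpace I x) := FiniteDimensional.complete ℝ _
  exact InnerProductSpace.toDual_symm_apply

open scoped Classical in
/-- `leviCivitaFun Y x v` is the vector `∇_v Y ∈ T_x M` determined by the Koszul formula, for fields
`Y` differentiable at `x` (and `0` otherwise). -/
noncomputable def leviCivitaFun (Y : Π x : M, TangentSpace I x) (x : M) :
    TangentSpace I x →L[ℝ] TangentSpace I x :=
  if hY : MDiffAt (T% Y) x then
    tangentSharp x (TensorialAt.mkHom₂ (fun X Z ↦ koszulForm X Y Z x) x
        (fun Z hZ ↦ koszulForm_tensorial_left Y Z hY hZ)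
        (fun X hX ↦ koszulForm_tensorial_right X Y hX hY))
  else 0

theorem inner_leviCivitaFun {X Y Z : Π x : M, TangentSpace I x} {x : M}
    (hX : MDiffAt (T% X) x) (hY : MDiffAt (T% Y) x) (hZ : MDiffAt (T% Z) x) :
    inner ℝ (leviCivitaFun Y x (X x)) (Z x) = koszulForm X Y Z x := by
  rw [leviCivitaFun, dif_pos hY, inner_tangentSharp, TensorialAt.mkHom₂_apply _ _ hX hZ]

theorem inner_leviCivitaFun_extend {Y : Π x : M, TangentSpace I x} {x : M}
    (hY : MDiffAt (T% Y) x) (v w : TangentSpace I x) :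
    inner ℝ (leviCivitaFun Y x v) w = koszulForm (extend E v) Y (extend E w) x := by
  simpa using inner_leviCivitaFun (mdifferentiableAt_extend I E v) hY
    (mdifferentiableAt_extend I E w)

/-- The Levi-Civita connection of a Riemannian manifold; `leviCivita Y x v` is `∇_v Y` at `x`. -/
noncomputable def leviCivita : CovariantDerivative I E (fun x : M ↦ TangentSpace I x) where
  toFun := leviCivitaFun
  isCovariantDerivativeOnUniv :=
    { add := by
        intro Y Y' x hY hY' _
        ext1 v
        refine ext_inner_right ℝ fun w ↦ ?_
        rw [add_apply, inner_add_left, inner_leviCivitaFun_extend hY,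
          inner_leviCivitaFun_extend hY',
          inner_leviCivitaFun_extend (mdifferentiableAt_add_section hY hY'),
          koszulForm_add_mid (mdifferentiableAt_extend I E v) hY hY' (mdifferentiableAt_extend I E w)]
      leibniz := by
        intro Y f x hY hf _
        ext1 v
        refine ext_inner_right ℝ fun w ↦ ?_
        rw [inner_leviCivitaFun_extend (hf.smul_section hY),
          koszulForm_smul_mid hf (mdifferentiableAt_extend I E v) hY (mdifferentiableAt_extend I E w)]
        simp [inner_add_left, inner_smul_left, inner_leviCivitaFun_extend hY] }

theorem inner_leviCivita {X Y Z : Π x : M, TangentSpace I x} {x : M}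
    (hX : MDiffAt (T% X) x) (hY : MDiffAt (T% Y) x) (hZ : MDiffAt (T% Z) x) :
    inner ℝ (leviCivita Y x (X x)) (Z x) = koszulForm X Y Z x :=
  inner_leviCivitaFun hX hY hZ

/-- The Levi-Civita connection is torsion-free. -/
theorem leviCivita_torsion :
    (leviCivita : CovariantDerivative I E (fun x : M ↦ TangentSpace I x)).torsion = 0 := by
  rw [CovariantDerivative.torsion_eq_zero_iff]
  intro X Y x hX hY
  refine ext_inner_right ℝ fun w ↦ ?_
  have hW := mdifferentiableAt_extend I E w
  have h1 := inner_leviCivita hX hY hW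
  have h2 := inner_leviCivita hY hX hW
  simp only [extend_apply_self] at h1 h2
  rw [inner_sub_left, h1, h2]
  simp only [koszulForm, mlieBracket_swap_apply (V := Y) (W := X), extend_apply_self, inner_neg_left]
  simp only [real_inner_comm]
  ring

/-- The Levi-Civita connection is metric. -/
theorem leviCivita_metric {X Y Z : Π x : M, TangentSpace I x} {x : M}
    (hX : MDiffAt (T% X) x) (hY : MDiffAt (T% Y) x) (hZ : MDiffAt (T% Z) x) :
    mvfderiv I (fun p ↦ inner ℝ (Y p) (Z p)) x (X x)
      = inner ℝ (leviCivita Y x (X x)) (Z x) + inner ℝ (Y x) (leviCivita Z x (X x)) := by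
  rw [real_inner_comm (leviCivita Z x (X x)), inner_leviCivita hX hY hZ, inner_leviCivita hX hZ hY]
  simp only [koszulForm, mlieBracket_swap_apply (V := Z) (W := Y), inner_neg_left]
  simp only [real_inner_comm]
  ring

/-! ### `H_k` structures -/

/-- Fields of trilinear forms on the tangent spaces (covariant 3-tensor fields). -/
abbrev TrilinearField (I : ModelWithCorners ℝ E H) (M : Type*) [TopologicalSpace M]
    [ChartedSpace H M] :=
  Π x : M, TangentSpace I x →L[ℝ] TangentSpace I x →L[ℝ] TangentSpace I x →L[ℝ] ℝ

/-- The tensor field `S` is smooth: `S(X, Y, Z)` is a smooth function for all smooth vector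
fields `X`, `Y`, `Z`. -/
def TrilinearField.IsSmooth (S : TrilinearField I M) : Prop :=
  ∀ X Y Z : Π x : M, TangentSpace I x,
    CMDiff ∞ (T% X) → CMDiff ∞ (T% Y) → CMDiff ∞ (T% Z) →
      CMDiff ∞ (fun x ↦ S x (X x) (Y x) (Z x))

/-- An `H_k` structure on a Riemannian manifold: a smooth 3-tensor field `Υ` which is totally
symmetric, trace-free, and satisfies the quadratic identity
`Υ_{jki}Υ_{lmi} + Υ_{lji}Υ_{kmi} + Υ_{kli}Υ_{jmi} = g_{jk}g_{lm} + g_{lj}g_{km} + g_{kl}g_{jm}`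
in orthonormal frames. -/
structure IsHkStructure (Υ : TrilinearField I M) : Prop where
  smooth : Υ.IsSmooth
  symm_left : ∀ (x : M) (u v w : TangentSpace I x), Υ x u v w = Υ x v u w
  symm_right : ∀ (x : M) (u v w : TangentSpace I x), Υ x u v w = Υ x u w v
  trace_free : ∀ (x : M)
    (e : OrthonormalBasis (Fin (Module.finrank ℝ E)) ℝ (TangentSpace I x)) (i),
    ∑ j, Υ x (e i) (e j) (e j) = 0
  quadratic : ∀ (x : M)
    (e : OrthonormalBasis (Fin (Module.finrank ℝ E)) ℝ (TangentSpace I x)) (j k l m),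
    ∑ i, (Υ x (e j) (e k) (e i) * Υ x (e l) (e m) (e i)
        + Υ x (e l) (e j) (e i) * Υ x (e k) (e m) (e i)
        + Υ x (e k) (e l) (e i) * Υ x (e j) (e m) (e i))
      = inner ℝ (e j) (e k) * inner ℝ (e l) (e m)
        + inner ℝ (e l) (e j) * inner ℝ (e k) (e m)
        + inner ℝ (e k) (e l) * inner ℝ (e j) (e m)

/-- The covariant derivative of a 3-tensor field:
`(∇_v S)(X, Y, Z) = v(S(X, Y, Z)) - S(∇_v X, Y, Z) - S(X, ∇_v Y, Z) - S(X, Y, ∇_v Z)` at `x`. -/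
noncomputable def TrilinearField.covDeriv
    (D : CovariantDerivative I E (fun x : M ↦ TangentSpace I x)) (S : TrilinearField I M)
    (X Y Z : Π x : M, TangentSpace I x) (x : M) (v : TangentSpace I x) : ℝ :=
  mvfderiv I (fun p ↦ S p (X p) (Y p) (Z p)) x v
    - S x (D X x v) (Y x) (Z x) - S x (X x) (D Y x v) (Z x) - S x (X x) (Y x) (D Z x v)

/-- `(∇^{LC}_V Υ)(V, V, V) = 0` for every smooth vector field `V`. -/
def IsNearlyIntegrable (Υ : TrilinearField I M) : Prop :=
  ∀ V : Π x : M, TangentSpace I x, CMDiff ∞ (T% V) →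
    ∀ x, Υ.covDeriv leviCivita V V V x (V x) = 0

/-- `D` is an `𝔥_k`-valued connection of the structure `(g, Υ)`. As `H_k` is the stabilizer of `Υ`
in the orthogonal group and `𝔥_k` is its Lie algebra, the connections whose forms in adapted
(orthonormal, `Υ`-normalizing) frames have values in `𝔥_k` are the smooth linear connections
preserving `g` and `Υ`. -/
structure IsHkConnection (Υ : TrilinearField I M)
    (D : CovariantDerivative I E (fun x : M ↦ TangentSpace I x)) : Prop where
  smooth : D.ContMDiffCovariantDerivative ∞
  preserves_metric : ∀ Y Z : Π x : M, TangentSpace I x, CMDiff ∞ (T% Y) → CMDiff ∞ (T% Z) →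
    ∀ (x : M) (v : TangentSpace I x),
      mvfderiv I (fun p ↦ inner ℝ (Y p) (Z p)) x v
        = inner ℝ (D Y x v) (Z x) + inner ℝ (Y x) (D Z x v)
  preserves_tensor : ∀ X Y Z : Π x : M, TangentSpace I x,
    CMDiff ∞ (T% X) → CMDiff ∞ (T% Y) → CMDiff ∞ (T% Z) →
      ∀ (x : M) (v : TangentSpace I x), Υ.covDeriv D X Y Z x v = 0

/-- `D` is a characteristic connection of `(g, Υ)` with totally skew-symmetric torsion `T`: it is an
`𝔥_k`-valued connection, `T` is a smooth 3-form, and the Levi-Civita connection decomposes as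
`Γ^{LC} = Γ + T / 2`, that is, `Γ^{LC}_{abc} = Γ_{abc} + T_{abc} / 2` where `Γ_{abc}` stands for
`g(e_a, D_{e_c} e_b)`. -/
structure IsCharacteristicConnection (Υ : TrilinearField I M)
    (D : CovariantDerivative I E (fun x : M ↦ TangentSpace I x)) (T : TrilinearField I M) :
    Prop where
  isHkConnection : IsHkConnection Υ D
  smooth_torsion : T.IsSmooth
  skew_left : ∀ (x : M) (u v w : TangentSpace I x), T x u v w = -T x v u w
  skew_right : ∀ (x : M) (u v w : TangentSpace I x), T x u v w = -T x u w v
  decomposition : ∀ (x : M) (Y : Π x : M, TangentSpace I x), MDiffAt (T% Y) x →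
    ∀ u w : TangentSpace I x,
      inner ℝ w (leviCivita Y x u) = inner ℝ w (D Y x u) + T x w (Y x) u / 2

end HkStructures

/-!
Raising an index of `Υ` gives a commutative product `x ∘ y` on each tangent space, with
`⟪x ∘ y, z⟫ = Υ(x, y, z)`, with traceless multiplications and with `(x ∘ x) ∘ x = |x|² x`,
equivalently `|x ∘ x|² = |x|⁴` (`IsHkStructure.isCubicProduct`). A metric connection is
`∇ = ∇^{LC} + τ` with all `τ_v` skew-symmetric. It preserves `Υ` if and only if `∇^{LC}_v Υ` is the
infinitesimal action `deform μ τ_v` of `τ_v` on the product `μ`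
(`TrilinearField.covDeriv_eq_sub_deform`), and it is characteristic if and only if moreover
`τ_v v = 0`; then `T = 2τ`. The condition `(∇^{LC}_v Υ)(v, v, v) = 0` is necessary because
`deform μ τ_v (v, v) = -τ_v (v ∘ v)` is orthogonal to `v` when `τ_v v = 0`. Everything else reduces
to two statements on a Euclidean space of dimension 5 or 14 with such a product.

* Uniqueness (`IsCubicProduct.skew_eq_zero`): if every `τ_v` is a skew derivation and `τ_v v = 0`,
  then `τ = 0`.
* Existence (`IsCubicProduct.exists_skew`): differentiating `|X ∘ X|² = |X|⁴` shows that
  `S_v = ∇^{LC}_v Υ` satisfies `⟪S_v(x, x), x ∘ x⟫ = 0`. By infinitesimal rigidity of the product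
  (`PeirceDecomposition.exists_deform`), `S_v = deform μ F_v` for skew `F_v`. Near integrability
  says that the quadratic map `x ↦ F_x x` is orthogonal to `x` and to `x ∘ x`. Such a quadratic map
  is `x ↦ D_x x` for a linear family `D` of skew derivations
  (`PeirceDecomposition.exists_derivation`), and `τ = F - D` is the required family.

Both are proved with the Peirce decomposition `V = ℝ e ⊕ U ⊕ W` with respect to a unit idempotent
`e`. Tracelessness gives `dim U = 2` or `5`, and the product is encoded by symmetric endomorphisms
`γ u` of `W` with `γ u ^ 2 = |u|²`, subject to a completeness relation (`CliffordSystem`). On the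
pieces of the decomposition, the statements above become statements on such Clifford systems, where
the completeness relation controls the eigenvalues of `X ↦ ∑ₐ γₐ X γₐ`.

The pointwise solution `τ` is smooth because, in a smooth frame, its components are the unique
solution of a linear system with smooth coefficients (`IsHkStructure.contMDiff_inner_skew`).
-/

/-! ### Clifford systems -/

/-- A Clifford system on Euclidean spaces `U` and `W`: symmetric endomorphisms `γ u` of `W` with
`γ u ^ 2 = |u|²`, such that the quadratic map `w ↦ q w w` dual to `γ` satisfies `|q w w| = |w|²`
(in the form `γ (q w w) w = |w|² w`). -/
structure CliffordSystem (U W : Type*) [NormedAddCommGroup U] [InnerProductSpace ℝ U]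
    [NormedAddCommGroup W] [InnerProductSpace ℝ W] where
  γ : U →ₗ[ℝ] Module.End ℝ W
  q : W →ₗ[ℝ] W →ₗ[ℝ] U
  symm : ∀ u w w', inner ℝ (γ u w) w' = inner ℝ w (γ u w')
  sq : ∀ u w, γ u (γ u w) = inner ℝ u u • w
  inner_q : ∀ w w' u, inner ℝ (q w w') u = inner ℝ (γ u w) w'
  fierz : ∀ w, γ (q w w) w = inner ℝ w w • w

namespace CliffordSystem

variable {U W : Type*} [NormedAddCommGroup U] [InnerProductSpace ℝ U]
  [NormedAddCommGroup W] [InnerProductSpace ℝ W] (C : CliffordSystem U W)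

theorem anticomm_apply (u v : U) (w : W) :
    C.γ u (C.γ v w) + C.γ v (C.γ u w) = (2 * inner ℝ u v) • w := by
  have h := C.sq (u + v) w
  simp only [map_add, LinearMap.add_apply, C.sq, inner_add_left, inner_add_right] at h
  rw [real_inner_comm u v] at h
  linear_combination (norm := module) h

theorem anticomm (u v : U) : C.γ u * C.γ v + C.γ v * C.γ u = (2 * inner ℝ u v) • 1 := by
  ext w
  simpa using C.anticomm_apply u v w

theorem mul_self (u : U) : C.γ u * C.γ u = inner ℝ u u • 1 := by
  ext w
  simpa using C.sq u w

theorem q_comm (w w' : W) : C.q w w' = C.q w' w := by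
  refine ext_inner_right ℝ fun u ↦ ?_
  rw [C.inner_q, C.inner_q, C.symm, real_inner_comm]

theorem fierz_polar (x y z : W) :
    C.γ (C.q x y) z + C.γ (C.q y z) x + C.γ (C.q z x) y
      = inner ℝ x y • z + inner ℝ y z • x + inner ℝ z x • y := by
  have h1 := C.fierz (x + y + z)
  have h2 := C.fierz (x + y)
  have h3 := C.fierz (x + z)
  have h4 := C.fierz (y + z)
  have h5 := C.fierz x
  have h6 := C.fierz y
  have h7 := C.fierz z
  simp only [map_add, LinearMap.add_apply, inner_add_left, inner_add_right] at h1 h2 h3 h4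
  simp only [C.q_comm y x, C.q_comm z x, C.q_comm z y, real_inner_comm x y, real_inner_comm x z,
    real_inner_comm y z] at *
  linear_combination (norm := module) (1/2 : ℝ) • (h1 - h2 - h3 - h4 + h5 + h6 + h7)

theorem γ_injective [Nontrivial W] {u : U} (h : C.γ u = 0) : u = 0 := by
  obtain ⟨w, hw⟩ := exists_ne (0 : W)
  have := C.sq u w
  rw [h, LinearMap.zero_apply, eq_comm, smul_eq_zero] at this
  exact inner_self_eq_zero.1 (this.resolve_right hw)

section Finite

/-- The Casimir-type operator `X ↦ ∑ₐ γₐ X γₐ`. -/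
noncomputable def casimir {ι : Type*} [Fintype ι] (b : OrthonormalBasis ι ℝ U)
    (X : Module.End ℝ W) : Module.End ℝ W :=
  ∑ a, C.γ (b a) * X * C.γ (b a)

theorem q_eq_sum {ι : Type*} [Fintype ι] (b : OrthonormalBasis ι ℝ U) (w w' : W) :
    C.q w w' = ∑ a, inner ℝ (C.γ (b a) w) w' • b a := by
  conv_lhs => rw [← b.sum_repr (C.q w w')]
  simp [b.repr_apply_apply, ← C.inner_q, real_inner_comm]

/-- The completeness relation of a Clifford system, evaluated on symmetric endomorphisms: the
polarized identity `γ (q w w) w = |w|² w`, traced over two of its arguments. -/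
theorem two_casimir_add [FiniteDimensional ℝ W] {ι : Type*} [Fintype ι] (b : OrthonormalBasis ι ℝ U)
    {X : Module.End ℝ W} (hX : ∀ w w', inner ℝ (X w) w' = inner ℝ w (X w')) :
    (2 : ℝ) • C.casimir b X + ∑ a, LinearMap.trace ℝ W (C.γ (b a) * X) • C.γ (b a)
      = (2 : ℝ) • X + LinearMap.trace ℝ W X • 1 := by
  ext z
  -- Sum the polarized identity at `(f i, X (f i), z)` over an orthonormal basis `f`.
  let f := stdOrthonormalBasis ℝ W
  have key := Finset.sum_congr rfl fun i (_ : i ∈ Finset.univ) ↦ C.fierz_polar (f i) (X (f i)) z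
  simp only [Finset.sum_add_distrib] at key
  have t1 : ∑ i, C.γ (C.q (f i) (X (f i))) z
      = ∑ a, LinearMap.trace ℝ W (C.γ (b a) * X) • C.γ (b a) z := by
    simp only [C.q_eq_sum b, map_sum, map_smul, LinearMap.sum_apply, LinearMap.smul_apply]
    rw [Finset.sum_comm]
    refine Finset.sum_congr rfl fun a _ ↦ ?_
    rw [LinearMap.trace_eq_sum_inner _ f, Finset.sum_smul]
    refine Finset.sum_congr rfl fun i _ ↦ ?_
    rw [C.symm]; rfl
  have t2 : ∑ i, C.γ (C.q (X (f i)) z) (f i) = C.casimir b X z := by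
    simp only [C.q_eq_sum b, map_sum, map_smul, LinearMap.sum_apply, LinearMap.smul_apply, casimir]
    rw [Finset.sum_comm]
    refine Finset.sum_congr rfl fun a _ ↦ ?_
    simp only [Module.End.mul_apply, ← map_smul, ← map_sum]
    congr 1
    conv_rhs => rw [← f.sum_repr' (X (C.γ (b a) z))]
    refine Finset.sum_congr rfl fun i _ ↦ ?_
    rw [C.symm, hX]
  have t3 : ∑ i, C.γ (C.q z (f i)) (X (f i)) = C.casimir b X z := by
    simp only [C.q_eq_sum b, map_sum, map_smul, LinearMap.sum_apply, LinearMap.smul_apply, casimir]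
    rw [Finset.sum_comm]
    refine Finset.sum_congr rfl fun a _ ↦ ?_
    simp only [Module.End.mul_apply, ← map_smul, ← map_sum]
    congr 2
    conv_rhs => rw [← f.sum_repr' (C.γ (b a) z)]
    refine Finset.sum_congr rfl fun i _ ↦ ?_
    rw [real_inner_comm]
  have t4 : ∑ i, inner ℝ (f i) (X (f i)) • z = LinearMap.trace ℝ W X • z := by
    rw [LinearMap.trace_eq_sum_inner _ f, Finset.sum_smul]
  have t5 : ∑ i, inner ℝ (X (f i)) z • f i = X z := by
    conv_rhs => rw [← f.sum_repr' (X z)]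
    simp only [hX]
  have t6 : ∑ i, inner ℝ z (f i) • X (f i) = X z := by
    conv_rhs => rw [← f.sum_repr' z]
    simp [real_inner_comm]
  rw [t1, t2, t3, t4, t5, t6] at key
  simp only [LinearMap.add_apply, LinearMap.smul_apply, LinearMap.sum_apply, Module.End.one_apply]
  linear_combination (norm := module) key

theorem sum_mul_self {ι : Type*} [Fintype ι] (b : OrthonormalBasis ι ℝ U) :
    ∑ a, C.γ (b a) * C.γ (b a) = (Fintype.card ι : ℝ) • 1 := by
  simp [C.mul_self, b.orthonormal.1, ← Nat.cast_smul_eq_nsmul ℝ]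

theorem sum_inner_smul {ι : Type*} [Fintype ι] (b : OrthonormalBasis ι ℝ U) (v : U) :
    ∑ a, inner ℝ (b a) v • C.γ (b a) = C.γ v := by
  conv_rhs => rw [← b.sum_repr' v]
  simp

/-- The image `-1/4 ∑ₐ γₐ γ(R bₐ)` of a skew endomorphism `R` of `U` under the spin
representation. -/
noncomputable def spinLift {ι : Type*} [Fintype ι] (b : OrthonormalBasis ι ℝ U) :
    Module.End ℝ U →ₗ[ℝ] Module.End ℝ W where
  toFun R := (-1 / 4 : ℝ) • ∑ a, C.γ (b a) * C.γ (R (b a))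
  map_add' R S := by simp [mul_add, Finset.sum_add_distrib]
  map_smul' c R := by simp [Finset.smul_sum, smul_smul, mul_comm]

end Finite

end CliffordSystem

/-! ### Skew endomorphisms and the spin representation -/

/-- Skew-adjointness of an endomorphism of a Euclidean space. -/
def IsSkewMap {V : Type*} [NormedAddCommGroup V] [InnerProductSpace ℝ V]
    (F : Module.End ℝ V) : Prop :=
  ∀ x y, inner ℝ (F x) y = -inner ℝ x (F y)

theorem IsSkewMap.inner_self {V : Type*} [NormedAddCommGroup V] [InnerProductSpace ℝ V]
    {F : Module.End ℝ V} (h : IsSkewMap F) (x : V) : inner ℝ (F x) x = 0 := by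
  have := h x x
  rw [real_inner_comm (F x) x] at this
  linarith

theorem IsSkewMap.of_inner_self {V : Type*} [NormedAddCommGroup V] [InnerProductSpace ℝ V]
    {F : Module.End ℝ V} (h : ∀ x, inner ℝ (F x) x = 0) : IsSkewMap F := by
  intro x y
  have h1 := h (x + y)
  simp only [map_add, inner_add_left, inner_add_right, h] at h1
  rw [real_inner_comm (F y) x]
  linarith

theorem IsSkewMap.add {V : Type*} [NormedAddCommGroup V] [InnerProductSpace ℝ V]
    {F G : Module.End ℝ V} (hF : IsSkewMap F) (hG : IsSkewMap G) : IsSkewMap (F + G) := by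
  intro x y
  simp only [LinearMap.add_apply, inner_add_left, inner_add_right, hF x y, hG x y]
  ring

theorem IsSkewMap.smul {V : Type*} [NormedAddCommGroup V] [InnerProductSpace ℝ V]
    {F : Module.End ℝ V} (hF : IsSkewMap F) (c : ℝ) : IsSkewMap (c • F) := by
  intro x y
  simp only [LinearMap.smul_apply, inner_smul_left, inner_smul_right, hF x y]
  simp

theorem IsSkewMap.sub {V : Type*} [NormedAddCommGroup V] [InnerProductSpace ℝ V]
    {F G : Module.End ℝ V} (hF : IsSkewMap F) (hG : IsSkewMap G) : IsSkewMap (F - G) := by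
  intro x y
  simp only [LinearMap.sub_apply, inner_sub_left, inner_sub_right, hF x y, hG x y]
  ring

/-- The joint `+1`-eigenspaces of three commuting involutions are detected by their sum. -/
theorem eq_of_add_involutions_eq_three {A : Type*} [AddCommGroup A] [Module ℝ A]
    {f g h : Module.End ℝ A} (hf : ∀ x, f (f x) = x) (hg : ∀ x, g (g x) = x)
    (hh : ∀ x, h (h x) = x) (hfg : ∀ x, f (g x) = g (f x)) (hfh : ∀ x, f (h x) = h (f x))
    (hgh : ∀ x, g (h x) = h (g x)) {x : A} (hx : f x + g x + h x = (3 : ℝ) • x) : f x = x := by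
  -- On a joint eigenspace with signs `(a, b, c)`, the hypothesis reads `(a + b + c - 3) x = 0`. The
  -- eight images of it under products of the involutions combine to `(a - 1) x = 0`.
  have e0 := hx
  have e1 := congrArg f e0
  have e2 := congrArg g e0
  have e3 := congrArg h e0
  have e4 := congrArg f e2
  have e5 := congrArg f e3
  have e6 := congrArg g e3
  have e7 := congrArg f e6
  simp only [map_add, map_smul, hf, hg, hh, ← hfg, ← hfh, ← hgh] at e1 e2 e3 e4 e5 e6 e7
  linear_combination (norm := module) (7/24 : ℝ) • e0 - (7/24 : ℝ) • e1 + (1/12 : ℝ) • e2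
    + (1/12 : ℝ) • e3 - (1/12 : ℝ) • e4 - (1/12 : ℝ) • e5 + (1/24 : ℝ) • e6 - (1/24 : ℝ) • e7

namespace CliffordSystem

variable {U W : Type*} [NormedAddCommGroup U] [InnerProductSpace ℝ U]
  [NormedAddCommGroup W] [InnerProductSpace ℝ W] (C : CliffordSystem U W)

section

variable {ι : Type*} [Fintype ι]

/-- The spin representation is compatible with the action on the Clifford generators. -/
theorem spinLift_bracket (b : OrthonormalBasis ι ℝ U)
    {R : Module.End ℝ U} (hR : IsSkewMap R) (v : U) :
    C.spinLift b R * C.γ v - C.γ v * C.spinLift b R = C.γ (R v) := by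
  have key : ∀ a, C.γ (b a) * C.γ (R (b a)) * C.γ v - C.γ v * (C.γ (b a) * C.γ (R (b a)))
      = (-2 : ℝ) • (inner ℝ (b a) (R v) • C.γ (b a)) - (2 : ℝ) • (inner ℝ (b a) v • C.γ (R (b a))) := by
    intro a
    have h1 := C.anticomm (R (b a)) v
    have h2 := C.anticomm (b a) v
    rw [hR] at h1
    have h3 : C.γ (b a) * C.γ (R (b a)) * C.γ v - C.γ v * (C.γ (b a) * C.γ (R (b a)))
      = C.γ (b a) * (C.γ (R (b a)) * C.γ v + C.γ v * C.γ (R (b a)))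
        - (C.γ (b a) * C.γ v + C.γ v * C.γ (b a)) * C.γ (R (b a)) := by noncomm_ring
    rw [h3, h1, h2]
    simp only [mul_smul_comm, smul_mul_assoc, one_mul, mul_one]
    module
  have h4 : ∑ a, inner ℝ (b a) v • C.γ (R (b a)) = C.γ (R v) := by
    conv_rhs => rw [← b.sum_repr' v]
    simp
  simp only [spinLift, LinearMap.coe_mk, AddHom.coe_mk, smul_mul_assoc, mul_smul_comm,
    Finset.sum_mul, Finset.mul_sum, ← smul_sub, ← Finset.sum_sub_distrib, key]
  rw [Finset.sum_sub_distrib, ← Finset.smul_sum, ← Finset.smul_sum, C.sum_inner_smul, h4]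
  module

theorem spinLift_skew (b : OrthonormalBasis ι ℝ U)
    {R : Module.End ℝ U} (hR : IsSkewMap R) : IsSkewMap (C.spinLift b R) := by
  refine .of_inner_self fun w ↦ ?_
  simp only [spinLift, LinearMap.coe_mk, AddHom.coe_mk, LinearMap.smul_apply, inner_smul_left,
    LinearMap.sum_apply, sum_inner, Module.End.mul_apply]
  rw [Finset.sum_eq_zero, mul_zero]
  intro a _
  have h := congrArg (inner ℝ w) (C.anticomm_apply (b a) (R (b a)) w)
  rw [real_inner_comm (R (b a)) (b a), hR.inner_self, inner_add_right, ← C.symm (b a),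
    ← C.symm (R (b a)) w, mul_zero, zero_smul, inner_zero_right,
    real_inner_comm (C.γ (b a) w)] at h
  rw [C.symm, real_inner_comm]
  linarith

theorem casimir_γ (b : OrthonormalBasis ι ℝ U) (v : U) :
    C.casimir b (C.γ v) = (2 - Fintype.card ι : ℝ) • C.γ v := by
  have h : ∀ a, C.γ (b a) * C.γ v * C.γ (b a)
      = (2 : ℝ) • inner ℝ (b a) v • C.γ (b a) - C.γ v * (C.γ (b a) * C.γ (b a)) := by
    intro a
    have h1 := congrArg (· * C.γ (b a)) (C.anticomm (b a) v)
    simp only [add_mul, smul_mul_assoc, one_mul] at h1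
    rw [← mul_assoc, smul_smul]
    exact eq_sub_of_add_eq h1
  simp only [casimir, h, Finset.sum_sub_distrib, ← Finset.smul_sum, C.sum_inner_smul,
    ← Finset.mul_sum, C.sum_mul_self]
  rw [mul_smul_comm, mul_one]
  module

variable [FiniteDimensional ℝ W]

theorem trace_γ [Nontrivial W] (b : OrthonormalBasis ι ℝ U) (hι : 2 ≤ Fintype.card ι) (u : U) :
    LinearMap.trace ℝ W (C.γ u) = 0 := by
  -- The completeness relation for the identity shows that `γ s` is a scalar, where `s` is dual to
  -- the trace form. Comparing Casimir values then forces `s = 0`.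
  set s : U := ∑ a, LinearMap.trace ℝ W (C.γ (b a)) • b a with hs
  set k : ℝ := 2 + Module.finrank ℝ W - 2 * Fintype.card ι with hk
  have h1 : C.γ s = k • 1 := by
    have h := C.two_casimir_add b (X := 1) (fun _ _ ↦ rfl)
    simp only [casimir, mul_one, C.sum_mul_self, LinearMap.trace_one] at h
    rw [hs, map_sum]
    simp only [map_smul]
    linear_combination (norm := module) h
  have h2 := C.casimir_γ b s
  have hcard : (2 : ℝ) ≤ Fintype.card ι := by exact_mod_cast hι
  have h3 : (k * (2 * Fintype.card ι - 2)) • (1 : Module.End ℝ W) = 0 := by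
    rw [h1] at h2
    simp only [casimir, mul_smul_comm, smul_mul_assoc, mul_one, ← Finset.smul_sum,
      C.sum_mul_self] at h2
    linear_combination (norm := module) h2
  have h4 : k = 0 := by
    rcases smul_eq_zero.1 h3 with h | h
    · rcases mul_eq_zero.1 h with h | h
      · exact h
      · linarith
    · exact absurd h one_ne_zero
  rw [h4, zero_smul] at h1
  have h5 := C.γ_injective h1
  have h6 : ∀ a, LinearMap.trace ℝ W (C.γ (b a)) = 0 := by
    intro a
    have := congrArg (inner ℝ (b a)) h5
    rwa [hs, b.orthonormal.inner_right_fintype, inner_zero_right] at this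
  rw [← b.sum_repr' u]
  simp [h6]

theorem trace_mul (u v : U) :
    LinearMap.trace ℝ W (C.γ u * C.γ v) = inner ℝ u v * Module.finrank ℝ W := by
  have h := congrArg (LinearMap.trace ℝ W) (C.anticomm u v)
  rw [map_add, LinearMap.trace_mul_comm ℝ (C.γ v), map_smul, LinearMap.trace_one, smul_eq_mul] at h
  linarith

end

end CliffordSystem

/-! ### Rigidity of Clifford systems -/

namespace CliffordSystem

variable {U W : Type*} [NormedAddCommGroup U] [InnerProductSpace ℝ U]
  [NormedAddCommGroup W] [InnerProductSpace ℝ W] (C : CliffordSystem U W)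
  {ι : Type*} [Fintype ι]

/-- Clifford systems are infinitesimally rigid: a first-order deformation `τ` of `γ` that preserves
the Clifford relations comes from skew endomorphisms of `W` and `U`. The endomorphism of `W` is a
multiple of `∑ₐ γₐ τₐ`, and that of `U` is a multiple of the trace form of `γ` and `τ`. -/
theorem exists_bracket_of_anticomm [FiniteDimensional ℝ W] [Nontrivial W]
    (b : OrthonormalBasis ι ℝ U)
    (τ : U →ₗ[ℝ] Module.End ℝ W) (hs : ∀ u w w', inner ℝ (τ u w) w' = inner ℝ w (τ u w'))
    (ha : ∀ u, τ u * C.γ u + C.γ u * τ u = 0) :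
    ∃ (F : Module.End ℝ W) (R : Module.End ℝ U), IsSkewMap F ∧ IsSkewMap R ∧
      ∀ v, τ v = F * C.γ v - C.γ v * F - C.γ (R v) := by
  have hpol : ∀ u v, τ u * C.γ v + τ v * C.γ u + C.γ u * τ v + C.γ v * τ u = 0 := by
    intro u v
    have h1 := ha (u + v)
    simp only [map_add, add_mul, mul_add] at h1
    linear_combination (norm := module) h1 - ha u - ha v
  have htr : ∀ u, LinearMap.trace ℝ W (τ u) = 0 := by
    intro u
    have h1 := congrArg (fun X ↦ LinearMap.trace ℝ W (X * C.γ u)) (ha u)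
    simp only [add_mul, map_add, zero_mul, map_zero] at h1
    rw [LinearMap.trace_mul_comm ℝ (C.γ u * τ u), ← mul_assoc (C.γ u), mul_assoc (τ u),
      C.mul_self, smul_mul_assoc, mul_smul_comm, one_mul, mul_one, map_smul, smul_eq_mul] at h1
    have h2 : inner ℝ u u * LinearMap.trace ℝ W (τ u) = 0 := by linarith
    rcases mul_eq_zero.1 h2 with h | h
    · simp [inner_self_eq_zero.1 h]
    · exact h
  -- The trace form: `⟪s u, v⟫ = tr (γ v τ u)`.
  let s : Module.End ℝ U :=
    { toFun v := ∑ a, LinearMap.trace ℝ W (C.γ (b a) * τ v) • b a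
      map_add' u v := by simp [mul_add, add_smul, Finset.sum_add_distrib]
      map_smul' c v := by simp [Finset.smul_sum, smul_smul] }
  have hs_inner : ∀ u v, inner ℝ (s u) v = LinearMap.trace ℝ W (C.γ v * τ u) := by
    intro u v
    rw [← C.sum_inner_smul b v, Finset.sum_mul, map_sum]
    simp [s, sum_inner, inner_smul_left, mul_comm]
  have hs_skew : IsSkewMap s := by
    refine .of_inner_self fun v ↦ ?_
    have h := congrArg (LinearMap.trace ℝ W) (ha v)
    rw [map_add, LinearMap.trace_mul_comm ℝ (τ v), map_zero] at h
    rw [hs_inner]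
    linarith
  have hγs : ∀ v, ∑ a, LinearMap.trace ℝ W (C.γ (b a) * τ v) • C.γ (b a) = C.γ (s v) := by
    intro v
    simp [s]
  set F₀ : Module.End ℝ W := ∑ a, C.γ (b a) * τ (b a) with hF₀
  have hF₀_skew : IsSkewMap F₀ := by
    refine .of_inner_self fun w ↦ ?_
    rw [hF₀, LinearMap.sum_apply, sum_inner]
    refine Finset.sum_eq_zero fun a _ ↦ ?_
    have h := congrArg (fun X : Module.End ℝ W ↦ inner ℝ (X w) w) (ha (b a))
    simp only [LinearMap.add_apply, Module.End.mul_apply, inner_add_left, LinearMap.zero_apply,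
      inner_zero_left] at h
    rw [hs, C.symm, real_inner_comm] at h
    rw [Module.End.mul_apply, C.symm]
    have h' : inner ℝ (C.γ (b a) (τ (b a) w)) w = inner ℝ (τ (b a) w) (C.γ (b a) w) := C.symm ..
    linarith
  have hbr : ∀ v, F₀ * C.γ v - C.γ v * F₀
      = -C.casimir b (τ v) - (Fintype.card ι + 2 : ℝ) • τ v := by
    intro v
    have key : ∀ a, C.γ (b a) * τ (b a) * C.γ v - C.γ v * (C.γ (b a) * τ (b a))
        = -(C.γ (b a) * τ v * C.γ (b a)) - C.γ (b a) * C.γ (b a) * τ v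
          - (2 : ℝ) • (inner ℝ (b a) v • τ (b a)) := by
      intro a
      have h1 := congrArg (C.γ (b a) * ·) (hpol (b a) v)
      have h2 := congrArg (· * τ (b a)) (C.anticomm (b a) v)
      simp only [mul_add, add_mul, mul_zero, smul_mul_assoc, one_mul, ← mul_assoc] at h1 h2 ⊢
      linear_combination (norm := module) h1 - h2
    have h3 : ∑ a, inner ℝ (b a) v • τ (b a) = τ v := by
      conv_rhs => rw [← b.sum_repr' v]
      simp
    rw [hF₀, Finset.sum_mul, Finset.mul_sum, ← Finset.sum_sub_distrib,
      Finset.sum_congr rfl fun a _ ↦ key a, Finset.sum_sub_distrib, Finset.sum_sub_distrib,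
      ← Finset.smul_sum, h3, ← Finset.sum_mul, C.sum_mul_self, smul_mul_assoc, one_mul,
      Finset.sum_neg_distrib]
    simp only [casimir]
    module
  -- The bracket with `F₀` involves the Casimir operator, which the completeness relation evaluates.
  have hcas : ∀ v, (2 : ℝ) • C.casimir b (τ v) + C.γ (s v) = (2 : ℝ) • τ v := by
    intro v
    have := C.two_casimir_add b (hs v)
    rwa [htr, zero_smul, add_zero, hγs] at this
  have hm : (Fintype.card ι + 3 : ℝ) ≠ 0 := by positivity
  refine ⟨(-1 / (Fintype.card ι + 3 : ℝ)) • F₀, (-1 / 2 / (Fintype.card ι + 3 : ℝ)) • s,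
    hF₀_skew.smul _, hs_skew.smul _, fun v ↦ ?_⟩
  have h4 : (Fintype.card ι + 3 : ℝ) • τ v
      = -(F₀ * C.γ v - C.γ v * F₀) + (1 / 2 : ℝ) • C.γ (s v) := by
    rw [hbr]
    linear_combination (norm := module) (-1 / 2 : ℝ) • hcas v
  have h5 := congrArg (((Fintype.card ι + 3 : ℝ)⁻¹) • ·) h4
  simp only [smul_smul, inv_mul_cancel₀ hm, one_smul] at h5
  rw [h5, LinearMap.smul_apply, map_smul, smul_mul_assoc, mul_smul_comm]
  module

/-- An endomorphism `J` commuting with `γ` and such that `[γ u, γ v] J` always lies in the image of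
`γ` vanishes. This fails in rank three, where the product of the three generators is such a `J`. -/
theorem eq_zero_of_bracket_mul [Nontrivial W] (hι : Fintype.card ι = 2 ∨ Fintype.card ι = 5)
    (b : OrthonormalBasis ι ℝ U) {J : Module.End ℝ W}
    (hJ : ∀ u, J * C.γ u = C.γ u * J)
    (h : ∀ u v, ∃ r, (C.γ u * C.γ v - C.γ v * C.γ u) * J = C.γ r) : J = 0 := by
  classical
  have hb : ∀ a, C.γ (b a) * C.γ (b a) = 1 := fun a ↦ by
    rw [C.mul_self, real_inner_self_eq_norm_sq, b.orthonormal.1]; simp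
  have hac : ∀ {a c}, a ≠ c → C.γ (b a) * C.γ (b c) = -(C.γ (b c) * C.γ (b a)) := by
    intro a c hac
    have := C.anticomm (b a) (b c)
    rw [b.orthonormal.2 hac, mul_zero, zero_smul] at this
    exact eq_neg_of_add_eq_zero_left this
  obtain ⟨i, k, hik⟩ : ∃ i k : ι, i ≠ k := by
    have : 1 < Fintype.card ι := by omega
    exact Fintype.one_lt_card_iff.1 this
  obtain ⟨r, hr⟩ := h (b i) (b k)
  have hX : C.γ r = (2 : ℝ) • (C.γ (b i) * C.γ (b k) * J) := by
    rw [← hr, hac hik.symm, sub_mul]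
    simp only [neg_mul]
    module
  -- `γ r` anticommutes with `γ i` and `γ k` and commutes with the remaining `γ c`. There are
  -- either none or at least two of the latter, so `r = 0`.
  have hi : C.γ (b i) * C.γ r + C.γ r * C.γ (b i) = 0 := by
    rw [hX, mul_smul_comm, smul_mul_assoc, mul_assoc _ J, hJ,
      show C.γ (b i) * C.γ (b k) * (C.γ (b i) * J) = C.γ (b i) * (C.γ (b k) * C.γ (b i)) * J by
        simp only [mul_assoc], hac hik.symm]
    simp only [neg_mul, mul_neg, mul_assoc]
    module
  have hk : C.γ (b k) * C.γ r + C.γ r * C.γ (b k) = 0 := by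
    rw [hX, mul_smul_comm, smul_mul_assoc, mul_assoc _ J, hJ, ← mul_assoc, ← mul_assoc,
      hac hik.symm, mul_assoc (C.γ (b i)) (C.γ (b k))]
    simp only [neg_mul, mul_assoc]
    module
  have hc : ∀ c, c ≠ i → c ≠ k → C.γ (b c) * C.γ r = inner ℝ (b c) r • 1 := by
    intro c hci hck
    have h1 : C.γ (b c) * C.γ r = C.γ r * C.γ (b c) := by
      rw [hX, mul_smul_comm, smul_mul_assoc, mul_assoc _ J, hJ, ← mul_assoc, ← mul_assoc,
        hac hci, neg_mul, mul_assoc (C.γ (b i)), hac hck]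
      simp only [mul_neg, mul_assoc, neg_neg]
    have h2 := C.anticomm (b c) r
    rw [← h1] at h2
    linear_combination (norm := module) (1 / 2 : ℝ) • h2
  have coord : ∀ c, C.γ (b c) * C.γ r + C.γ r * C.γ (b c) = 0 → inner ℝ (b c) r = 0 := by
    intro c h0
    rw [C.anticomm, smul_eq_zero] at h0
    have := h0.resolve_right one_ne_zero
    linarith
  have hr0 : r = 0 := by
    have hri := coord i hi
    have hrk := coord k hk
    have hrc : ∀ c, c ≠ i → c ≠ k → inner ℝ (b c) r = 0 := by
      intro c hci hck
      obtain ⟨d, hd⟩ : ∃ d, d ∉ ({i, k, c} : Finset ι) := by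
        by_contra! hall
        have h1 : (Finset.univ : Finset ι) ⊆ {i, k, c} := fun d _ ↦ hall d
        have h2 := Finset.card_le_card h1
        have h3 : ({i, k, c} : Finset ι).card = 3 := by
          rw [Finset.card_eq_three]; exact ⟨i, k, c, hik, hci.symm, hck.symm, rfl⟩
        have h4 := Finset.card_le_univ ({i, k, c} : Finset ι)
        rw [Finset.card_univ] at h2
        omega
      simp only [Finset.mem_insert, Finset.mem_singleton, not_or] at hd
      have h1 := congrArg (C.γ (b c) * ·) (hc c hci hck)
      have h2 := congrArg (C.γ (b d) * ·) (hc d hd.1 hd.2.1)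
      simp only [← mul_assoc, hb, one_mul, mul_smul_comm, mul_one] at h1 h2
      have h3 := C.γ_injective (u := inner ℝ (b c) r • b c - inner ℝ (b d) r • b d)
        (by rw [map_sub, map_smul, map_smul, ← h1, ← h2, sub_self])
      have h4 := congrArg (inner ℝ (b c)) h3
      simpa [inner_sub_right, inner_smul_right, b.orthonormal.1 c,
        b.orthonormal.2 (Ne.symm hd.2.2)] using h4
    rw [← b.sum_repr' r]
    refine Finset.sum_eq_zero fun c _ ↦ ?_
    by_cases hci : c = i
    · rw [hci, hri, zero_smul]
    by_cases hck : c = k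
    · rw [hck, hrk, zero_smul]
    rw [hrc c hci hck, zero_smul]
  have h0 : C.γ (b i) * C.γ (b k) * J = 0 := by
    rw [hr0, map_zero, eq_comm, smul_eq_zero] at hX
    exact hX.resolve_left two_ne_zero
  calc J = C.γ (b k) * (C.γ (b i) * (C.γ (b i) * C.γ (b k) * J)) := by
        rw [← mul_assoc, ← mul_assoc, mul_assoc (C.γ (b k)), ← mul_assoc (C.γ (b i)), hb, one_mul,
          hb, one_mul]
    _ = 0 := by rw [h0]; simp

/-- An alternating `W × W → W` which is linear over the Clifford system vanishes. -/
theorem eq_zero_of_commute (b : OrthonormalBasis ι ℝ U) (hι : 2 ≤ Fintype.card ι)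
    {G : W →ₗ[ℝ] Module.End ℝ W} (hG : ∀ w u, G w * C.γ u = C.γ u * G w)
    (h0 : ∀ w, G w w = 0) : G = 0 := by
  obtain ⟨i, k, hik⟩ : ∃ i k : ι, i ≠ k := Fintype.one_lt_card_iff.1 hι
  set v := b i
  set u := b k
  have hvv : ∀ w, C.γ v (C.γ v w) = w := fun w ↦ by
    rw [C.sq, real_inner_self_eq_norm_sq, b.orthonormal.1]; simp
  have huu : ∀ w, C.γ u (C.γ u w) = w := fun w ↦ by
    rw [C.sq, real_inner_self_eq_norm_sq, b.orthonormal.1]; simp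
  have huv : ∀ w, C.γ v (C.γ u w) = -C.γ u (C.γ v w) := fun w ↦ by
    have := C.anticomm_apply v u w
    rw [b.orthonormal.2 hik, mul_zero, zero_smul] at this
    exact eq_neg_of_add_eq_zero_left this
  have hG' : ∀ w u y, G w (C.γ u y) = C.γ u (G w y) := fun w u y ↦
    LinearMap.congr_fun (hG w u) y
  have hskew : ∀ w y, G w y = -G y w := by
    intro w y
    have := h0 (w + y)
    simp only [map_add, LinearMap.add_apply, h0] at this
    linear_combination (norm := module) this
  -- `G` vanishes on pairs from opposite eigenspaces of `γ v`, which `γ u` exchanges.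
  have h1 : ∀ (ε : ℝ) w y, C.γ v w = ε • w → C.γ v y = (-ε) • y → ε * ε = 1 → G w y = 0 := by
    intro ε w y hw hy hε
    have e1 : C.γ v (G w y) = (-ε) • G w y := by rw [← hG', hy, map_smul]
    have e2 : C.γ v (G w y) = ε • G w y := by
      rw [hskew, map_neg, ← hG', hw, map_smul, smul_neg]
    have e3 : (2 * ε) • G w y = 0 := by linear_combination (norm := module) e1 - e2
    refine (smul_eq_zero.1 e3).resolve_left ?_
    rintro h
    have : ε = 0 := by linarith
    rw [this] at hε
    norm_num at hε
  have h2 : ∀ (ε : ℝ) w y, C.γ v w = ε • w → C.γ v y = ε • y → ε * ε = 1 → G w y = 0 := by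
    intro ε w y hw hy hε
    rw [← huu y, hG', h1 ε w _ hw _ hε, map_zero]
    rw [huv, hy, map_smul]
    module
  have hsplit : ∀ w, ∃ x y, C.γ v x = (1 : ℝ) • x ∧ C.γ v y = (-1 : ℝ) • y ∧ w = x + y := by
    intro w
    refine ⟨(1 / 2 : ℝ) • (w + C.γ v w), (1 / 2 : ℝ) • (w - C.γ v w), ?_, ?_, by module⟩
    · rw [map_smul, map_add, hvv]; module
    · rw [map_smul, map_sub, hvv]; module
  ext w y
  obtain ⟨x₁, x₂, hx₁, hx₂, rfl⟩ := hsplit w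
  obtain ⟨y₁, y₂, hy₁, hy₂, rfl⟩ := hsplit y
  simp only [map_add, LinearMap.add_apply, LinearMap.zero_apply]
  rw [h2 1 x₁ y₁ hx₁ hy₁ (by norm_num), h1 1 x₁ y₂ hx₁ hy₂ (by norm_num),
    h1 (-1) x₂ y₁ hx₂ (by simpa using hy₁) (by norm_num), h2 (-1) x₂ y₂ hx₂ hy₂ (by norm_num)]

end CliffordSystem

/-! ### Skew families acting on a Clifford system -/

namespace CliffordSystem

variable {U W : Type*} [NormedAddCommGroup U] [InnerProductSpace ℝ U]
  [NormedAddCommGroup W] [InnerProductSpace ℝ W] (C : CliffordSystem U W)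
  {ι : Type*} [Fintype ι]

theorem mul_self_basis (b : OrthonormalBasis ι ℝ U) (a : ι) : C.γ (b a) * C.γ (b a) = 1 := by
  rw [C.mul_self, real_inner_self_eq_norm_sq, b.orthonormal.1]; simp

theorem mul_basis_anticomm (b : OrthonormalBasis ι ℝ U) {a c : ι} (h : a ≠ c) :
    C.γ (b a) * C.γ (b c) = -(C.γ (b c) * C.γ (b a)) := by
  have := C.anticomm (b a) (b c)
  rw [b.orthonormal.2 h, mul_zero, zero_smul] at this
  exact eq_neg_of_add_eq_zero_left this

/-- An endomorphism with Casimir value `1` that anticommutes with two of the `γ`s vanishes in rank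
two, and commutes with the three other `γ`s in rank five. -/
theorem commute_of_casimir_eq (hι : Fintype.card ι = 2 ∨ Fintype.card ι = 5)
    (b : OrthonormalBasis ι ℝ U) {a c : ι} (hac : a ≠ c) {X : Module.End ℝ W}
    (hX : C.casimir b X = X) (ha : X * C.γ (b a) + C.γ (b a) * X = 0)
    (hc : X * C.γ (b c) + C.γ (b c) * X = 0) :
    (Fintype.card ι = 2 → X = 0) ∧
      ∀ d, d ≠ a → d ≠ c → X * C.γ (b d) = C.γ (b d) * X := by
  classical
  have conj : ∀ d, X * C.γ (b d) + C.γ (b d) * X = 0 → C.γ (b d) * X * C.γ (b d) = -X := by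
    intro d hd
    rw [mul_assoc, eq_neg_of_add_eq_zero_left hd, mul_neg, ← mul_assoc, C.mul_self_basis, one_mul]
  have hsum : ∑ d ∈ Finset.univ \ {a, c}, C.γ (b d) * X * C.γ (b d) = (3 : ℝ) • X := by
    have h := Finset.sum_sdiff (Finset.subset_univ ({a, c} : Finset ι))
      (f := fun d ↦ C.γ (b d) * X * C.γ (b d))
    rw [Finset.sum_pair hac, conj a ha, conj c hc] at h
    rw [casimir] at hX
    rw [hX] at h
    linear_combination (norm := module) h
  have hcard : (Finset.univ \ {a, c} : Finset ι).card = Fintype.card ι - 2 := by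
    rw [Finset.card_sdiff_of_subset (Finset.subset_univ _), Finset.card_pair hac, Finset.card_univ]
  have h2 : Fintype.card ι = 2 → X = 0 := by
    intro h
    rw [h, Nat.sub_self, Finset.card_eq_zero] at hcard
    rw [hcard, Finset.sum_empty, eq_comm, smul_eq_zero] at hsum
    exact hsum.resolve_left (by norm_num)
  refine ⟨h2, ?_⟩
  rcases hι with h | h
  · intro d _ _
    simp [h2 h]
  -- The three remaining conjugations are commuting involutions whose sum is `3` on `X`.
  rw [h] at hcard
  have hS : (Finset.univ \ {a, c} : Finset ι).card = 3 := hcard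
  let Θ : ι → Module.End ℝ (Module.End ℝ W) := fun d ↦
    LinearMap.mulLeftRight ℝ (C.γ (b d), C.γ (b d))
  have hΘ : ∀ d Y, Θ d Y = C.γ (b d) * Y * C.γ (b d) := fun d Y ↦ by simp [Θ]
  have hΘΘ : ∀ d Y, Θ d (Θ d Y) = Y := by
    intro d Y
    rw [hΘ, hΘ, ← mul_assoc, ← mul_assoc, C.mul_self_basis, one_mul, mul_assoc, C.mul_self_basis,
      mul_one]
  have hΘc : ∀ d e, d ≠ e → ∀ Y, Θ d (Θ e Y) = Θ e (Θ d Y) := by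
    intro d e hde Y
    simp only [hΘ]
    rw [show C.γ (b d) * (C.γ (b e) * Y * C.γ (b e)) * C.γ (b d)
        = (C.γ (b d) * C.γ (b e)) * Y * (C.γ (b e) * C.γ (b d)) by simp only [mul_assoc],
      show C.γ (b e) * (C.γ (b d) * Y * C.γ (b d)) * C.γ (b e)
        = (C.γ (b e) * C.γ (b d)) * Y * (C.γ (b d) * C.γ (b e)) by simp only [mul_assoc],
      C.mul_basis_anticomm b hde, neg_mul, neg_mul, mul_neg]
  intro d hda hdc
  have hd : d ∈ Finset.univ \ {a, c} := by simp [hda, hdc]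
  obtain ⟨e, f, hde, hdf, hef, hset⟩ : ∃ e f, d ≠ e ∧ d ≠ f ∧ e ≠ f ∧
      Finset.univ \ {a, c} = ({d, e, f} : Finset ι) := by
    have h1 : ((Finset.univ \ {a, c}).erase d).card = 2 := by
      rw [Finset.card_erase_of_mem hd, hS]
    obtain ⟨e, f, hef, hs⟩ := Finset.card_eq_two.1 h1
    have he : e ∈ (Finset.univ \ {a, c}).erase d := by simp [hs]
    have hf : f ∈ (Finset.univ \ {a, c}).erase d := by simp [hs]
    refine ⟨e, f, (Finset.ne_of_mem_erase he).symm, (Finset.ne_of_mem_erase hf).symm, hef, ?_⟩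
    rw [← Finset.insert_erase hd, hs]
  rw [hset, Finset.sum_insert (by simp [hde, hdf]), Finset.sum_pair hef, ← hΘ, ← hΘ, ← hΘ,
    ← add_assoc] at hsum
  have key := eq_of_add_involutions_eq_three (hΘΘ d) (hΘΘ e) (hΘΘ f) (hΘc d e hde) (hΘc d f hdf)
    (hΘc e f hef) hsum
  rw [hΘ] at key
  calc X * C.γ (b d) = C.γ (b d) * C.γ (b d) * X * C.γ (b d) := by
        rw [C.mul_self_basis, one_mul]
    _ = C.γ (b d) * (C.γ (b d) * X * C.γ (b d)) := by simp only [mul_assoc]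
    _ = C.γ (b d) * X := by rw [key]

/-- An alternating bilinear map `M` with values in the symmetric endomorphisms of Casimir value `1`,
such that `M u v` anticommutes with `γ v`, has the values `γ a γ c X` on pairs of distinct basis
vectors, with one common `X` in the commutant of `γ`. -/
theorem exists_commutant_of_casimir_eq (hι : Fintype.card ι = 2 ∨ Fintype.card ι = 5)
    (b : OrthonormalBasis ι ℝ U) (M : U →ₗ[ℝ] U →ₗ[ℝ] Module.End ℝ W)
    (hM : ∀ u v, C.casimir b (M u v) = M u v)
    (hsymm : ∀ u v w w', inner ℝ (M u v w) w' = inner ℝ w (M u v w'))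
    (hself : ∀ u, M u u = 0) (ha : ∀ u v, M u v * C.γ v + C.γ v * M u v = 0) :
    ∃ X : Module.End ℝ W, IsSkewMap X ∧ (∀ u, X * C.γ u = C.γ u * X) ∧
      ∀ a c, a ≠ c → M (b a) (b c) = C.γ (b a) * C.γ (b c) * X := by
  classical
  have hanti : ∀ u v, M u v = -M v u := by
    intro u v
    have := hself (u + v)
    simp only [map_add, LinearMap.add_apply, hself] at this
    linear_combination (norm := module) this
  have ha' : ∀ u v, M u v * C.γ u + C.γ u * M u v = 0 := by
    intro u v
    rw [hanti, neg_mul, mul_neg, ← neg_add, ha, neg_zero]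
  have hpol : ∀ u v v', M u v * C.γ v' + C.γ v' * M u v + M u v' * C.γ v + C.γ v * M u v' = 0 := by
    intro u v v'
    have := ha u (v + v')
    simp only [map_add, add_mul, mul_add] at this
    linear_combination (norm := module) this - ha u v - ha u v'
  have hcomm := fun a c (hac : a ≠ c) ↦
    C.commute_of_casimir_eq hι b hac (hM (b a) (b c)) (ha' _ _) (ha _ _)
  -- Each `X a c` commutes with `γ`, and it does not depend on `a` and `c`.
  let X : ι → ι → Module.End ℝ W := fun a c ↦ C.γ (b c) * C.γ (b a) * M (b a) (b c)
  have hb := C.mul_self_basis b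
  have hMX : ∀ a c, M (b a) (b c) = C.γ (b a) * C.γ (b c) * X a c := by
    intro a c
    calc M (b a) (b c) = C.γ (b a) * (C.γ (b c) * C.γ (b c)) * C.γ (b a) * M (b a) (b c) := by
          rw [hb, mul_one, hb, one_mul]
      _ = _ := by simp only [X, mul_assoc]
  have hXγ : ∀ a c, a ≠ c → ∀ u, X a c * C.γ u = C.γ u * X a c := by
    intro a c hac u
    have hbasis : ∀ d, X a c * C.γ (b d) = C.γ (b d) * X a c := by
      intro d
      by_cases hda : d = a
      · subst hda
        have h1 := eq_neg_of_add_eq_zero_left (ha' (b d) (b c))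
        simp only [X]
        rw [mul_assoc, h1, mul_neg, ← mul_assoc, ← mul_assoc, ← mul_assoc, mul_assoc (C.γ (b c)),
          hb, C.mul_basis_anticomm b hac, neg_mul, mul_assoc (C.γ (b c)) (C.γ (b d)), hb, neg_mul]
      by_cases hdc : d = c
      · subst hdc
        have h1 := eq_neg_of_add_eq_zero_left (ha (b a) (b d))
        simp only [X]
        rw [mul_assoc, h1, mul_neg, ← mul_assoc, ← mul_assoc, ← mul_assoc, hb, one_mul,
          mul_assoc (C.γ (b d)), C.mul_basis_anticomm b hac, mul_neg, ← mul_assoc, hb, one_mul,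
          neg_mul, neg_neg]
      · have h1 := (hcomm a c hac).2 d hda hdc
        simp only [X]
        rw [mul_assoc, h1, ← mul_assoc, mul_assoc (C.γ (b c)), C.mul_basis_anticomm b (Ne.symm hda),
          mul_neg, ← mul_assoc, C.mul_basis_anticomm b (Ne.symm hdc)]
        simp only [neg_mul, neg_neg, mul_assoc]
    rw [← C.sum_inner_smul b u, Finset.mul_sum, Finset.sum_mul]
    simp only [mul_smul_comm, smul_mul_assoc, hbasis]
  have hXsymm : ∀ a c, a ≠ c → X a c = X c a := by
    intro a c hac
    simp only [X]
    rw [hanti (b c), C.mul_basis_anticomm b hac, neg_mul_neg]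
  have hXc : ∀ a c d, a ≠ c → a ≠ d → X a c = X a d := by
    intro a c d hac had
    by_cases hcd : c = d
    · rw [hcd]
    have h1 := hpol (b a) (b c) (b d)
    rw [(hcomm a c hac).2 d had.symm (Ne.symm hcd), (hcomm a d had).2 c hac.symm hcd,
      hMX a c, hMX a d] at h1
    have h2 : ∀ Y, C.γ (b d) * (C.γ (b a) * C.γ (b c) * Y)
        = -(C.γ (b a) * (C.γ (b d) * C.γ (b c)) * Y) := by
      intro Y
      rw [← mul_assoc, ← mul_assoc, C.mul_basis_anticomm b had.symm]
      simp only [neg_mul, mul_assoc]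
    have h3 : ∀ Y, C.γ (b c) * (C.γ (b a) * C.γ (b d) * Y)
        = C.γ (b a) * (C.γ (b d) * C.γ (b c)) * Y := by
      intro Y
      rw [← mul_assoc, ← mul_assoc, C.mul_basis_anticomm b hac.symm, neg_mul, mul_assoc (C.γ (b a)),
        C.mul_basis_anticomm b hcd]
      simp only [mul_neg, neg_neg]
    rw [h2, h3] at h1
    have h4 : C.γ (b a) * (C.γ (b d) * C.γ (b c)) * X a c
        = C.γ (b a) * (C.γ (b d) * C.γ (b c)) * X a d := by
      linear_combination (norm := module) (-1 / 2 : ℝ) • h1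
    have h5 : ∀ Y, C.γ (b c) * (C.γ (b d) * (C.γ (b a) * (C.γ (b a) * (C.γ (b d) * C.γ (b c)) * Y)))
        = Y := by
      intro Y
      calc _ = C.γ (b c) * (C.γ (b d) * (C.γ (b a) * C.γ (b a)) * C.γ (b d)) * C.γ (b c) * Y := by
            simp only [mul_assoc]
        _ = Y := by rw [hb, mul_one, hb, mul_one, hb, one_mul]
    rw [← h5 (X a c), h4, h5]
  obtain ⟨i, k, hik⟩ : ∃ i k : ι, i ≠ k := Fintype.one_lt_card_iff.1 (by omega)
  have hall : ∀ a c, a ≠ c → X a c = X i k := by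
    intro a c hac
    by_cases hai : a = i
    · subst hai
      exact hXc a c k hac hik
    · rw [hXc a c i hac hai, hXsymm a i hai, hXc i a k (Ne.symm hai) hik]
  refine ⟨X i k, ?_, hXγ i k hik, fun a c hac ↦ by rw [← hall a c hac, ← hMX]⟩
  intro w w'
  have h1 : X i k = -(M (b i) (b k) * (C.γ (b i) * C.γ (b k))) := by
    simp only [X]
    rw [mul_assoc, eq_neg_of_add_eq_zero_right (ha' _ _), mul_neg, ← mul_assoc,
      eq_neg_of_add_eq_zero_right (ha _ _), C.mul_basis_anticomm b hik]
    simp only [neg_mul, mul_neg, mul_assoc, neg_neg]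
  have h2 : inner ℝ (X i k w) w' = inner ℝ w (M (b i) (b k) (C.γ (b i) (C.γ (b k) w'))) := by
    simp only [X, Module.End.mul_apply]
    rw [C.symm, C.symm, hsymm]
  rw [h2, h1]
  simp

/-- A family of skew endomorphisms `N u` commuting with `γ u` is, up to a multiple of `γ u` by a
fixed element of the commutant, a family of infinitesimal automorphisms of the Clifford system. -/
theorem exists_decomposition_of_commute [FiniteDimensional ℝ W] [Nontrivial W]
    (hι : Fintype.card ι = 2 ∨ Fintype.card ι = 5)
    (b : OrthonormalBasis ι ℝ U) (N : U →ₗ[ℝ] Module.End ℝ W) (hN : ∀ u, IsSkewMap (N u))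
    (hc : ∀ u, N u * C.γ u = C.γ u * N u) :
    ∃ (J : Module.End ℝ W) (R : U →ₗ[ℝ] Module.End ℝ U), IsSkewMap J ∧
      (∀ u, J * C.γ u = C.γ u * J) ∧ (∀ u, IsSkewMap (R u)) ∧ (∀ u, R u u = 0) ∧
      ∀ u v, (N u - C.γ u * J) * C.γ v - C.γ v * (N u - C.γ u * J) = C.γ (R u v) := by
  classical
  have hcard : 2 ≤ Fintype.card ι := by omega
  -- Let `L u v = [N u, γ v]`, and let `γ (r u v)` be its component in the image of `γ`, for the
  -- trace form. The remainder `M` is orthogonal to `1` and to all `γ u`, so the completeness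
  -- relation gives it the Casimir value `1`.
  let L : U →ₗ[ℝ] U →ₗ[ℝ] Module.End ℝ W := LinearMap.mk₂ ℝ
    (fun u v ↦ N u * C.γ v - C.γ v * N u)
    (fun u u' v ↦ by simp only [map_add, add_mul, mul_add]; abel)
    (fun c u v ↦ by simp only [map_smul, smul_mul_assoc, mul_smul_comm, smul_sub])
    (fun u v v' ↦ by simp only [map_add, add_mul, mul_add]; abel)
    (fun c u v ↦ by simp only [map_smul, smul_mul_assoc, mul_smul_comm, smul_sub])
  have hL : ∀ u v, L u v = N u * C.γ v - C.γ v * N u := fun u v ↦ rfl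
  set δ : ℝ := ((Module.finrank ℝ W : ℕ) : ℝ) with hδ_def
  have hδ : δ ≠ 0 := by
    have : 0 < Module.finrank ℝ W := Module.finrank_pos
    positivity
  let r : U →ₗ[ℝ] U →ₗ[ℝ] U := LinearMap.mk₂ ℝ
    (fun u v ↦ ∑ a, (δ⁻¹ * LinearMap.trace ℝ W (C.γ (b a) * L u v)) • b a)
    (fun u u' v ↦ by simp [mul_add, add_smul, Finset.sum_add_distrib])
    (fun c u v ↦ by
      simp only [map_smul, LinearMap.smul_apply, mul_smul_comm, Finset.smul_sum, smul_smul,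
        smul_eq_mul]
      exact Finset.sum_congr rfl fun _ _ ↦ by congr 1; ring)
    (fun u v v' ↦ by simp [mul_add, add_smul, Finset.sum_add_distrib])
    (fun c u v ↦ by
      simp only [map_smul, mul_smul_comm, Finset.smul_sum, smul_smul, smul_eq_mul]
      exact Finset.sum_congr rfl fun _ _ ↦ by congr 1; ring)
  have hr : ∀ u v x, inner ℝ x (r u v) = δ⁻¹ * LinearMap.trace ℝ W (C.γ x * L u v) := by
    intro u v x
    rw [← C.sum_inner_smul b x, Finset.sum_mul, map_sum, Finset.mul_sum]
    simp only [r, LinearMap.mk₂_apply, inner_sum, inner_smul_right, smul_mul_assoc, map_smul,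
      smul_eq_mul]
    exact Finset.sum_congr rfl fun a _ ↦ by rw [real_inner_comm]; ring
  have hLself : ∀ u, L u u = 0 := fun u ↦ by rw [hL, hc, sub_self]
  have hrself : ∀ u, r u u = 0 := fun u ↦ by
    refine ext_inner_left ℝ fun x ↦ ?_
    rw [hr, hLself]; simp
  have hLa : ∀ u v, L u v * C.γ v + C.γ v * L u v = 0 := by
    intro u v
    have h1 : N u * (C.γ v * C.γ v) = C.γ v * C.γ v * N u := by
      rw [C.mul_self, mul_smul_comm, smul_mul_assoc, one_mul, mul_one]
    rw [hL, sub_mul, mul_sub, mul_assoc, h1]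
    simp only [mul_assoc]
    abel
  have hrv : ∀ u v, inner ℝ v (r u v) = 0 := by
    intro u v
    have h1 := congrArg (LinearMap.trace ℝ W) (hLa u v)
    rw [map_add, LinearMap.trace_mul_comm ℝ (L u v), map_zero] at h1
    rw [hr, show LinearMap.trace ℝ W (C.γ v * L u v) = 0 by linarith, mul_zero]
  have hLs : ∀ u v w w', inner ℝ (L u v w) w' = inner ℝ w (L u v w') := by
    intro u v w w'
    simp only [hL, LinearMap.sub_apply, Module.End.mul_apply, inner_sub_left, inner_sub_right]
    linarith [hN u (C.γ v w) w', C.symm v w (N u w'), C.symm v (N u w) w', hN u w (C.γ v w')]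
  have hLtr : ∀ u v, LinearMap.trace ℝ W (L u v) = 0 := by
    intro u v
    rw [hL, map_sub, LinearMap.trace_mul_comm, sub_self]
  let M : U →ₗ[ℝ] U →ₗ[ℝ] Module.End ℝ W := L - r.compr₂ C.γ
  have hM : ∀ u v, M u v = L u v - C.γ (r u v) := fun u v ↦ rfl
  have hMs : ∀ u v w w', inner ℝ (M u v w) w' = inner ℝ w (M u v w') := by
    intro u v w w'
    simp only [hM, LinearMap.sub_apply, inner_sub_left, inner_sub_right, hLs, C.symm]
  have hMcas : ∀ u v, C.casimir b (M u v) = M u v := by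
    intro u v
    have h1 := C.two_casimir_add b (hMs u v)
    have htr : LinearMap.trace ℝ W (M u v) = 0 := by
      rw [hM, map_sub, hLtr, C.trace_γ b hcard, sub_zero]
    have hz : ∀ a, LinearMap.trace ℝ W (C.γ (b a) * M u v) = 0 := by
      intro a
      rw [hM, mul_sub, map_sub, C.trace_mul, hr, mul_comm δ⁻¹, mul_assoc, inv_mul_cancel₀ hδ,
        mul_one, sub_self]
    simp only [hz, htr, zero_smul, Finset.sum_const_zero, add_zero] at h1
    exact smul_right_injective _ (two_ne_zero' ℝ) h1
  have hMself : ∀ u, M u u = 0 := by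
    intro u
    rw [hM, hLself, hrself, map_zero, sub_zero]
  have hMa : ∀ u v, M u v * C.γ v + C.γ v * M u v = 0 := by
    intro u v
    have h1 := C.anticomm v (r u v)
    rw [hrv, mul_zero, zero_smul] at h1
    rw [hM, sub_mul, mul_sub]
    linear_combination (norm := module) hLa u v - h1
  obtain ⟨X, hXskew, hXγ, hX⟩ := C.exists_commutant_of_casimir_eq hι b M hMcas hMs hMself hMa
  refine ⟨(1 / 2 : ℝ) • X, r, hXskew.smul _, fun u ↦ ?_, fun u ↦ ?_, hrself, ?_⟩
  · rw [smul_mul_assoc, hXγ, mul_smul_comm]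
  · exact .of_inner_self fun v ↦ by rw [real_inner_comm, hrv]
  -- By bilinearity it is enough to compare on basis vectors.
  have hbil : M = LinearMap.mk₂ ℝ
      (fun u v ↦ (1 / 2 : ℝ) • (C.γ u * X * C.γ v - C.γ v * (C.γ u * X)))
      (fun u u' v ↦ by simp only [map_add, add_mul, mul_add]; module)
      (fun c u v ↦ by simp only [map_smul, smul_mul_assoc, mul_smul_comm]; module)
      (fun u v v' ↦ by simp only [map_add, add_mul, mul_add]; module)
      (fun c u v ↦ by simp only [map_smul, smul_mul_assoc, mul_smul_comm]; module) := by
    refine b.toBasis.ext fun a ↦ b.toBasis.ext fun c ↦ ?_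
    simp only [OrthonormalBasis.coe_toBasis, LinearMap.mk₂_apply]
    by_cases hac : a = c
    · subst hac
      rw [hM, hLself, hrself, map_zero, mul_assoc, hXγ, sub_self, sub_self, smul_zero]
    · rw [hX a c hac, mul_assoc (C.γ (b a)) X, hXγ, ← mul_assoc, ← mul_assoc,
        C.mul_basis_anticomm b (Ne.symm hac), neg_mul]
      module
  intro u v
  have h1 := LinearMap.congr_fun₂ hbil u v
  rw [LinearMap.mk₂_apply, hM, hL] at h1
  rw [mul_smul_comm, sub_mul, mul_sub, smul_mul_assoc, mul_smul_comm]
  linear_combination (norm := module) h1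

/-- If the skew endomorphisms `N u` move `γ u` only within the image of `γ`, namely to
`γ (ρ u u)`, then `N u` is an infinitesimal automorphism of the Clifford system up to a term `γ u J`
with `J` in the commutant of `γ`. -/
theorem exists_decomposition [FiniteDimensional ℝ U] [FiniteDimensional ℝ W] [Nontrivial W]
    (hι : Fintype.card ι = 2 ∨ Fintype.card ι = 5)
    (b : OrthonormalBasis ι ℝ U) (N : U →ₗ[ℝ] Module.End ℝ W) (hN : ∀ u, IsSkewMap (N u))
    (ρ : U →ₗ[ℝ] U →ₗ[ℝ] U) (hρ : ∀ u v, ρ u v = ρ v u) (hρ0 : ∀ u, inner ℝ (ρ u u) u = 0)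
    (h : ∀ u w, inner ℝ (C.γ (ρ u u) w) w + 2 * inner ℝ (N u w) (C.γ u w) = 0) :
    ∃ (J : Module.End ℝ W) (R : U →ₗ[ℝ] Module.End ℝ U) (N' : U →ₗ[ℝ] Module.End ℝ W),
      IsSkewMap J ∧ (∀ u, J * C.γ u = C.γ u * J) ∧ (∀ u, IsSkewMap (R u)) ∧
      (∀ u, IsSkewMap (N' u)) ∧ (∀ u, R u u = ρ u u) ∧ (∀ u, N u = N' u + C.γ u * J) ∧
      ∀ u v, N' u * C.γ v - C.γ v * N' u = C.γ (R u v) := by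
  have hpol : ∀ u v, inner ℝ (ρ u u) v + 2 * inner ℝ (ρ u v) u = 0 := by
    intro u v
    have h1 := hρ0 (u + v)
    have h2 := hρ0 (u - v)
    simp only [map_add, map_sub, LinearMap.add_apply, LinearMap.sub_apply, inner_add_left,
      inner_add_right, inner_sub_left, inner_sub_right, hρ0, hρ v u] at h1 h2
    linarith
  -- A skew family `R` with `R u u = ρ u u`. Subtracting its spin lift from `N` reduces to `ρ = 0`.
  let R : U →ₗ[ℝ] Module.End ℝ U := LinearMap.mk₂ ℝ
    (fun u v ↦ (2 / 3 : ℝ) • (ρ u v - LinearMap.adjoint (ρ u) v))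
    (fun u u' v ↦ by simp only [map_add, LinearMap.add_apply]; module)
    (fun c u v ↦ by simp [smul_sub, smul_smul, mul_comm])
    (fun u v v' ↦ by simp only [map_add]; module)
    (fun c u v ↦ by simp only [map_smul]; module)
  have hR : ∀ u v, R u v = (2 / 3 : ℝ) • (ρ u v - LinearMap.adjoint (ρ u) v) := fun u v ↦ rfl
  have hRskew : ∀ u, IsSkewMap (R u) := by
    refine fun u ↦ .of_inner_self fun v ↦ ?_
    rw [hR, inner_smul_left, inner_sub_left, LinearMap.adjoint_inner_left, real_inner_comm (ρ u v)]
    simp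
  have hRρ : ∀ u, R u u = ρ u u := by
    refine fun u ↦ ext_inner_right ℝ fun v ↦ ?_
    rw [hR, inner_smul_left, inner_sub_left, LinearMap.adjoint_inner_left,
      real_inner_comm (ρ u v) u]
    have := hpol u v
    simp only [conj_trivial]
    linarith
  let N₁ : U →ₗ[ℝ] Module.End ℝ W := N - (C.spinLift b).comp R
  have hN₁ : ∀ u, N₁ u = N u - C.spinLift b (R u) := fun u ↦ rfl
  have hN₁skew : ∀ u, IsSkewMap (N₁ u) := fun u ↦ (hN u).sub (C.spinLift_skew b (hRskew u))
  obtain ⟨J, R', hJ, hJγ, hR'skew, hR'0, hR'⟩ := C.exists_decomposition_of_commute hι b N₁ hN₁skew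
    (by
      intro u
      have h0 : ∀ w, inner ℝ (N₁ u w) (C.γ u w) = 0 := by
        intro w
        have h1 := h u w
        have h2 := congrArg (fun X : Module.End ℝ W ↦ inner ℝ (X w) w)
          (C.spinLift_bracket b (hRskew u) u)
        simp only [LinearMap.sub_apply, Module.End.mul_apply, inner_sub_left, hRρ] at h2
        have h3 : inner ℝ (C.γ u (C.spinLift b (R u) w)) w
          = inner ℝ (C.spinLift b (R u) w) (C.γ u w) := C.symm ..
        rw [C.spinLift_skew b (hRskew u), real_inner_comm (C.spinLift b (R u) w)] at h2
        rw [hN₁, LinearMap.sub_apply, inner_sub_left]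
        linarith
      ext w
      refine ext_inner_right ℝ fun w' ↦ ?_
      have h1 := h0 (w + w')
      simp only [map_add, inner_add_left, inner_add_right, h0] at h1
      have h2 : inner ℝ (C.γ u (N₁ u w)) w' = inner ℝ (N₁ u w) (C.γ u w') := C.symm ..
      have h3 := hN₁skew u (C.γ u w) w'
      rw [real_inner_comm] at h1
      rw [Module.End.mul_apply, Module.End.mul_apply]
      linarith)
  refine ⟨J, R + R', N - (LinearMap.mulRight ℝ J).comp C.γ, hJ, hJγ,
    fun u ↦ (hRskew u).add (hR'skew u), fun u ↦ (hN u).sub ?_, fun u ↦ ?_, fun u ↦ ?_, fun u v ↦ ?_⟩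
  · refine .of_inner_self fun w ↦ ?_
    have h1 := LinearMap.congr_fun (hJγ u) w
    simp only [Module.End.mul_apply] at h1
    have h2 : inner ℝ (C.γ u (J w)) w = inner ℝ (J w) (C.γ u w) := C.symm ..
    have h3 := hJ w (C.γ u w)
    rw [h1, real_inner_comm (C.γ u (J w)) w] at h3
    simp only [LinearMap.comp_apply, LinearMap.mulRight_apply, Module.End.mul_apply]
    linarith
  · simp [hRρ, hR'0]
  · simp
  · have h1 := hR' u v
    have h2 := C.spinLift_bracket b (hRskew u) v
    rw [hN₁] at h1
    simp only [LinearMap.sub_apply, LinearMap.comp_apply, LinearMap.mulRight_apply,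
      LinearMap.add_apply, map_add]
    rw [← h1, ← h2]
    simp only [sub_mul, mul_sub]
    abel

end CliffordSystem

/-! ### Quadratic maps orthogonal to a Clifford system -/

namespace CliffordSystem

variable {U W : Type*} [NormedAddCommGroup U] [InnerProductSpace ℝ U]
  [NormedAddCommGroup W] [InnerProductSpace ℝ W] (C : CliffordSystem U W)
  {ι : Type*} [Fintype ι]

theorem γ_γ_basis (b : OrthonormalBasis ι ℝ U) (a : ι) (w : W) :
    C.γ (b a) (C.γ (b a) w) = w :=
  LinearMap.congr_fun (C.mul_self_basis b a) w

theorem γ_basis_swap (b : OrthonormalBasis ι ℝ U) {a c : ι} (h : a ≠ c) (w : W) :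
    C.γ (b a) (C.γ (b c) w) = -C.γ (b c) (C.γ (b a) w) :=
  LinearMap.congr_fun (C.mul_basis_anticomm b h) w

theorem inner_γ_γ_basis_self (b : OrthonormalBasis ι ℝ U) {a c : ι} (h : a ≠ c) (w : W) :
    inner ℝ (C.γ (b a) w) (C.γ (b c) w) = 0 := by
  have h1 := C.symm (b a) w (C.γ (b c) w)
  have h2 := C.symm (b c) w (C.γ (b a) w)
  rw [C.γ_basis_swap b h, inner_neg_right] at h1
  have h3 := real_inner_comm (C.γ (b a) w) (C.γ (b c) w)
  linarith

/-- If `w` and `y` lie in opposite eigenspaces of `γ v` for a basis vector `v`, then `y` is a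
combination of the `γ u w` with `u` orthogonal to `v`. -/
theorem eq_sum_γ_of_opposite (b : OrthonormalBasis ι ℝ U) {i : ι} {ε : ℝ} (hε : ε * ε = 1)
    {w y : W} (hw : C.γ (b i) w = ε • w) (hy : C.γ (b i) y = (-ε) • y) :
    inner ℝ (C.γ (b i) w) y = 0 ∧
      inner ℝ w w • y = ∑ j, inner ℝ (C.γ (b j) w) y • C.γ (b j) w := by
  classical
  have hwy : inner ℝ w y = 0 := by
    have h := C.symm (b i) w y
    rw [hw, hy, inner_smul_left, inner_smul_right, conj_trivial] at h
    have h2 : (2 * ε) * inner ℝ w y = 0 := by linarith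
    have hε0 : ε ≠ 0 := by rintro rfl; norm_num at hε
    simpa [hε0] using h2
  refine ⟨by rw [hw, inner_smul_left, hwy, mul_zero], ?_⟩
  have hq : C.q w w = (ε * inner ℝ w w) • b i := by
    rw [C.q_eq_sum b, Finset.sum_eq_single i]
    · rw [hw, inner_smul_left, conj_trivial]
    · intro j _ hji
      have h1 := C.symm (b j) w (C.γ (b i) w)
      have h2 := C.inner_γ_γ_basis_self b hji w
      rw [hw, inner_smul_right] at h2
      have hε0 : ε ≠ 0 := by rintro rfl; norm_num at hε
      rw [(mul_eq_zero.1 h2).resolve_left hε0, zero_smul]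
    · simp
  have h := C.fierz_polar w w y
  rw [C.q_comm y w, hq, map_smul, LinearMap.smul_apply, hy, hwy, real_inner_comm w y, hwy,
    C.q_eq_sum b w y] at h
  simp only [map_sum, map_smul, LinearMap.sum_apply, LinearMap.smul_apply] at h
  have h3 : (ε * inner ℝ w w) • (-ε) • y = -(inner ℝ w w • y) := by
    rw [smul_smul, ← neg_smul]
    congr 1
    linear_combination (-inner ℝ w w) * hε
  rw [h3] at h
  linear_combination (norm := module) (-1 / 2 : ℝ) • h

/-- In rank five, on an eigenspace of one basis vector the product of three further ones is a fixed
multiple of the last one. -/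
theorem triple_product (hι : Fintype.card ι = 5) (b : OrthonormalBasis ι ℝ U) {i c f j : ι}
    (hic : i ≠ c) (hif : i ≠ f) (hij : i ≠ j) (hcf : c ≠ f) (hcj : c ≠ j) (hfj : f ≠ j)
    {ε : ℝ} (hε : ε * ε = 1) {w z : W} (hw : C.γ (b i) w = ε • w) (hz : C.γ (b i) z = ε • z)
    (hwz : inner ℝ w z = 0) :
    ∃ (e : ι) (μ : ℝ), e ≠ i ∧ C.γ (b c) (C.γ (b f) (C.γ (b j) w)) = μ • C.γ (b e) w ∧
      C.γ (b c) (C.γ (b f) (C.γ (b j) z)) = μ • C.γ (b e) z := by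
  classical
  obtain ⟨e, he⟩ : ∃ e, Finset.univ \ {i, c, f, j} = ({e} : Finset ι) := by
    rw [← Finset.card_eq_one, Finset.card_sdiff_of_subset (Finset.subset_univ _), Finset.card_univ,
      hι]
    simp [hic, hif, hij, hcf, hcj, hfj]
  have hmem : ∀ d, d ≠ i → d ≠ c → d ≠ f → d ≠ j → d = e := by
    intro d h1 h2 h3 h4
    rw [← Finset.mem_singleton, ← he]
    simp [h1, h2, h3, h4]
  have hei : e ∉ ({i, c, f, j} : Finset ι) := by
    have : e ∈ Finset.univ \ {i, c, f, j} := by rw [he]; simp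
    exact (Finset.mem_sdiff.1 this).2
  simp only [Finset.mem_insert, Finset.mem_singleton, not_or] at hei
  set K : W → W := fun x ↦ C.γ (b c) (C.γ (b f) (C.γ (b j) x)) with hK
  -- Every vector of the eigenspace is an eigenvector of `γ e K`.
  have hKx : ∀ x, C.γ (b i) x = ε • x →
      inner ℝ x x • K x = inner ℝ (C.γ (b e) x) (K x) • C.γ (b e) x := by
    intro x hx
    have hKi : C.γ (b i) (K x) = (-ε) • K x := by
      simp only [hK]
      rw [C.γ_basis_swap b hic, C.γ_basis_swap b hif, C.γ_basis_swap b hij, hx]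
      simp only [map_neg, map_smul, neg_neg, neg_smul]
    obtain ⟨h0, hsum⟩ := C.eq_sum_γ_of_opposite b hε hx hKi
    rw [hsum, Finset.sum_eq_single e]
    · intro d _ hde
      suffices inner ℝ (C.γ (b d) x) (K x) = 0 by rw [this, zero_smul]
      by_cases hdi : d = i
      · rw [hdi, h0]
      by_cases hdc : d = c
      · subst hdc
        simp only [hK]
        rw [C.symm, C.γ_γ_basis, ← C.symm, C.inner_γ_γ_basis_self b hfj]
      by_cases hdf : d = f
      · subst hdf
        simp only [hK]
        rw [C.symm, C.γ_basis_swap b hdc, C.γ_γ_basis, inner_neg_right, ← C.symm,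
          C.inner_γ_γ_basis_self b hcj, neg_zero]
      by_cases hdj : d = j
      · subst hdj
        simp only [hK]
        rw [C.symm, C.γ_basis_swap b hdc, C.γ_basis_swap b hdf, map_neg, neg_neg, C.γ_γ_basis,
          ← C.symm, C.inner_γ_γ_basis_self b hcf]
      · exact absurd (hmem d hdi hdc hdf hdj) hde
    · simp
  have hKadd : K (w + z) = K w + K z := by simp [hK]
  have hwz' : inner ℝ (w + z) (w + z) = inner ℝ w w + inner ℝ z z := by
    rw [inner_add_left, inner_add_right, inner_add_right, hwz, real_inner_comm w z,
      hwz]; ring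
  have hγ : ∀ x y, inner ℝ (C.γ (b e) x) (C.γ (b e) y) = inner ℝ x y := fun x y ↦ by
    rw [C.symm, C.γ_γ_basis]
  by_cases hw0 : w = 0
  · by_cases hz0 : z = 0
    · exact ⟨e, 0, hei.1, by simp [hw0], by simp [hz0]⟩
    · refine ⟨e, (inner ℝ z z)⁻¹ * inner ℝ (C.γ (b e) z) (K z), hei.1, by simp [hw0], ?_⟩
      rw [mul_smul, ← hKx z hz, smul_smul, inv_mul_cancel₀ (inner_self_ne_zero.2 hz0), one_smul]
  have hww := inner_self_ne_zero (𝕜 := ℝ).2 hw0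
  set μ := (inner ℝ w w)⁻¹ * inner ℝ (C.γ (b e) w) (K w) with hμ
  have hKw : K w = μ • C.γ (b e) w := by
    rw [mul_smul, ← hKx w hw, smul_smul, inv_mul_cancel₀ hww, one_smul]
  refine ⟨e, μ, hei.1, hKw, ?_⟩
  by_cases hz0 : z = 0
  · simp [hz0]
  have hzz := inner_self_ne_zero (𝕜 := ℝ).2 hz0
  have h1 := hKx (w + z) (by rw [map_add, hw, hz, smul_add])
  set ν := inner ℝ (C.γ (b e) (w + z)) (K (w + z))
  obtain ⟨κ, hκ⟩ : ∃ κ, K z = κ • C.γ (b e) z :=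
    ⟨(inner ℝ z z)⁻¹ * inner ℝ (C.γ (b e) z) (K z), by
      rw [mul_smul, ← hKx z hz, smul_smul, inv_mul_cancel₀ hzz, one_smul]⟩
  rw [hKadd, hKw, hκ, hwz', map_add] at h1
  have h2 := congrArg (inner ℝ (C.γ (b e) w)) h1
  have h3 := congrArg (inner ℝ (C.γ (b e) z)) h1
  simp only [inner_smul_right, inner_add_right, hγ, hwz, real_inner_comm w z, mul_zero, add_zero,
    zero_add] at h2 h3
  have hpos : inner ℝ w w + inner ℝ z z ≠ 0 := by
    have h1 := real_inner_self_nonneg (x := z)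
    have h2 := lt_of_le_of_ne real_inner_self_nonneg hww.symm
    exact (add_pos_of_pos_of_nonneg h2 h1).ne'
  have h4 : (inner ℝ w w + inner ℝ z z) * μ = ν := by
    apply mul_right_cancel₀ hww; linarith
  have h5 : (inner ℝ w w + inner ℝ z z) * κ = ν := by
    apply mul_right_cancel₀ hzz; linarith
  have h6 : κ = μ := mul_left_cancel₀ hpos (h5.trans h4.symm)
  change K z = _
  rw [hκ, h6]

/-- The contribution of one eigenspace of `γ v`, for a basis vector `v`, to the commutant-valued
linear map of `exists_commutant_of_inner_eq_zero`. For `w` in this eigenspace, `η w` determines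
`G w` on the opposite eigenspace, and conjugation by a second `γ f` transports it to the whole of
`W`. -/
theorem exists_commutant_of_eigenspace (hι : Fintype.card ι = 2 ∨ Fintype.card ι = 5)
    (b : OrthonormalBasis ι ℝ U) {i f : ι} (hif : i ≠ f) {ε : ℝ} (hε : ε * ε = 1)
    (η : W →ₗ[ℝ] W →ₗ[ℝ] W) (hη : ∀ w y, η w y = η y w)
    (h : ∀ u w, inner ℝ (η w w) (C.γ u w) = 0) :
    ∃ G : W →ₗ[ℝ] Module.End ℝ W, (∀ w, IsSkewMap (G w)) ∧ (∀ w u, G w * C.γ u = C.γ u * G w) ∧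
      (∀ w, C.γ (b i) w = ε • w → G w w = η w w) ∧
      (∀ w, C.γ (b i) w = (-ε) • w → G w = 0) ∧
      ∀ w y, C.γ (b i) w = ε • w → C.γ (b i) y = (-ε) • y →
        G w y = η w y - ε • C.γ (b i) (η w y) := by
  classical
  have hε0 : ε ≠ 0 := by rintro rfl; norm_num at hε
  have h0 : ∀ w, inner ℝ (η w w) w = 0 := by
    intro w
    have h1 := h (C.q w w) w
    rw [C.fierz, inner_smul_right] at h1
    rcases mul_eq_zero.1 h1 with h1 | h1
    · rw [inner_self_eq_zero.1 h1]; simp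
    · exact h1
  have hpol : ∀ u w y, inner ℝ (η w w) (C.γ u y) + 2 * inner ℝ (η w y) (C.γ u w) = 0 := by
    intro u w y
    have h1 := h u (w + y)
    have h2 := h u (w - y)
    simp only [map_add, map_sub, LinearMap.add_apply, LinearMap.sub_apply, inner_add_left,
      inner_add_right, inner_sub_left, inner_sub_right, h, hη y w] at h1 h2
    linarith
  have hpol0 : ∀ w y, inner ℝ (η w w) y + 2 * inner ℝ (η w y) w = 0 := by
    intro w y
    have h1 := h0 (w + y)
    have h2 := h0 (w - y)
    simp only [map_add, map_sub, LinearMap.add_apply, LinearMap.sub_apply, inner_add_left,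
      inner_add_right, inner_sub_left, inner_sub_right, h0, hη y w] at h1 h2
    linarith
  have hcross : ∀ (δ : ℝ) (w y : W), δ ≠ 0 → C.γ (b i) w = δ • w → C.γ (b i) y = (-δ) • y →
      inner ℝ (η w w) y = 0 ∧ inner ℝ (η w y) w = 0 := by
    intro δ w y hδ hw hy
    have h1 := hpol (b i) w y
    rw [hw, hy, inner_smul_right, inner_smul_right] at h1
    have h2 := hpol0 w y
    have h3 : δ * (inner ℝ (η w y) w) = 0 := by linear_combination (1 / 4 : ℝ) * h1 + δ / 4 * h2
    have h4 := (mul_eq_zero.1 h3).resolve_left hδ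
    exact ⟨by linarith, h4⟩
  -- The projections onto the two eigenspaces of `γ v`.
  let P : Module.End ℝ W := (1 / 2 : ℝ) • (1 + ε • C.γ (b i))
  let P' : Module.End ℝ W := (1 / 2 : ℝ) • (1 - ε • C.γ (b i))
  have hP : ∀ w, P w = (1 / 2 : ℝ) • (w + ε • C.γ (b i) w) := fun w ↦ rfl
  have hP' : ∀ w, P' w = (1 / 2 : ℝ) • (w - ε • C.γ (b i) w) := fun w ↦ rfl
  have hvv := C.γ_γ_basis b i
  have hPe : ∀ w, C.γ (b i) (P w) = ε • P w := by
    intro w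
    rw [hP, map_smul, map_add, map_smul, hvv]
    linear_combination (norm := module) (-1 / 2 : ℝ) • congrArg (· • C.γ (b i) w) hε
  have hP'e : ∀ w, C.γ (b i) (P' w) = (-ε) • P' w := by
    intro w
    rw [hP', map_smul, map_sub, map_smul, hvv]
    linear_combination (norm := module) (-1 / 2 : ℝ) • congrArg (· • C.γ (b i) w) hε
  have hPof : ∀ w, C.γ (b i) w = ε • w → P w = w := by
    intro w hw
    rw [hP, hw, smul_smul, hε]; module
  have hPof' : ∀ w, C.γ (b i) w = (-ε) • w → P w = 0 := by
    intro w hw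
    rw [hP, hw, smul_smul, mul_neg, hε]; module
  have hP'of : ∀ w, C.γ (b i) w = (-ε) • w → P' w = w := by
    intro w hw
    rw [hP', hw, smul_smul, mul_neg, hε]; module
  have hP'of' : ∀ w, C.γ (b i) w = ε • w → P' w = 0 := by
    intro w hw
    rw [hP', hw, smul_smul, hε]; module
  have hPP' : ∀ w, w = P w + P' w := by
    intro w
    rw [hP, hP']; module
  have hP's : ∀ w y, inner ℝ (P' w) y = inner ℝ w (P' y) := by
    intro w y
    simp only [hP', inner_smul_left, inner_smul_right, inner_sub_left, inner_sub_right, C.symm,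
      conj_trivial]
  have hswap : ∀ {j} (δ : ℝ) (w : W), j ≠ i → C.γ (b i) w = δ • w →
      C.γ (b i) (C.γ (b j) w) = (-δ) • C.γ (b j) w := by
    intro j δ w hj hw
    rw [C.γ_basis_swap b hj.symm, hw, map_smul, neg_smul]
  -- `Q w = P' η(P w) P'` is the part of `η` on pairs from opposite eigenspaces.
  let Q : W →ₗ[ℝ] Module.End ℝ W :=
    ((LinearMap.mulRight ℝ P').comp (LinearMap.mulLeft ℝ P')).comp (η.comp P)
  have hQ : ∀ w y, Q w y = P' (η (P w) (P' y)) := fun w y ↦ rfl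
  have hQskew : ∀ w, IsSkewMap (Q w) := by
    refine fun w ↦ .of_inner_self fun y ↦ ?_
    rw [hQ, hP's, hη]
    exact (hcross (-ε) _ _ (neg_ne_zero.2 hε0) (hP'e y) (by rw [neg_neg]; exact hPe w)).2
  have hQe : ∀ w y, C.γ (b i) (Q w y) = (-ε) • Q w y := fun w y ↦ by rw [hQ, hP'e]
  have hQ0 : ∀ w y, C.γ (b i) y = ε • y → Q w y = 0 := fun w y hy ↦ by
    rw [hQ, hP'of' y hy]; simp
  -- The relation `2 Q w (γ u w) = γ u (η w w)` for `w` in the eigenspace and `u` orthogonal to `v`.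
  have hkey : ∀ {j} (w : W), j ≠ i → (2 : ℝ) • Q w (C.γ (b j) (P w)) = C.γ (b j) (η (P w) (P w)) := by
    intro j w hj
    refine ext_inner_right ℝ fun y ↦ ?_
    have h1 := hpol (b j) (P w) (P' y)
    have h2 := hQskew w (C.γ (b j) (P w)) y
    have h3 : inner ℝ (C.γ (b j) (P w)) (Q w y) = inner ℝ (η (P w) (P' y)) (C.γ (b j) (P w)) := by
      rw [hQ, ← hP's, hP'of _ (hswap ε _ hj (hPe w)), real_inner_comm]
    have h4 := (hcross ε (P w) (C.γ (b j) (P y)) hε0 (hPe w) (hswap ε _ hj (hPe y))).1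
    have h5 : inner ℝ (C.γ (b j) (η (P w) (P w))) y
        = inner ℝ (η (P w) (P w)) (C.γ (b j) (P y)) + inner ℝ (η (P w) (P w)) (C.γ (b j) (P' y)) := by
      rw [← inner_add_right, ← map_add, ← hPP', C.symm]
    rw [inner_smul_left, conj_trivial, h5, h4, h2, h3]
    linarith
  have hηe : ∀ w, C.γ (b i) (η (P w) (P w)) = ε • η (P w) (P w) := by
    intro w
    have h1 : P' (η (P w) (P w)) = 0 := by
      refine ext_inner_right ℝ fun y ↦ ?_
      rw [hP's, inner_zero_left]
      exact (hcross ε _ _ hε0 (hPe w) (hP'e y)).1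
    rw [hPP' (η (P w) (P w)), h1, add_zero, hPe]
  have hff := C.γ_γ_basis b f
  -- `Q w` commutes with the products `γ c γ f`: by the previous relation on vectors `γ j w`, which
  -- span the opposite eigenspace.
  have hcomm : ∀ c, c ≠ i → c ≠ f → ∀ w y,
      Q w (C.γ (b c) (C.γ (b f) y)) = C.γ (b c) (C.γ (b f) (Q w y)) := by
    intro c hci hcf w y
    have hcc := C.γ_γ_basis b c
    by_cases hw0 : P w = 0
    · simp [hQ, hw0]
    have hww := inner_self_ne_zero (𝕜 := ℝ).2 hw0
    have main : ∀ j, j ≠ i → (2 : ℝ) • Q w (C.γ (b c) (C.γ (b f) (C.γ (b j) (P w))))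
        = C.γ (b c) (C.γ (b f) (C.γ (b j) (η (P w) (P w)))) := by
      intro j hj
      by_cases hjf : j = f
      · rw [hjf, hff, hff, hkey w hci]
      by_cases hjc : j = c
      · rw [hjc, C.γ_basis_swap b (Ne.symm hcf), C.γ_basis_swap b (Ne.symm hcf)]
        simp only [map_neg, hcc, smul_neg, hkey w hif.symm]
      · have h5 : Fintype.card ι = 5 := by
          refine hι.resolve_left fun h2 ↦ ?_
          have := Finset.card_le_univ ({i, c, f} : Finset ι)
          rw [Finset.card_eq_three.2 ⟨i, c, f, hci.symm, hif, hcf, rfl⟩] at this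
          omega
        obtain ⟨e, μ, hei, h1, h2⟩ := C.triple_product h5 b hci.symm hif (Ne.symm hj) hcf
          (Ne.symm hjc) (Ne.symm hjf) hε (hPe w) (hηe w) (by rw [real_inner_comm]; exact h0 _)
        rw [h1, h2, map_smul, ← hkey w hei, smul_comm]
    have hopp : ∀ y, C.γ (b i) y = (-ε) • y →
        Q w (C.γ (b c) (C.γ (b f) y)) = C.γ (b c) (C.γ (b f) (Q w y)) := by
      intro y hy
      obtain ⟨hi0, hsum⟩ := C.eq_sum_γ_of_opposite b hε (hPe w) hy
      have h1 : inner ℝ (P w) (P w) • Q w (C.γ (b c) (C.γ (b f) y))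
          = inner ℝ (P w) (P w) • C.γ (b c) (C.γ (b f) (Q w y)) := by
        simp only [← map_smul]
        rw [hsum]
        simp only [map_sum, map_smul]
        refine Finset.sum_congr rfl fun j _ ↦ ?_
        by_cases hj : j = i
        · rw [hj, hi0, zero_smul, zero_smul]
        congr 1
        have h2 := main j hj
        rw [← hkey w hj, map_smul, map_smul] at h2
        exact smul_right_injective _ (two_ne_zero' ℝ) h2
      exact smul_right_injective _ hww h1
    have h1 : Q w (C.γ (b c) (C.γ (b f) (P y))) = 0 := by
      refine hQ0 _ _ ?_
      have := hswap (-ε) _ hci (hswap ε _ hif.symm (hPe y))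
      rwa [neg_neg] at this
    rw [hPP' y]
    simp only [map_add]
    rw [h1, hopp _ (hP'e y), hQ0 _ _ (hPe y)]
    simp
  have hQapp : ∀ w y, C.γ (b i) w = ε • w → C.γ (b i) y = (-ε) • y →
      (2 : ℝ) • Q w y = η w y - ε • C.γ (b i) (η w y) := by
    intro w y hw hy
    rw [hQ, hPof w hw, hP'of y hy, hP']
    module
  let G : W →ₗ[ℝ] Module.End ℝ W :=
    (2 : ℝ) • (Q + ((LinearMap.mulRight ℝ (C.γ (b f))).comp (LinearMap.mulLeft ℝ (C.γ (b f)))).comp Q)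
  have hG : ∀ w y, G w y = (2 : ℝ) • (Q w y + C.γ (b f) (Q w (C.γ (b f) y))) := fun w y ↦ rfl
  refine ⟨G, fun w ↦ .of_inner_self fun y ↦ ?_, fun w u ↦ ?_, fun w hw ↦ ?_, fun w hw ↦ ?_,
    fun w y hw hy ↦ ?_⟩
  · rw [hG, inner_smul_left, inner_add_left, C.symm, (hQskew w).inner_self, (hQskew w).inner_self]
    simp
  · have hb : ∀ j, G w * C.γ (b j) = C.γ (b j) * G w := by
      intro j
      ext y
      simp only [Module.End.mul_apply, hG, map_smul, map_add]
      congr 1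
      by_cases hji : j = i
      · have hQv : ∀ y, Q w (C.γ (b i) y) = (-ε) • Q w y := by
          intro y
          conv_lhs => rw [hPP' y, map_add, hPe, hP'e, map_add, map_smul, hQ0 _ _ (hPe y)]
          conv_rhs => rw [hPP' y, map_add, hQ0 _ _ (hPe y)]
          simp
        rw [hji, hQv, C.γ_basis_swap b hif.symm, map_neg, hQv, hQe, C.γ_basis_swap b hif, hQe]
        simp only [map_neg, map_smul]
      by_cases hjf : j = f
      · rw [hjf, hff, hff, add_comm]
      · have e := hcomm j hji hjf w (C.γ (b f) y)
        rw [hff] at e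
        rw [C.γ_basis_swap b (Ne.symm hjf), map_neg, hcomm j hji hjf, ← e, map_neg,
          C.γ_basis_swap b (Ne.symm hjf), hff, neg_neg, add_comm]
    rw [← C.sum_inner_smul b u, Finset.mul_sum, Finset.sum_mul]
    simp only [mul_smul_comm, smul_mul_assoc, hb]
  · have h1 := hkey w hif.symm
    rw [hPof w hw] at h1
    rw [hG, hQ0 _ _ hw, zero_add, ← map_smul, h1, hff]
  · ext y
    rw [hG, hQ, hQ, hPof' w hw]
    simp
  · have h1 : Q w (C.γ (b f) y) = 0 := by
      refine hQ0 _ _ ?_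
      have := hswap (-ε) _ hif.symm hy
      rwa [neg_neg] at this
    rw [hG, h1, map_zero, add_zero, hQapp w y hw hy]

/-- A quadratic map `w ↦ η w w` on `W` orthogonal to all `γ u w` has the form `G w w` for a linear
map `G` into the skew endomorphisms commuting with the Clifford system. -/
theorem exists_commutant_of_inner_eq_zero (hι : Fintype.card ι = 2 ∨ Fintype.card ι = 5)
    (b : OrthonormalBasis ι ℝ U) (η : W →ₗ[ℝ] W →ₗ[ℝ] W) (hη : ∀ w y, η w y = η y w)
    (h : ∀ u w, inner ℝ (η w w) (C.γ u w) = 0) :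
    ∃ G : W →ₗ[ℝ] Module.End ℝ W, (∀ w, IsSkewMap (G w)) ∧ (∀ w u, G w * C.γ u = C.γ u * G w) ∧
      ∀ w, G w w = η w w := by
  obtain ⟨i, f, hif⟩ : ∃ i f : ι, i ≠ f := Fintype.one_lt_card_iff.1 (by omega)
  obtain ⟨G₁, hs₁, hc₁, hd₁, hz₁, hm₁⟩ :=
    C.exists_commutant_of_eigenspace hι b hif (ε := 1) (by norm_num) η hη h
  obtain ⟨G₂, hs₂, hc₂, hd₂, hz₂, hm₂⟩ :=
    C.exists_commutant_of_eigenspace hι b hif (ε := -1) (by norm_num) η hη h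
  refine ⟨G₁ + G₂, fun w ↦ (hs₁ w).add (hs₂ w), fun w u ↦ ?_, fun w ↦ ?_⟩
  · rw [LinearMap.add_apply, add_mul, mul_add, hc₁, hc₂]
  · obtain ⟨x, y, hx, hy, rfl⟩ : ∃ x y, C.γ (b i) x = (1 : ℝ) • x ∧ C.γ (b i) y = (-1 : ℝ) • y ∧
        w = x + y := by
      refine ⟨(1 / 2 : ℝ) • (w + C.γ (b i) w), (1 / 2 : ℝ) • (w - C.γ (b i) w), ?_, ?_, by module⟩
      · rw [map_smul, map_add, C.γ_γ_basis]; module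
      · rw [map_smul, map_sub, C.γ_γ_basis]; module
    have hx' : C.γ (b i) x = (-(-1) : ℝ) • x := by rw [hx, neg_neg]
    simp only [map_add, LinearMap.add_apply]
    rw [hd₁ x hx, hm₁ x y hx hy, hz₁ y hy, hz₂ x hx', hd₂ y hy, hm₂ y x hy hx', hη y x]
    simp only [LinearMap.zero_apply]
    module

end CliffordSystem

/-! ### Peirce decompositions -/

/-- A commutative product on a Euclidean space with totally symmetric structure tensor, all
multiplications traceless, and `(x ∘ x) ∘ x = |x|² x`. -/
structure IsCubicProduct {V : Type*} [NormedAddCommGroup V] [InnerProductSpace ℝ V]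
    (μ : V →ₗ[ℝ] V →ₗ[ℝ] V) : Prop where
  comm : ∀ x y, μ x y = μ y x
  assoc : ∀ x y z, inner ℝ (μ x y) z = inner ℝ x (μ y z)
  cube : ∀ x, μ (μ x x) x = inner ℝ x x • x
  trace : ∀ x, LinearMap.trace ℝ V (μ x) = 0

/-- The Peirce decomposition `V = ℝ e ⊕ U ⊕ W` of a product `μ` with respect to a unit
idempotent `e`, which acts as `-1` on `U` and as `1/2` on `W`. The remaining products are encoded by
a Clifford system on `(U, W)`, up to the normalization `κ = √3 / 2`. -/
structure PeirceDecomposition {V : Type*} [NormedAddCommGroup V] [InnerProductSpace ℝ V]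
    (μ : V →ₗ[ℝ] V →ₗ[ℝ] V) (U W : Type*) [NormedAddCommGroup U] [InnerProductSpace ℝ U]
    [NormedAddCommGroup W] [InnerProductSpace ℝ W] extends CliffordSystem U W where
  e : V
  i : U →ₗᵢ[ℝ] V
  j : W →ₗᵢ[ℝ] V
  κ : ℝ
  κ_sq : κ * κ = 3 / 4
  inner_e_e : inner ℝ e e = (1 : ℝ)
  inner_e_i : ∀ u, inner ℝ e (i u) = (0 : ℝ)
  inner_e_j : ∀ w, inner ℝ e (j w) = (0 : ℝ)
  inner_i_j : ∀ u w, inner ℝ (i u) (j w) = (0 : ℝ)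
  exists_eq : ∀ x, ∃ (t : ℝ) (u : U) (w : W), x = t • e + i u + j w
  mul_comm : ∀ x y, μ x y = μ y x
  mul_e_e : μ e e = e
  mul_e_i : ∀ u, μ e (i u) = -i u
  mul_e_j : ∀ w, μ e (j w) = (1 / 2 : ℝ) • j w
  mul_i_i : ∀ u u', μ (i u) (i u') = -inner ℝ u u' • e
  mul_i_j : ∀ u w, μ (i u) (j w) = κ • j (γ u w)
  mul_j_j : ∀ w w', μ (j w) (j w') = (1 / 2 * inner ℝ w w' : ℝ) • e + κ • i (q w w')

/-- A skew derivation of a product: an infinitesimal automorphism of the pair (metric, product). -/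
structure IsSkewDerivation {V : Type*} [NormedAddCommGroup V] [InnerProductSpace ℝ V]
    (μ : V →ₗ[ℝ] V →ₗ[ℝ] V) (D : Module.End ℝ V) : Prop where
  skew : IsSkewMap D
  leibniz : ∀ x y, D (μ x y) = μ (D x) y + μ x (D y)

theorem IsSkewDerivation.add {V : Type*} [NormedAddCommGroup V] [InnerProductSpace ℝ V]
    {μ : V →ₗ[ℝ] V →ₗ[ℝ] V} {D D' : Module.End ℝ V} (h : IsSkewDerivation μ D)
    (h' : IsSkewDerivation μ D') : IsSkewDerivation μ (D + D') where
  skew := h.skew.add h'.skew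
  leibniz x y := by
    simp only [LinearMap.add_apply, h.leibniz, h'.leibniz, map_add]
    abel

theorem IsSkewDerivation.smul {V : Type*} [NormedAddCommGroup V] [InnerProductSpace ℝ V]
    {μ : V →ₗ[ℝ] V →ₗ[ℝ] V} {D : Module.End ℝ V} (h : IsSkewDerivation μ D) (c : ℝ) :
    IsSkewDerivation μ (c • D) where
  skew := h.skew.smul c
  leibniz x y := by
    simp only [LinearMap.smul_apply, h.leibniz, map_smul, smul_add]

set_option linter.unusedSectionVars false

namespace PeirceDecomposition

variable {V U W : Type*} [NormedAddCommGroup V] [InnerProductSpace ℝ V] [NormedAddCommGroup U]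
  [InnerProductSpace ℝ U] [NormedAddCommGroup W] [InnerProductSpace ℝ W]
  {μ : V →ₗ[ℝ] V →ₗ[ℝ] V} (P : PeirceDecomposition μ U W)

theorem inner_i_e (u : U) : inner ℝ (P.i u) P.e = (0 : ℝ) := by rw [real_inner_comm, P.inner_e_i]

theorem inner_j_e (w : W) : inner ℝ (P.j w) P.e = (0 : ℝ) := by rw [real_inner_comm, P.inner_e_j]

theorem inner_j_i (w : W) (u : U) : inner ℝ (P.j w) (P.i u) = (0 : ℝ) := by
  rw [real_inner_comm, P.inner_i_j]

theorem mul_i_e (u : U) : μ (P.i u) P.e = -P.i u := by rw [P.mul_comm, P.mul_e_i]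

theorem mul_j_e (w : W) : μ (P.j w) P.e = (1 / 2 : ℝ) • P.j w := by rw [P.mul_comm, P.mul_e_j]

theorem mul_j_i (w : W) (u : U) : μ (P.j w) (P.i u) = P.κ • P.j (P.γ u w) := by
  rw [P.mul_comm, P.mul_i_j]

theorem κ_ne_zero : P.κ ≠ 0 := by
  intro h
  have := P.κ_sq
  rw [h] at this
  norm_num at this

theorem ext_linear {A : Type*} [AddCommGroup A] [Module ℝ A] {f g : V →ₗ[ℝ] A}
    (he : f P.e = g P.e) (hi : ∀ u, f (P.i u) = g (P.i u)) (hj : ∀ w, f (P.j w) = g (P.j w)) :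
    f = g := by
  ext x
  obtain ⟨t, u, w, rfl⟩ := P.exists_eq x
  simp only [map_add, map_smul, he, hi, hj]

theorem ext_bilinear {A : Type*} [AddCommGroup A] [Module ℝ A] {f g : V →ₗ[ℝ] V →ₗ[ℝ] A}
    (hf : ∀ x y, f x y = f y x) (hg : ∀ x y, g x y = g y x)
    (hee : f P.e P.e = g P.e P.e) (hei : ∀ u, f P.e (P.i u) = g P.e (P.i u))
    (hej : ∀ w, f P.e (P.j w) = g P.e (P.j w))
    (hii : ∀ u v, f (P.i u) (P.i v) = g (P.i u) (P.i v))
    (hij : ∀ u w, f (P.i u) (P.j w) = g (P.i u) (P.j w))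
    (hjj : ∀ w w', f (P.j w) (P.j w') = g (P.j w) (P.j w')) : f = g := by
  refine P.ext_linear (P.ext_linear hee hei hej) (fun u ↦ P.ext_linear ?_ (hii u) (hij u))
    fun w ↦ P.ext_linear ?_ (fun u ↦ ?_) (hjj w)
  · rw [hf, hg, hei]
  · rw [hf, hg, hej]
  · rw [hf, hg, hij]

theorem ext_inner {x y : V} (he : inner ℝ x P.e = (inner ℝ y P.e : ℝ))
    (hi : ∀ u, inner ℝ x (P.i u) = (inner ℝ y (P.i u) : ℝ))
    (hj : ∀ w, inner ℝ x (P.j w) = (inner ℝ y (P.j w) : ℝ)) : x = y := by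
  refine ext_inner_right ℝ fun z ↦ ?_
  obtain ⟨t, u, w, rfl⟩ := P.exists_eq z
  simp only [inner_add_right, inner_smul_right, he, hi, hj]

variable [FiniteDimensional ℝ V] [FiniteDimensional ℝ U] [FiniteDimensional ℝ W]

/-- The projection of `V` onto `U`. -/
noncomputable def pU : V →ₗ[ℝ] U := LinearMap.adjoint P.i.toLinearMap

/-- The projection of `V` onto `W`. -/
noncomputable def pW : V →ₗ[ℝ] W := LinearMap.adjoint P.j.toLinearMap

theorem inner_pU (x : V) (u : U) : inner ℝ (P.pU x) u = inner ℝ x (P.i u) :=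
  LinearMap.adjoint_inner_left ..

theorem inner_pW (x : V) (w : W) : inner ℝ (P.pW x) w = inner ℝ x (P.j w) :=
  LinearMap.adjoint_inner_left ..

@[simp] theorem pU_e : P.pU P.e = 0 :=
  ext_inner_right ℝ fun u ↦ by rw [inner_pU, P.inner_e_i, inner_zero_left]

@[simp] theorem pU_i (u : U) : P.pU (P.i u) = u :=
  ext_inner_right ℝ fun v ↦ by rw [inner_pU, P.i.inner_map_map]

@[simp] theorem pU_j (w : W) : P.pU (P.j w) = 0 :=
  ext_inner_right ℝ fun u ↦ by rw [inner_pU, P.inner_j_i, inner_zero_left]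

@[simp] theorem pW_e : P.pW P.e = 0 :=
  ext_inner_right ℝ fun u ↦ by rw [inner_pW, P.inner_e_j, inner_zero_left]

@[simp] theorem pW_i (u : U) : P.pW (P.i u) = 0 :=
  ext_inner_right ℝ fun v ↦ by rw [inner_pW, P.inner_i_j, inner_zero_left]

@[simp] theorem pW_j (w : W) : P.pW (P.j w) = w :=
  ext_inner_right ℝ fun u ↦ by rw [inner_pW, P.j.inner_map_map]

theorem eq_add (x : V) : x = inner ℝ x P.e • P.e + P.i (P.pU x) + P.j (P.pW x) := by
  refine P.ext_inner ?_ (fun u ↦ ?_) fun w ↦ ?_ <;>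
  simp [inner_add_left, inner_smul_left, P.inner_e_e, P.inner_i_e, P.inner_j_e, P.inner_e_i,
    P.inner_e_j, P.inner_i_j, P.inner_j_i, inner_pU, inner_pW, -inner_self_eq_norm_sq_to_K]

/-- The linear map out of `V` with prescribed restrictions to `ℝ e`, `U` and `W`. -/
noncomputable def lift {A : Type*} [AddCommGroup A] [Module ℝ A] (a : A) (f : U →ₗ[ℝ] A)
    (g : W →ₗ[ℝ] A) : V →ₗ[ℝ] A :=
  (innerₛₗ ℝ P.e).smulRight a + f.comp P.pU + g.comp P.pW

section Lift

variable {A : Type*} [AddCommGroup A] [Module ℝ A] (a : A) (f : U →ₗ[ℝ] A) (g : W →ₗ[ℝ] A)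

@[simp] theorem lift_e : P.lift a f g P.e = a := by
  simp [lift, P.inner_e_e, -inner_self_eq_norm_sq_to_K]

@[simp] theorem lift_i (u : U) : P.lift a f g (P.i u) = f u := by simp [lift, P.inner_e_i]

@[simp] theorem lift_j (w : W) : P.lift a f g (P.j w) = g w := by simp [lift, P.inner_e_j]

end Lift

/-- A skew endomorphism is a derivation as soon as the Leibniz rule holds on the Peirce pieces. -/
theorem isSkewDerivation_of {D : Module.End ℝ V} (hD : IsSkewMap D)
    (hee : D (μ P.e P.e) = μ (D P.e) P.e + μ P.e (D P.e))
    (hei : ∀ u, D (μ P.e (P.i u)) = μ (D P.e) (P.i u) + μ P.e (D (P.i u)))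
    (hej : ∀ w, D (μ P.e (P.j w)) = μ (D P.e) (P.j w) + μ P.e (D (P.j w)))
    (hii : ∀ u v, D (μ (P.i u) (P.i v)) = μ (D (P.i u)) (P.i v) + μ (P.i u) (D (P.i v)))
    (hij : ∀ u w, D (μ (P.i u) (P.j w)) = μ (D (P.i u)) (P.j w) + μ (P.i u) (D (P.j w)))
    (hjj : ∀ w w', D (μ (P.j w) (P.j w')) = μ (D (P.j w)) (P.j w') + μ (P.j w) (D (P.j w'))) :
    IsSkewDerivation μ D := by
  refine ⟨hD, LinearMap.ext_iff₂.1 (P.ext_bilinear (f := μ.compr₂ D)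
    (g := μ.comp D + (LinearMap.lcomp ℝ V D).comp μ) ?_ ?_ ?_ ?_ ?_ ?_ ?_ ?_)⟩
  · intro x y
    simp [P.mul_comm x y]
  · intro x y
    change μ (D x) y + μ x (D y) = μ (D y) x + μ y (D x)
    rw [P.mul_comm (D x), P.mul_comm x, add_comm]
  exacts [hee, hei, hej, hii, hij, hjj]

/-- The endomorphism of `V` acting as `R` on `U` and as zero on `ℝ e ⊕ W`. -/
noncomputable def stabU : Module.End ℝ U →ₗ[ℝ] Module.End ℝ V where
  toFun R := P.i.toLinearMap ∘ₗ R ∘ₗ P.pU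
  map_add' R S := by ext; simp
  map_smul' c R := by ext; simp

/-- The endomorphism of `V` acting as `F` on `W` and as zero on `ℝ e ⊕ U`. -/
noncomputable def stabW : Module.End ℝ W →ₗ[ℝ] Module.End ℝ V where
  toFun F := P.j.toLinearMap ∘ₗ F ∘ₗ P.pW
  map_add' R S := by ext; simp
  map_smul' c R := by ext; simp

theorem stabU_apply (R : Module.End ℝ U) (x : V) : P.stabU R x = P.i (R (P.pU x)) := rfl

theorem stabW_apply (F : Module.End ℝ W) (x : V) : P.stabW F x = P.j (F (P.pW x)) := rfl

theorem isSkewMap_stabU {R : Module.End ℝ U} (h : IsSkewMap R) : IsSkewMap (P.stabU R) :=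
  .of_inner_self fun x ↦ by
    rw [stabU_apply, real_inner_comm, ← inner_pU, real_inner_comm, h.inner_self]

theorem isSkewMap_stabW {F : Module.End ℝ W} (h : IsSkewMap F) : IsSkewMap (P.stabW F) :=
  .of_inner_self fun x ↦ by
    rw [stabW_apply, real_inner_comm, ← inner_pW, real_inner_comm, h.inner_self]

/-- Infinitesimal automorphisms of the Clifford system are derivations of the product. -/
theorem isSkewDerivation_stab {R : Module.End ℝ U} {F : Module.End ℝ W} (hR : IsSkewMap R)
    (hF : IsSkewMap F) (h : ∀ v, F * P.γ v - P.γ v * F = P.γ (R v)) :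
    IsSkewDerivation μ (P.stabU R + P.stabW F) := by
  have h' : ∀ v w, F (P.γ v w) = P.γ (R v) w + P.γ v (F w) := fun v w ↦
    sub_eq_iff_eq_add.1 (LinearMap.congr_fun (h v) w)
  refine P.isSkewDerivation_of ((P.isSkewMap_stabU hR).add (P.isSkewMap_stabW hF)) ?_ ?_ ?_ ?_ ?_ ?_
  · simp [stabU_apply, stabW_apply, P.mul_e_e]
  · intro u
    simp [stabU_apply, stabW_apply, P.mul_e_i]
  · intro w
    simp [stabU_apply, stabW_apply, P.mul_e_j]
  · intro u v
    have := hR u v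
    simp [stabU_apply, stabW_apply, P.mul_i_i, this]
  · intro u w
    simp [stabU_apply, stabW_apply, P.mul_i_j, h']
  · intro w w'
    have hq : R (P.q w w') = P.q (F w) w' + P.q w (F w') := by
      refine ext_inner_right ℝ fun v ↦ ?_
      have h1 := congrArg (fun z ↦ inner ℝ z w') (h' v w)
      have h2 := hF (P.γ v w) w'
      simp only [inner_add_left] at h1
      rw [hR, P.inner_q, inner_add_left, P.inner_q, P.inner_q]
      linarith
    have h3 := hF w w'
    simp only [LinearMap.add_apply, stabU_apply, stabW_apply, P.mul_j_j, map_add, map_smul, pU_e,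
      pW_e, pU_i, pW_i, pU_j, pW_j, map_zero, hq]
    simp only [h3, LinearMap.zero_apply]
    module

/-- The derivation with `e ↦ w`, mapping `U` into `W` and `W` into `ℝ e ⊕ U`. The coefficient
`-2κ/3` on `U` is forced by the Leibniz rule for `μ e u = -u`. -/
noncomputable def transv : W →ₗ[ℝ] Module.End ℝ V where
  toFun w := P.lift (P.j w) ((-2 * P.κ / 3) • P.j.toLinearMap ∘ₗ P.γ.flip w)
    (-(innerₛₗ ℝ w).smulRight P.e - (-2 * P.κ / 3) • P.i.toLinearMap ∘ₗ P.q w)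
  map_add' w w' := P.ext_linear (by simp) (fun u ↦ by simp) fun z ↦ by
    simp only [lift_j, LinearMap.add_apply, LinearMap.sub_apply, LinearMap.neg_apply,
      LinearMap.smul_apply, LinearMap.smulRight_apply, innerₛₗ_apply_apply, LinearMap.comp_apply,
      map_add]
    module
  map_smul' c w := P.ext_linear (by simp)
    (fun u ↦ by
      simp only [lift_i, LinearMap.smul_apply, LinearMap.comp_apply, LinearMap.flip_apply, map_smul,
        RingHom.id_apply]
      module)
    fun z ↦ by
      simp only [lift_j, LinearMap.sub_apply, LinearMap.neg_apply, LinearMap.smul_apply,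
        LinearMap.smulRight_apply, innerₛₗ_apply_apply, LinearMap.comp_apply, map_smul,
        RingHom.id_apply]
      module

@[simp] theorem transv_e (w : W) : P.transv w P.e = P.j w := by simp [transv]

@[simp] theorem transv_i (w : W) (u : U) :
    P.transv w (P.i u) = (-2 * P.κ / 3) • P.j (P.γ u w) := by simp [transv]

@[simp] theorem transv_j (w w' : W) :
    P.transv w (P.j w') = -inner ℝ w w' • P.e + (2 * P.κ / 3) • P.i (P.q w w') := by
  simp [transv]; module

theorem isSkewDerivation_transv (w : W) : IsSkewDerivation μ (P.transv w) := by
  have hκ := P.κ_sq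
  refine P.isSkewDerivation_of (.of_inner_self fun x ↦ ?_) ?_ ?_ ?_ ?_ ?_ ?_
  · obtain ⟨t, u, y, rfl⟩ := P.exists_eq x
    have := P.inner_q w y u
    simp only [map_add, map_smul, transv_e, transv_i, transv_j, inner_add_left, inner_add_right,
      inner_smul_left, inner_smul_right, P.inner_e_e, P.inner_i_e, P.inner_j_e, P.inner_e_i,
      P.inner_e_j, P.inner_i_j, P.inner_j_i, P.i.inner_map_map, P.j.inner_map_map, conj_trivial,
      this]
    ring
  · simp only [P.mul_e_e, transv_e, P.mul_j_e, P.mul_e_j]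
    module
  · intro u
    simp only [P.mul_e_i, transv_e, transv_i, P.mul_j_i, P.mul_e_j, map_neg, map_smul]
    module
  · intro y
    simp only [P.mul_e_j, transv_e, transv_j, P.mul_j_j, map_smul, map_add, P.mul_e_e, P.mul_e_i]
    module
  · intro u v
    have h := congrArg P.j (P.anticomm_apply u v w)
    simp only [P.mul_i_i, transv_e, transv_i, map_smul, P.mul_j_i, P.mul_i_j, LinearMap.smul_apply,
      map_add] at h ⊢
    linear_combination (norm := module) (2 / 3 * P.κ * P.κ) • h
      + (4 / 3 * inner ℝ u v) • congrArg (· • P.j w) hκ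
  · intro u y
    have h1 : P.q w (P.γ u y) + P.q (P.γ u w) y = (2 * inner ℝ w y : ℝ) • u := by
      refine ext_inner_right ℝ fun v ↦ ?_
      have h2 := congrArg (fun z ↦ inner ℝ z y) (P.anticomm_apply u v w)
      simp only [inner_add_left, inner_smul_left, conj_trivial] at h2
      rw [inner_add_left, P.inner_q, P.inner_q, inner_smul_left, ← P.symm, conj_trivial]
      linarith
    have h2 := congrArg P.i h1
    have h3 := P.symm u w y
    simp only [P.mul_i_j, transv_i, transv_j, map_smul, map_add, P.mul_j_j, LinearMap.smul_apply,
      P.mul_i_e, P.mul_i_i] at h2 ⊢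
    have h4 : inner ℝ u (P.q w y) = inner ℝ (P.γ u w) y := by
      rw [real_inner_comm, P.inner_q]
    rw [← h3, h4]
    linear_combination (norm := module) (2 / 3 * P.κ * P.κ) • h2
      + (4 / 3 * inner ℝ w y) • congrArg (· • P.i u) hκ
  · intro y z
    have h := congrArg P.j (P.fierz_polar y z w)
    simp only [P.mul_j_j, transv_e, transv_i, transv_j, map_smul, map_add, P.mul_j_e, P.mul_e_j,
      P.mul_j_i, P.mul_i_j, LinearMap.smul_apply, LinearMap.add_apply, P.q_comm z w,
      real_inner_comm w z] at h ⊢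
    linear_combination (norm := module) (-2 / 3 * P.κ * P.κ) • h
      + (-2 / 3 : ℝ) • congrArg (· • (inner ℝ y z • P.j w + inner ℝ w z • P.j y
        + inner ℝ w y • P.j z)) hκ

end PeirceDecomposition

/-! ### Infinitesimal deformations of the product -/

section Polarization

variable {V : Type*} [NormedAddCommGroup V] [InnerProductSpace ℝ V] {μ β : V →ₗ[ℝ] V →ₗ[ℝ] V}

/-- The coefficients of `t` and `t²` in the vanishing quartic form `⟪β z z, μ z z⟫` at
`z = x + t y`, up to constant factors. -/
theorem quartic_coeffs (hμ : ∀ x y, μ x y = μ y x) (hβ : ∀ x y, β x y = β y x)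
    (h : ∀ x, inner ℝ (β x x) (μ x x) = 0) (x y : V) :
    inner ℝ (β x x) (μ x y) + inner ℝ (β x y) (μ x x) = 0 ∧
      inner ℝ (β x x) (μ y y) + 4 * inner ℝ (β x y) (μ x y) + inner ℝ (β y y) (μ x x) = 0 := by
  have h1 := h (x + y)
  have h2 := h (x - y)
  have h3 := h (x + (2 : ℝ) • y)
  have h4 := h x
  have h5 := h y
  simp only [map_add, map_sub, map_smul, LinearMap.add_apply, LinearMap.sub_apply,
    LinearMap.smul_apply, inner_add_left, inner_add_right, inner_sub_left, inner_sub_right,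
    inner_smul_left, inner_smul_right, conj_trivial, hμ y x, hβ y x] at h1 h2 h3
  constructor <;> linarith

theorem quartic_first (hμ : ∀ x y, μ x y = μ y x) (hβ : ∀ x y, β x y = β y x)
    (h : ∀ x, inner ℝ (β x x) (μ x x) = 0) (x y : V) :
    inner ℝ (β x x) (μ x y) + inner ℝ (β x y) (μ x x) = 0 :=
  (quartic_coeffs hμ hβ h x y).1

theorem quartic_second (hμ : ∀ x y, μ x y = μ y x) (hβ : ∀ x y, β x y = β y x)
    (h : ∀ x, inner ℝ (β x x) (μ x x) = 0) (x y : V) :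
    inner ℝ (β x x) (μ y y) + 4 * inner ℝ (β x y) (μ x y) + inner ℝ (β y y) (μ x x) = 0 :=
  (quartic_coeffs hμ hβ h x y).2

theorem cubic_first (hβ : ∀ x y, β x y = β y x) (h : ∀ x, inner ℝ (β x x) x = 0) (x y : V) :
    2 * inner ℝ (β x y) x + inner ℝ (β x x) y = 0 := by
  have h1 := h (x + y)
  have h2 := h (x - y)
  have h4 := h x
  have h5 := h y
  simp only [map_add, map_sub, LinearMap.add_apply, LinearMap.sub_apply, inner_add_left,
    inner_add_right, inner_sub_left, inner_sub_right, hβ y x] at h1 h2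
  linarith

/-- The tangent vectors at `μ` to the space of totally symmetric products `ν` with
`|ν x x|² = |x|⁴`. -/
structure IsTangentProduct (μ S : V →ₗ[ℝ] V →ₗ[ℝ] V) : Prop where
  comm : ∀ x y, S x y = S y x
  assoc : ∀ x y z, inner ℝ (S x y) z = inner ℝ x (S y z)
  quartic : ∀ x, inner ℝ (S x x) (μ x x) = 0

theorem IsTangentProduct.sub {S S' : V →ₗ[ℝ] V →ₗ[ℝ] V} (h : IsTangentProduct μ S)
    (h' : IsTangentProduct μ S') : IsTangentProduct μ (S - S') where
  comm x y := by simp only [LinearMap.sub_apply, h.comm x y, h'.comm x y]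
  assoc x y z := by
    simp only [LinearMap.sub_apply, inner_sub_left, inner_sub_right, h.assoc, h'.assoc]
  quartic x := by
    simp only [LinearMap.sub_apply, inner_sub_left, h.quartic, h'.quartic, sub_self]

/-- The infinitesimal action `(x, y) ↦ μ (F x) y + μ x (F y) - F (μ x y)` of an endomorphism `F` on
a product `μ`. It vanishes if and only if `F` is a derivation. -/
noncomputable def deform (μ : V →ₗ[ℝ] V →ₗ[ℝ] V) : Module.End ℝ V →ₗ[ℝ] V →ₗ[ℝ] V →ₗ[ℝ] V where
  toFun F := μ.comp F + (LinearMap.lcomp ℝ V F).comp μ - μ.compr₂ F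
  map_add' F G := by
    ext x y
    simp
    abel
  map_smul' c F := by
    ext x y
    simp [smul_sub]

theorem deform_apply (F : Module.End ℝ V) (x y : V) :
    deform μ F x y = μ (F x) y + μ x (F y) - F (μ x y) := rfl

theorem IsCubicProduct.isTangentProduct_deform (hμ : IsCubicProduct μ) {F : Module.End ℝ V}
    (hF : IsSkewMap F) : IsTangentProduct μ (deform μ F) where
  comm x y := by
    rw [deform_apply, deform_apply, hμ.comm (F x), hμ.comm x (F y), hμ.comm x y, add_comm]
  assoc x y z := by
    have h1 := hF (μ x y) z
    have h2 := hF x (μ y z)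
    rw [hμ.assoc x y (F z)] at h1
    simp only [deform_apply, inner_add_left, inner_sub_left, inner_add_right, inner_sub_right,
      hμ.assoc] at *
    linarith
  quartic x := by
    have h1 := hF.inner_self (μ x x)
    have h2 : inner ℝ (μ (F x) x) (μ x x) = 0 := by
      rw [hμ.assoc, hμ.comm x (μ x x), hμ.cube, inner_smul_right, hF.inner_self, mul_zero]
    rw [deform_apply, hμ.comm x (F x), inner_sub_left, inner_add_left, h1, h2]
    simp

end Polarization

namespace PeirceDecomposition

variable {V U W : Type*} [NormedAddCommGroup V] [InnerProductSpace ℝ V] [NormedAddCommGroup U]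
  [InnerProductSpace ℝ U] [NormedAddCommGroup W] [InnerProductSpace ℝ W]
  {μ : V →ₗ[ℝ] V →ₗ[ℝ] V} (P : PeirceDecomposition μ U W)

/-- By total symmetry, the remaining components `W × W → ℝ e ⊕ U` of `S` vanish as well. -/
theorem tangent_eq_zero {S : V →ₗ[ℝ] V →ₗ[ℝ] V} (hS : IsTangentProduct μ S) (he : S P.e = 0)
    (hii : ∀ u v, S (P.i u) (P.i v) = 0) (hij : ∀ u w, S (P.i u) (P.j w) = 0)
    (hjj : ∀ w w' z, inner ℝ (S (P.j w) (P.j w')) (P.j z) = 0) : S = 0 := by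
  refine P.ext_bilinear hS.comm (fun _ _ ↦ rfl) (by simp [he]) (by simp [he]) (by simp [he])
    (by simp [hii]) (by simp [hij]) fun w w' ↦ P.ext_inner ?_ (fun u ↦ ?_) fun z ↦ ?_
  · rw [hS.assoc, hS.comm, he]
    simp
  · rw [hS.assoc, hS.comm, hij]
    simp
  · rw [hjj]
    simp

variable [FiniteDimensional ℝ V] [FiniteDimensional ℝ U] [FiniteDimensional ℝ W]

/-- The case of infinitesimal rigidity in which `e` stays an idempotent with the same Peirce
decomposition. Then only the block `τ : U × W → W` of `S` is left, and `τ u` anticommutes with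
`γ u`, so that the rigidity of Clifford systems applies. -/
theorem exists_deform_of_apply_e_eq_zero [Nontrivial W] {ι : Type*} [Fintype ι]
    (b : OrthonormalBasis ι ℝ U) (hμ : IsCubicProduct μ) {S : V →ₗ[ℝ] V →ₗ[ℝ] V}
    (hS : IsTangentProduct μ S) (he : S P.e = 0) :
    ∃ F : Module.End ℝ V, IsSkewMap F ∧ S = deform μ F := by
  have he' : ∀ x, S x P.e = 0 := fun x ↦ by rw [hS.comm, he]; rfl
  have hSe : ∀ x y, inner ℝ (S x y) P.e = 0 := fun x y ↦ by rw [hS.assoc, he', inner_zero_right]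
  have hμe : ∀ x, inner ℝ (S x x) (μ x P.e) = 0 := fun x ↦ by
    have := quartic_first hμ.comm hS.comm hS.quartic x P.e
    rwa [he', inner_zero_left, add_zero] at this
  have huuu : ∀ u, inner ℝ (S (P.i u) (P.i u)) (P.i u) = 0 := fun u ↦ by
    have := hμe (P.i u)
    rw [P.mul_i_e, inner_neg_right] at this
    linarith
  have hwww : ∀ w, inner ℝ (S (P.j w) (P.j w)) (P.j w) = 0 := fun w ↦ by
    have := hμe (P.j w)
    rw [P.mul_j_e, inner_smul_right] at this
    linarith
  have hrot : ∀ x y, inner ℝ (S x y) x = inner ℝ (S x x) y := fun x y ↦ by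
    rw [hS.assoc x x, real_inner_comm]
  have huuw : ∀ u w, inner ℝ (S (P.i u) (P.i u)) (P.j w) = 0 := fun u w ↦ by
    have h1 := hμe (P.i u + P.j w)
    have h2 := hμe (P.i u - P.j w)
    have h3 := hrot (P.i u) (P.j w)
    simp only [map_add, map_sub, LinearMap.add_apply, LinearMap.sub_apply, P.mul_i_e, P.mul_j_e,
      inner_add_left, inner_add_right, inner_sub_left, inner_sub_right, inner_neg_right,
      inner_smul_right, huuu, hwww, hS.comm (P.j w) (P.i u), h3] at h1 h2
    linarith
  have huu : ∀ u, S (P.i u) (P.i u) = 0 := fun u ↦ by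
    refine P.ext_inner ?_ (fun v ↦ ?_) fun w ↦ ?_
    · rw [hSe, inner_zero_left]
    · have h1 := huuu (u + v)
      have h2 := huuu (u - v)
      simp only [map_add, map_sub, LinearMap.add_apply, LinearMap.sub_apply, inner_add_left,
        inner_add_right, inner_sub_left, inner_sub_right, huuu, hS.comm (P.i v) (P.i u),
        hrot (P.i u) (P.i v)] at h1 h2
      rw [inner_zero_left]
      linarith
    · rw [huuw, inner_zero_left]
  have hii : ∀ u v, S (P.i u) (P.i v) = 0 := fun u v ↦ by
    have h1 := huu (u + v)
    simp only [map_add, LinearMap.add_apply, huu, hS.comm (P.i v) (P.i u), zero_add,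
      add_zero] at h1
    rwa [← two_smul ℝ, smul_eq_zero_iff_right two_ne_zero] at h1
  have hjj : ∀ w w' z, inner ℝ (S (P.j w) (P.j w')) (P.j z) = 0 := by
    have h0 : ∀ w z, inner ℝ (S (P.j w) (P.j w)) (P.j z) = 0 := fun w z ↦ by
      have h1 := hwww (w + z)
      have h2 := hwww (w - z)
      simp only [map_add, map_sub, LinearMap.add_apply, LinearMap.sub_apply, inner_add_left,
        inner_add_right, inner_sub_left, inner_sub_right, hwww, hS.comm (P.j z) (P.j w),
        hrot (P.j w) (P.j z)] at h1 h2
      linarith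
    intro w w' z
    have h1 := h0 (w + w') z
    simp only [map_add, LinearMap.add_apply, inner_add_left, h0, hS.comm (P.j w') (P.j w)] at h1
    linarith
  obtain ⟨τ, hτ⟩ : ∃ τ : U →ₗ[ℝ] Module.End ℝ W, ∀ u w, τ u w = P.pW (S (P.i u) (P.j w)) :=
    ⟨((LinearMap.lcomp ℝ W P.j.toLinearMap).comp (S.compr₂ P.pW)).comp P.i.toLinearMap,
      fun _ _ ↦ rfl⟩
  have hτS : ∀ u w, S (P.i u) (P.j w) = P.j (τ u w) := fun u w ↦ by
    refine P.ext_inner ?_ (fun v ↦ ?_) fun z ↦ ?_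
    · rw [hSe, P.inner_j_e]
    · rw [hS.comm, hS.assoc, hii, inner_zero_right, P.inner_j_i]
    · rw [P.j.inner_map_map, hτ, inner_pW]
  have hs : ∀ u w w', inner ℝ (τ u w) w' = inner ℝ w (τ u w') := fun u w w' ↦ by
    rw [hτ, inner_pW, ← P.j.inner_map_map w, ← hτS, hS.comm, hS.assoc]
  have hτγ : ∀ u w, inner ℝ (τ u w) (P.γ u w) = 0 := fun u w ↦ by
    have h1 := quartic_second hμ.comm hS.comm hS.quartic (P.i u) (P.j w)
    rw [hii, hτS, P.mul_i_j, P.mul_i_i, inner_zero_left, inner_smul_right, inner_smul_right, hSe,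
      P.j.inner_map_map] at h1
    have h2 := P.κ_ne_zero
    rw [mul_zero, add_zero, zero_add] at h1
    simpa [h2] using h1
  obtain ⟨F, R, hF, hR, hFR⟩ := P.exists_bracket_of_anticomm b τ hs fun u ↦ by
    have h0 : ∀ w, inner ℝ ((τ u * P.γ u + P.γ u * τ u) w) w = 0 := fun w ↦ by
      have h1 := hτγ u w
      simp only [LinearMap.add_apply, Module.End.mul_apply, inner_add_left]
      rw [P.symm, hs, h1, real_inner_comm, h1, add_zero]
    have h3 := IsSkewMap.of_inner_self h0
    ext w
    refine ext_inner_right ℝ fun w' ↦ ?_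
    have h4 := h3 w w'
    have h5 : inner ℝ w ((τ u * P.γ u + P.γ u * τ u) w')
        = inner ℝ ((τ u * P.γ u + P.γ u * τ u) w) w' := by
      simp only [LinearMap.add_apply, Module.End.mul_apply, inner_add_left, inner_add_right]
      rw [P.symm, hs, hs, P.symm, add_comm]
    rw [LinearMap.zero_apply, inner_zero_left]
    linarith
  have hD : IsSkewMap (P.stabU R + P.stabW F) := (P.isSkewMap_stabU hR).add (P.isSkewMap_stabW hF)
  refine ⟨(-P.κ⁻¹) • (P.stabU R + P.stabW F), hD.smul _, sub_eq_zero.1 <|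
    P.tangent_eq_zero (hS.sub (hμ.isTangentProduct_deform (hD.smul _))) ?_ ?_ ?_ ?_⟩
  · refine P.ext_linear ?_ (fun u ↦ ?_) fun w ↦ ?_ <;>
    simp [he, deform_apply, stabU_apply, stabW_apply, P.mul_e_e, P.mul_e_i, P.mul_e_j]
  · intro u v
    have h1 := hR u v
    simp [hii, deform_apply, stabU_apply, stabW_apply, P.mul_i_i, h1]
  · intro u w
    have h1 := LinearMap.congr_fun (hFR u) w
    simp only [LinearMap.sub_apply, Module.End.mul_apply] at h1
    simp only [LinearMap.sub_apply, hτS, h1, deform_apply, LinearMap.smul_apply,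
      LinearMap.add_apply, stabU_apply, stabW_apply, pU_i, pU_j, pW_i, pW_j, map_zero, add_zero,
      zero_add, map_smul, P.mul_i_j, map_sub]
    rw [← smul_add, ← smul_sub, neg_smul, inv_smul_smul₀ P.κ_ne_zero]
    module
  · intro w w' z
    have h1 : ∀ x y, inner ℝ (μ (P.j x) (P.j y)) (P.j z) = (0 : ℝ) := fun x y ↦ by
      simp [P.mul_j_j, inner_add_left, inner_smul_left, P.inner_e_j, P.inner_i_j]
    simp [inner_sub_left, inner_add_left, inner_smul_left, hjj, deform_apply, stabU_apply,
      stabW_apply, h1]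
    simp [P.mul_j_j, inner_smul_left, P.inner_i_j]

/-- Infinitesimal rigidity: all tangent products come from infinitesimal isometries. A first
isometry, rotating `e` into `U` and `U` into `W`, reduces to the case `S e = 0`. -/
theorem exists_deform (P : PeirceDecomposition μ U W) [Nontrivial W] {ι : Type*} [Fintype ι]
    (b : OrthonormalBasis ι ℝ U) (hμ : IsCubicProduct μ) {S : V →ₗ[ℝ] V →ₗ[ℝ] V}
    (hS : IsTangentProduct μ S) :
    ∃ F : Module.End ℝ V, IsSkewMap F ∧ S = deform μ F := by
  have hee : S P.e P.e = P.i (P.pU (S P.e P.e)) := by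
    have h1 := fun y ↦ quartic_first hμ.comm hS.comm hS.quartic P.e y
    have h2 : ∀ y, inner ℝ (S P.e y) P.e = inner ℝ (S P.e P.e) y := fun y ↦ by
      rw [hS.assoc P.e P.e, real_inner_comm]
    refine P.ext_inner ?_ (fun v ↦ ?_) fun w ↦ ?_
    · have := h1 P.e
      rw [P.mul_e_e] at this
      rw [P.inner_i_e]
      linarith
    · rw [P.i.inner_map_map, inner_pU]
    · have := h1 (P.j w)
      rw [P.mul_e_e, P.mul_e_j, inner_smul_right, h2] at this
      rw [P.inner_i_j]
      linarith
  set p := P.pU (S P.e P.e)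
  obtain ⟨A, hA⟩ : ∃ A : U →ₗ[ℝ] W, ∀ u, A u = P.pW (S P.e (P.i u)) :=
    ⟨P.pW.comp ((S P.e).comp P.i.toLinearMap), fun _ ↦ rfl⟩
  -- The constants are such that `deform μ F` has the component `p` at `(e, e)`, where `e` acts on
  -- `U` as `-1`, and the component `A` on `e × U → W`, where `e` acts on `W` as `1/2`.
  set F : Module.End ℝ V := P.lift ((-1 / 3 : ℝ) • P.i p)
    ((1 / 3 : ℝ) • (innerₛₗ ℝ p).smulRight P.e + (2 / 3 : ℝ) • P.j.toLinearMap ∘ₗ A)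
    ((-2 / 3 : ℝ) • P.i.toLinearMap ∘ₗ LinearMap.adjoint A) with hF
  have hFe : F P.e = (-1 / 3 : ℝ) • P.i p := by simp [hF]
  have hFi : ∀ u, F (P.i u) = (1 / 3 * inner ℝ p u : ℝ) • P.e + (2 / 3 : ℝ) • P.j (A u) :=
    fun u ↦ by simp [hF, smul_smul]
  have hFj : ∀ w, F (P.j w) = (-2 / 3 : ℝ) • P.i (LinearMap.adjoint A w) := fun w ↦ by simp [hF]
  have hskew : IsSkewMap F := .of_inner_self fun x ↦ by
    obtain ⟨t, u, y, rfl⟩ := P.exists_eq x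
    have := LinearMap.adjoint_inner_left A u y
    have h2 := real_inner_comm (A u) y
    simp only [map_add, map_smul, hFe, hFi, hFj, inner_add_left, inner_add_right,
      inner_smul_left, inner_smul_right, P.inner_e_e, P.inner_i_e, P.inner_j_e, P.inner_e_i,
      P.inner_e_j, P.inner_i_j, P.inner_j_i, P.i.inner_map_map, P.j.inner_map_map, conj_trivial,
      this, h2]
    ring
  have hS' := hS.sub (hμ.isTangentProduct_deform hskew)
  obtain ⟨F', hF', h⟩ := P.exists_deform_of_apply_e_eq_zero b hμ hS' <| by
    set S' := S - deform μ F
    have hee' : S' P.e P.e = 0 := by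
      simp only [S', LinearMap.sub_apply, deform_apply, P.mul_e_e, hFe, map_smul,
        LinearMap.smul_apply, P.mul_i_e, P.mul_e_i]
      rw [hee]
      module
    have hij' : ∀ u w, inner ℝ (S' P.e (P.i u)) (P.j w) = 0 := fun u w ↦ by
      simp only [S', LinearMap.sub_apply, deform_apply, P.mul_e_i, hFe, hFi, map_smul, map_neg,
        LinearMap.smul_apply, P.mul_i_i, map_add, P.mul_e_e, P.mul_e_j, inner_sub_left,
        inner_add_left, inner_smul_left, inner_neg_left, P.inner_e_j, P.j.inner_map_map,
        conj_trivial, hA, inner_pW]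
      ring
    have hii' : ∀ u, inner ℝ (S' P.e (P.i u)) (P.i u) = 0 := fun u ↦ by
      have h1 := quartic_second hμ.comm hS'.comm hS'.quartic P.e (P.i u)
      have h2 : inner ℝ (S' P.e (P.i u)) (P.i u) = inner ℝ (S' (P.i u) (P.i u)) P.e := by
        rw [hS'.assoc, real_inner_comm]
      rw [hee', inner_zero_left, P.mul_e_i, inner_neg_right, P.mul_e_e, ← h2] at h1
      linarith
    have hjj' : ∀ u, inner ℝ (S' P.e (P.j u)) (P.j u) = 0 := fun u ↦ by
      have h1 := quartic_second hμ.comm hS'.comm hS'.quartic P.e (P.j u)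
      have h2 : inner ℝ (S' P.e (P.j u)) (P.j u) = inner ℝ (S' (P.j u) (P.j u)) P.e := by
        rw [hS'.assoc, real_inner_comm]
      rw [hee', inner_zero_left, P.mul_e_j, inner_smul_right, P.mul_e_e, ← h2] at h1
      linarith
    have hassoc : ∀ x y, inner ℝ (S' P.e x) y = inner ℝ (S' P.e y) x := fun x y ↦ by
      rw [hS'.comm, hS'.assoc, real_inner_comm]
    refine P.ext_linear (by rw [hee']; rfl) (fun u ↦ P.ext_inner ?_ (fun v ↦ ?_) fun w ↦ ?_)
      fun w ↦ P.ext_inner ?_ (fun v ↦ ?_) fun w' ↦ ?_ <;>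
    rw [LinearMap.zero_apply, inner_zero_left]
    · rw [hassoc, hee', inner_zero_left]
    · have h1 := hii' (u + v)
      have h2 := hassoc (P.i u) (P.i v)
      simp only [map_add, inner_add_left, inner_add_right, hii'] at h1
      linarith
    · exact hij' u w
    · rw [hassoc, hee', inner_zero_left]
    · rw [hassoc, hij']
    · have h1 := hjj' (w + w')
      have h2 := hassoc (P.j w) (P.j w')
      simp only [map_add, inner_add_left, inner_add_right, hjj'] at h1
      linarith
  exact ⟨F + F', hskew.add hF', by rw [map_add, ← h]; abel⟩

end PeirceDecomposition

/-! ### Symmetric bilinear maps tangent to the metric and the cubic form -/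

/-- The symmetrization of an endomorphism-valued linear map. -/
noncomputable def symmPart {V : Type*} [AddCommGroup V] [Module ℝ V] (D : V →ₗ[ℝ] Module.End ℝ V) :
    V →ₗ[ℝ] V →ₗ[ℝ] V :=
  (1 / 2 : ℝ) • (D + LinearMap.flip D)

theorem symmPart_apply {V : Type*} [AddCommGroup V] [Module ℝ V] (D : V →ₗ[ℝ] Module.End ℝ V)
    (x y : V) : symmPart D x y = (1 / 2 : ℝ) • (D x y + D y x) := rfl

/-- Symmetric bilinear maps killing, to first order, both `|x|²` and the cubic form of `μ`. -/
structure IsTangentField {V : Type*} [NormedAddCommGroup V] [InnerProductSpace ℝ V]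
    (μ β : V →ₗ[ℝ] V →ₗ[ℝ] V) : Prop where
  comm : ∀ x y, β x y = β y x
  inner_self : ∀ x, inner ℝ (β x x) x = 0
  quartic : ∀ x, inner ℝ (β x x) (μ x x) = 0

theorem IsTangentField.sub_symmPart {V : Type*} [NormedAddCommGroup V] [InnerProductSpace ℝ V]
    {μ β : V →ₗ[ℝ] V →ₗ[ℝ] V} (hβ : IsTangentField μ β) (hμ : IsCubicProduct μ)
    {D : V →ₗ[ℝ] Module.End ℝ V} (hD : ∀ x, IsSkewDerivation μ (D x)) :
    IsTangentField μ (β - symmPart D) where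
  comm x y := by
    simp only [LinearMap.sub_apply, symmPart_apply, hβ.comm x y, add_comm]
  inner_self x := by
    simp only [LinearMap.sub_apply, symmPart_apply, inner_sub_left, inner_smul_left, inner_add_left,
      hβ.inner_self, (hD x).skew.inner_self]
    simp
  quartic x := by
    have h1 : inner ℝ (D x x) (μ x x) = 0 := by
      have h2 := (hD x).skew x (μ x x)
      rw [(hD x).leibniz, inner_add_right, hμ.comm (D x x) x, ← hμ.assoc x x] at h2
      have h3 := real_inner_comm (D x x) (μ x x)
      linarith
    simp only [LinearMap.sub_apply, symmPart_apply, inner_sub_left, inner_smul_left, inner_add_left,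
      hβ.quartic, h1]
    simp

namespace PeirceDecomposition

variable {V U W : Type*} [NormedAddCommGroup V] [InnerProductSpace ℝ V] [NormedAddCommGroup U]
  [InnerProductSpace ℝ U] [NormedAddCommGroup W] [InnerProductSpace ℝ W]
  {μ : V →ₗ[ℝ] V →ₗ[ℝ] V} [FiniteDimensional ℝ V] [FiniteDimensional ℝ U]
  [FiniteDimensional ℝ W] (P : PeirceDecomposition μ U W) {ι : Type*} [Fintype ι]

/-- If `β` vanishes on `e`, then its remaining components are `U × U → U`, `U × W → U`, `U × W → W`
and `W × W → W`. The first and the third come from infinitesimal automorphisms of the Clifford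
system up to a term `γ u J`, and the other two from automorphisms as well, with the help of
`exists_commutant_of_inner_eq_zero`. The term `γ u J` is produced by transvections along multiples
of `J w`, whose values at `e` are cancelled by a derivation acting as a multiple of `J` on `W`. -/
theorem exists_derivation_of_apply_e_eq_zero [Nontrivial W]
    (hι : Fintype.card ι = 2 ∨ Fintype.card ι = 5) (b : OrthonormalBasis ι ℝ U)
    (hμ : IsCubicProduct μ) {β : V →ₗ[ℝ] V →ₗ[ℝ] V} (hβ : IsTangentField μ β) (he : β P.e = 0) :
    ∃ D : V →ₗ[ℝ] Module.End ℝ V, (∀ x, IsSkewDerivation μ (D x)) ∧ β = symmPart D := by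
  have he' : ∀ x, β x P.e = 0 := fun x ↦ by rw [hβ.comm, he]; rfl
  have hβe : ∀ x, inner ℝ (β x x) P.e = 0 := fun x ↦ by
    have := cubic_first hβ.comm hβ.inner_self x P.e
    rw [he', inner_zero_left] at this
    linarith
  have hβe' : ∀ x y, inner ℝ (β x y) P.e = 0 := fun x y ↦ by
    have := hβe (x + y)
    simp only [map_add, LinearMap.add_apply, inner_add_left, hβe, hβ.comm y x] at this
    linarith
  have hμe : ∀ x, inner ℝ (β x x) (μ x P.e) = 0 := fun x ↦ by
    have := quartic_first hμ.comm hβ.comm hβ.quartic x P.e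
    rwa [he', inner_zero_left, add_zero] at this
  have hU : ∀ u w, inner ℝ (β (P.i u + P.j w) (P.i u + P.j w)) (P.i u) = 0 ∧
      inner ℝ (β (P.i u + P.j w) (P.i u + P.j w)) (P.j w) = 0 := fun u w ↦ by
    have h1 := hμe (P.i u + P.j w)
    have h2 := hβ.inner_self (P.i u + P.j w)
    rw [map_add μ, LinearMap.add_apply, P.mul_i_e, P.mul_j_e, inner_add_right, inner_neg_right,
      inner_smul_right] at h1
    rw [inner_add_right] at h2
    constructor <;> linarith
  have hpieces : ∀ u w, (inner ℝ (β (P.i u) (P.j w)) (P.i u) = 0 ∧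
      inner ℝ (β (P.j w) (P.j w)) (P.i u) = 0) ∧ (inner ℝ (β (P.i u) (P.i u)) (P.j w) = 0 ∧
      inner ℝ (β (P.i u) (P.j w)) (P.j w) = 0) := fun u w ↦ by
    have h1 := hU u w
    have h2 := hU u (-w)
    have h3 := hβ.inner_self (P.i u)
    have h4 := hβ.inner_self (P.j w)
    simp only [map_add, map_neg, LinearMap.add_apply, LinearMap.neg_apply, inner_add_left,
      inner_neg_left, inner_neg_right, h3, h4, hβ.comm (P.j w) (P.i u)] at h1 h2
    obtain ⟨h11, h12⟩ := h1
    obtain ⟨h21, h22⟩ := h2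
    refine ⟨⟨?_, ?_⟩, ?_, ?_⟩ <;> linarith
  -- The components of `β`; the factors `2` make `N` and `K` the values of a family of derivations.
  obtain ⟨ρ, hρ⟩ : ∃ ρ : U →ₗ[ℝ] U →ₗ[ℝ] U, ∀ u v, ρ u v = P.pU (β (P.i u) (P.i v)) :=
    ⟨(β.compl₁₂ P.i.toLinearMap P.i.toLinearMap).compr₂ P.pU, fun _ _ ↦ rfl⟩
  obtain ⟨N, hN⟩ : ∃ N : U →ₗ[ℝ] Module.End ℝ W, ∀ u w,
      N u w = (2 : ℝ) • P.pW (β (P.i u) (P.j w)) :=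
    ⟨(2 : ℝ) • (β.compl₁₂ P.i.toLinearMap P.j.toLinearMap).compr₂ P.pW, fun _ _ ↦ rfl⟩
  obtain ⟨K, hK⟩ : ∃ K : W →ₗ[ℝ] Module.End ℝ U, ∀ w u,
      K w u = (2 : ℝ) • P.pU (β (P.j w) (P.i u)) :=
    ⟨(2 : ℝ) • (β.compl₁₂ P.j.toLinearMap P.i.toLinearMap).compr₂ P.pU, fun _ _ ↦ rfl⟩
  obtain ⟨η, hη⟩ : ∃ η : W →ₗ[ℝ] W →ₗ[ℝ] W, ∀ w w', η w w' = P.pW (β (P.j w) (P.j w')) :=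
    ⟨(β.compl₁₂ P.j.toLinearMap P.j.toLinearMap).compr₂ P.pW, fun _ _ ↦ rfl⟩
  have hNs : ∀ u, IsSkewMap (N u) := fun u ↦ .of_inner_self fun w ↦ by
    rw [hN, inner_smul_left, inner_pW, (hpieces u w).2.2, mul_zero]
  have hKs : ∀ w, IsSkewMap (K w) := fun w ↦ .of_inner_self fun u ↦ by
    rw [hK, inner_smul_left, inner_pU, hβ.comm, (hpieces u w).1.1, mul_zero]
  have hρs : ∀ u v, ρ u v = ρ v u := fun u v ↦ by rw [hρ, hρ, hβ.comm]
  have hηs : ∀ u v, η u v = η v u := fun u v ↦ by rw [hη, hη, hβ.comm]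
  have hii : ∀ u v, β (P.i u) (P.i v) = P.i (ρ u v) := fun u v ↦ by
    have h1 : ∀ u, β (P.i u) (P.i u) = P.i (ρ u u) := fun u ↦ by
      refine P.ext_inner ?_ (fun v ↦ ?_) fun w ↦ ?_
      · rw [hβe, P.inner_i_e]
      · rw [P.i.inner_map_map, hρ, inner_pU]
      · rw [(hpieces u w).2.1, P.inner_i_j]
    have h2 := h1 (u + v)
    simp only [map_add, LinearMap.add_apply, h1, hβ.comm (P.i v), hρs v] at h2
    linear_combination (norm := module) (1 / 2 : ℝ) • h2
  have hjj : ∀ u v, β (P.j u) (P.j v) = P.j (η u v) := fun u v ↦ by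
    have h1 : ∀ u, β (P.j u) (P.j u) = P.j (η u u) := fun w ↦ by
      refine P.ext_inner ?_ (fun v ↦ ?_) fun z ↦ ?_
      · rw [hβe, P.inner_j_e]
      · rw [(hpieces v w).1.2, P.inner_j_i]
      · rw [P.j.inner_map_map, hη, inner_pW]
    have h2 := h1 (u + v)
    simp only [map_add, LinearMap.add_apply, h1, hβ.comm (P.j v), hηs v] at h2
    linear_combination (norm := module) (1 / 2 : ℝ) • h2
  have hij : ∀ u w, β (P.i u) (P.j w) = (1 / 2 : ℝ) • (P.i (K w u) + P.j (N u w)) := fun u w ↦ by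
    have h1 := P.eq_add (β (P.i u) (P.j w))
    rw [hK, hN, hβ.comm (P.j w)]
    rw [hβe'] at h1
    simp only [map_smul]
    linear_combination (norm := module) h1
  have h22 : ∀ u w, inner ℝ (P.γ (ρ u u) w) w + 2 * inner ℝ (N u w) (P.γ u w) = 0 := fun u w ↦ by
    have h1 := quartic_second hμ.comm hβ.comm hβ.quartic (P.i u) (P.j w)
    have h2 := P.inner_q w w (ρ u u)
    rw [real_inner_comm] at h2
    simp only [hii, hij, hjj, P.mul_i_i, P.mul_i_j, P.mul_j_j, inner_add_left, inner_add_right,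
      inner_smul_left, inner_smul_right, P.inner_i_e, P.inner_i_j, P.inner_j_e,
      P.i.inner_map_map, P.j.inner_map_map, h2, conj_trivial] at h1
    apply mul_left_cancel₀ P.κ_ne_zero
    linarith
  have h13 : ∀ u w, 2 * inner ℝ (η w w) (P.γ u w) + inner ℝ (P.γ (K w u) w) w = 0 := fun u w ↦ by
    have h1 := quartic_first hμ.comm hβ.comm hβ.quartic (P.j w) (P.i u)
    have h2 := P.inner_q w w (K w u)
    rw [real_inner_comm] at h2
    rw [hβ.comm (P.j w) (P.i u)] at h1
    simp only [hij, hjj, P.mul_j_i, P.mul_j_j, inner_add_left, inner_add_right,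
      inner_smul_left, inner_smul_right, P.inner_i_e, P.inner_j_i, P.inner_j_e,
      P.i.inner_map_map, P.j.inner_map_map, h2, conj_trivial] at h1
    apply mul_left_cancel₀ P.κ_ne_zero
    linarith
  obtain ⟨J, R, N', hJ, hJγ, hR, hN', hRρ, hNN', hNR⟩ := P.exists_decomposition hι b N hNs ρ hρs
    (fun u ↦ by rw [hρ, inner_pU, hβ.inner_self]) h22
  -- The correction of `η` by the spin lifts of `K`.
  obtain ⟨L, hL⟩ : ∃ L : W →ₗ[ℝ] Module.End ℝ W, ∀ w, L w = P.spinLift b (K w) :=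
    ⟨(P.spinLift b).comp K, fun _ ↦ rfl⟩
  have hLs : ∀ w, IsSkewMap (L w) := fun w ↦ hL w ▸ P.spinLift_skew b (hKs w)
  have hLγ : ∀ w u, L w * P.γ u - P.γ u * L w = P.γ (K w u) := fun w u ↦
    hL w ▸ P.spinLift_bracket b (hKs w) u
  obtain ⟨G, hG, hGγ, hGη⟩ := P.exists_commutant_of_inner_eq_zero hι b (η - symmPart L)
    (fun w y ↦ by simp only [LinearMap.sub_apply, symmPart_apply, hηs w y, add_comm]) fun u w ↦ by
      have h1 := congrArg (fun z ↦ inner ℝ z w) (LinearMap.congr_fun (hLγ w u) w)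
      simp only [LinearMap.sub_apply, Module.End.mul_apply, inner_sub_left, P.symm] at h1
      rw [hLs, real_inner_comm (P.γ u w)] at h1
      have h2 := h13 u w
      rw [P.symm] at h2
      have h3 := real_inner_comm (L w w) (P.γ u w)
      simp only [LinearMap.sub_apply, symmPart_apply, inner_sub_left, inner_smul_left,
        inner_add_left, conj_trivial]
      linarith
  set J' : Module.End ℝ W := (3 / (2 * P.κ)) • J with hJ'
  have hJJ' : ∀ w, J w = (2 * P.κ / 3) • J' w := fun w ↦ by
    have := P.κ_ne_zero
    rw [hJ', LinearMap.smul_apply, smul_smul]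
    field_simp
    simp
  have hJ's : IsSkewMap J' := hJ.smul _
  have hJ'γ : ∀ u w, J' (P.γ u w) = P.γ u (J' w) := fun u w ↦ by
    have := LinearMap.congr_fun (hJγ u) w
    simp only [Module.End.mul_apply] at this
    simp only [hJ', LinearMap.smul_apply, this, map_smul]
  have hstab : ∀ w, IsSkewDerivation μ (P.stabU 0 + P.stabW (G w)) := fun w ↦
    P.isSkewDerivation_stab (fun _ _ ↦ by simp) (hG w) fun v ↦ by simp [hGγ]
  have hstabJ : IsSkewDerivation μ (P.stabU 0 + P.stabW J') :=
    P.isSkewDerivation_stab (fun _ _ ↦ by simp) hJ's fun v ↦ by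
      ext w
      simp [hJ'γ]
  refine ⟨P.lift (P.stabW J') (P.stabU.comp R + P.stabW.comp N')
    (P.stabU.comp K + P.stabW.comp (L + G) - P.transv.comp J'), fun x ↦ ?_, ?_⟩
  · obtain ⟨t, u, w, rfl⟩ := P.exists_eq x
    simp only [map_add, map_smul, lift_e, lift_i, lift_j]
    refine (IsSkewDerivation.add (.smul ?_ t) ?_).add ?_
    · simpa using hstabJ
    · exact P.isSkewDerivation_stab (hR u) (hN' u) (hNR u)
    · have h1 := ((P.isSkewDerivation_stab (hKs w) (hLs w) (hLγ w)).add (hstab w)).add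
        ((P.isSkewDerivation_transv (J' w)).smul (-1))
      convert h1 using 1
      simp only [LinearMap.sub_apply, LinearMap.add_apply, LinearMap.comp_apply, map_add, map_zero]
      module
  · have hRs : ∀ u v, ρ u v = (1 / 2 : ℝ) • (R u v + R v u) := fun u v ↦ by
      have h1 := hRρ (u + v)
      simp only [map_add, LinearMap.add_apply, hRρ, hρs v u] at h1
      linear_combination (norm := module) (-1 / 2 : ℝ) • h1
    have hGs : ∀ w z, η w z = (1 / 2 : ℝ) • (L w z + L z w + G w z + G z w) := fun u v ↦ by
      have h1 := hGη (u + v)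
      simp only [map_add, LinearMap.add_apply, hGη] at h1
      simp only [LinearMap.sub_apply, symmPart_apply, hηs v u] at h1
      linear_combination (norm := module) (-1 / 2 : ℝ) • h1
    have hqJ : ∀ w z, P.q (J' w) z + P.q (J' z) w = 0 := fun w z ↦ by
      refine ext_inner_right ℝ fun u ↦ ?_
      rw [inner_add_left, P.inner_q, P.inner_q, ← hJ'γ, hJ's, P.symm u (J' z),
        real_inner_comm (J' z), inner_zero_left, neg_add_cancel]
    refine P.ext_bilinear hβ.comm (fun x y ↦ ?_) ?_ (fun u ↦ ?_) (fun w ↦ ?_) (fun u v ↦ ?_)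
      (fun u w ↦ ?_) fun w z ↦ ?_
    · simp only [symmPart_apply, add_comm]
    · simp [he, symmPart_apply, stabW_apply]
    · simp [he, symmPart_apply, stabU_apply, stabW_apply]
    · simp [he, symmPart_apply, stabU_apply, stabW_apply]
    · simp [hii, hRs, symmPart_apply, stabU_apply, stabW_apply]
    · rw [hij, hNN']
      simp only [symmPart_apply, lift_i, lift_j, LinearMap.sub_apply, LinearMap.add_apply,
        LinearMap.comp_apply, stabU_apply, stabW_apply, pU_i, pU_j, pW_i, pW_j, map_zero,
        transv_i, Module.End.mul_apply, map_add, hJJ', map_smul]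
      module
    · have h1 := congrArg P.i (hqJ w z)
      have h2 : inner ℝ (J' w) z + inner ℝ (J' z) w = 0 := by
        rw [hJ's, real_inner_comm, hJ's]
        simp
      rw [map_add, map_zero] at h1
      rw [hjj, hGs]
      simp only [symmPart_apply, lift_j, LinearMap.sub_apply, LinearMap.add_apply,
        LinearMap.comp_apply, stabU_apply, stabW_apply, pU_j, pW_j, map_zero,
        transv_j, map_add, map_smul]
      linear_combination (norm := module) (P.κ / 3) • h1 - ((1 / 2 : ℝ) * h2) • P.e

/-- If `β e e = 0`, then `β e` maps `U` to `U ⊕ W` and `W` to `W`. Its component on `U → U` is skew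
and lifts to a derivation assigned to `e`; the components with values in `W` are removed by
transvections. -/
theorem exists_derivation_of_apply_e_e_eq_zero [Nontrivial W]
    (hι : Fintype.card ι = 2 ∨ Fintype.card ι = 5) (b : OrthonormalBasis ι ℝ U)
    (hμ : IsCubicProduct μ) {β : V →ₗ[ℝ] V →ₗ[ℝ] V} (hβ : IsTangentField μ β)
    (hee : β P.e P.e = 0) :
    ∃ D : V →ₗ[ℝ] Module.End ℝ V, (∀ x, IsSkewDerivation μ (D x)) ∧ β = symmPart D := by
  have h0 : ∀ y, inner ℝ (β P.e y) P.e = 0 := fun y ↦ by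
    have := cubic_first hβ.comm hβ.inner_self P.e y
    rw [hee, inner_zero_left] at this
    linarith
  have hc : ∀ y, inner ℝ (β y y) P.e + 2 * inner ℝ (β P.e y) y = 0 := fun y ↦ by
    have := cubic_first hβ.comm hβ.inner_self y P.e
    rw [hβ.comm y P.e] at this
    linarith
  have hq : ∀ y, 4 * inner ℝ (β P.e y) (μ P.e y) + inner ℝ (β y y) P.e = 0 := fun y ↦ by
    have := quartic_second hμ.comm hβ.comm hβ.quartic P.e y
    rwa [hee, inner_zero_left, zero_add, P.mul_e_e] at this
  obtain ⟨ρ, hρ⟩ : ∃ ρ : Module.End ℝ U, ∀ u, ρ u = P.pU (β P.e (P.i u)) :=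
    ⟨P.pU.comp ((β P.e).comp P.i.toLinearMap), fun _ ↦ rfl⟩
  obtain ⟨a, ha⟩ : ∃ a : U →ₗ[ℝ] W, ∀ u, a u = P.pW (β P.e (P.i u)) :=
    ⟨P.pW.comp ((β P.e).comp P.i.toLinearMap), fun _ ↦ rfl⟩
  obtain ⟨c, hc'⟩ : ∃ c : Module.End ℝ W, ∀ w, c w = P.pW (β P.e (P.j w)) :=
    ⟨P.pW.comp ((β P.e).comp P.j.toLinearMap), fun _ ↦ rfl⟩
  have hρs : IsSkewMap ρ := .of_inner_self fun u ↦ by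
    have h1 := hc (P.i u)
    have h2 := hq (P.i u)
    rw [P.mul_e_i, inner_neg_right] at h2
    rw [hρ, inner_pU]
    linarith
  have hjU : ∀ w u, inner ℝ (β P.e (P.j w)) (P.i u) = 0 := fun w u ↦ by
    have h1 := hc (P.i u + P.j w)
    have h2 := hq (P.i u + P.j w)
    have h3 := hc (P.i u - P.j w)
    have h4 := hq (P.i u - P.j w)
    simp only [map_add, map_sub, P.mul_e_i, P.mul_e_j, LinearMap.add_apply, LinearMap.sub_apply,
      inner_add_left, inner_add_right, inner_sub_left, inner_sub_right, inner_neg_right,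
      inner_smul_right] at h1 h2 h3 h4
    linarith
  have hei : ∀ u, β P.e (P.i u) = P.i (ρ u) + P.j (a u) := fun u ↦ by
    rw [P.eq_add (β P.e (P.i u)), h0, ← hρ, ← ha, zero_smul, zero_add]
  have hej : ∀ w, β P.e (P.j w) = P.j (c w) := fun w ↦ by
    have h1 : P.pU (β P.e (P.j w)) = 0 :=
      ext_inner_right ℝ fun u ↦ by rw [inner_pU, hjU, inner_zero_left]
    rw [P.eq_add (β P.e (P.j w)), h0, h1, ← hc', zero_smul, zero_add, map_zero, zero_add]
  set L := P.spinLift b ((2 : ℝ) • ρ)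
  set D : V →ₗ[ℝ] Module.End ℝ V := P.lift (P.stabU ((2 : ℝ) • ρ) + P.stabW L)
    (P.transv.comp ((2 : ℝ) • a)) (P.transv.comp ((2 : ℝ) • c - L)) with hD
  have hDs : ∀ x, IsSkewDerivation μ (D x) := fun x ↦ by
    obtain ⟨t, u, w, rfl⟩ := P.exists_eq x
    simp only [hD, map_add, map_smul, lift_e, lift_i, lift_j]
    have hstab := P.isSkewDerivation_stab (hρs.smul 2) (P.spinLift_skew b (hρs.smul 2))
      (P.spinLift_bracket b (hρs.smul 2))
    rw [map_smul P.stabU] at hstab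
    exact (IsSkewDerivation.add (hstab.smul t)
      (P.isSkewDerivation_transv _)).add (P.isSkewDerivation_transv _)
  obtain ⟨D', hD', h⟩ := P.exists_derivation_of_apply_e_eq_zero hι b hμ (hβ.sub_symmPart hμ hDs) <| by
    refine P.ext_linear ?_ (fun u ↦ ?_) fun w ↦ ?_
    · simp [hee, hD, symmPart_apply, stabU_apply, stabW_apply]
    · simp only [hD, LinearMap.sub_apply, hei, symmPart_apply, lift_e, lift_i, LinearMap.add_apply,
        LinearMap.comp_apply, LinearMap.smul_apply, stabU_apply, stabW_apply, pU_i, pW_i, map_zero,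
        transv_e, map_smul, LinearMap.zero_apply]
      module
    · simp only [hD, LinearMap.sub_apply, hej, symmPart_apply, lift_e, lift_j, LinearMap.add_apply,
        LinearMap.comp_apply, LinearMap.smul_apply, stabU_apply, stabW_apply, pU_j, pW_j, map_zero,
        transv_e, map_smul, LinearMap.zero_apply, map_sub]
      module
  refine ⟨D + D', fun x ↦ (hDs x).add (hD' x), ?_⟩
  rw [sub_eq_iff_eq_add] at h
  ext x y
  simp only [h, LinearMap.add_apply, symmPart_apply]
  module

/-- Symmetric bilinear maps tangent to the pair (metric, cubic form) come from derivations. As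
`β e e` lies in `W`, a transvection assigned to `e` reduces to the case `β e e = 0`. -/
theorem exists_derivation (P : PeirceDecomposition μ U W) [Nontrivial W]
    (hι : Fintype.card ι = 2 ∨ Fintype.card ι = 5) (b : OrthonormalBasis ι ℝ U)
    (hμ : IsCubicProduct μ) {β : V →ₗ[ℝ] V →ₗ[ℝ] V} (hβ : IsTangentField μ β) :
    ∃ D : V →ₗ[ℝ] Module.End ℝ V, (∀ x, IsSkewDerivation μ (D x)) ∧ β = symmPart D := by
  have hee : β P.e P.e = P.j (P.pW (β P.e P.e)) := by
    have h1 := cubic_first hβ.comm hβ.inner_self P.e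
    have h2 := quartic_first hμ.comm hβ.comm hβ.quartic P.e
    simp only [P.mul_e_e] at h2
    refine P.ext_inner ?_ (fun u ↦ ?_) fun w ↦ ?_
    · rw [hβ.inner_self, P.inner_j_e]
    · have h3 := h1 (P.i u)
      have h4 := h2 (P.i u)
      rw [P.mul_e_i, inner_neg_right] at h4
      rw [P.inner_j_i]
      linarith
    · rw [P.j.inner_map_map, inner_pW]
  set w := P.pW (β P.e P.e)
  set D : V →ₗ[ℝ] Module.End ℝ V := P.lift (P.transv w) 0 0 with hD
  have hDs : ∀ x, IsSkewDerivation μ (D x) := fun x ↦ by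
    obtain ⟨t, u, z, rfl⟩ := P.exists_eq x
    simp only [hD, map_add, map_smul, lift_e, lift_i, lift_j, LinearMap.zero_apply, add_zero]
    exact (P.isSkewDerivation_transv w).smul t
  obtain ⟨D', hD', h⟩ := P.exists_derivation_of_apply_e_e_eq_zero hι b hμ
    (hβ.sub_symmPart hμ hDs) <| by
      simp only [hD, LinearMap.sub_apply, symmPart_apply, lift_e, transv_e]
      rw [hee]
      module
  refine ⟨D + D', fun x ↦ (hDs x).add (hD' x), ?_⟩
  rw [sub_eq_iff_eq_add] at h
  ext x y
  simp only [h, LinearMap.add_apply, symmPart_apply]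
  module

end PeirceDecomposition

/-! ### Skew-symmetric families of derivations -/

namespace PeirceDecomposition

variable {V U W : Type*} [NormedAddCommGroup V] [InnerProductSpace ℝ V] [NormedAddCommGroup U]
  [InnerProductSpace ℝ U] [NormedAddCommGroup W] [InnerProductSpace ℝ W]
  {μ : V →ₗ[ℝ] V →ₗ[ℝ] V} [FiniteDimensional ℝ V] [FiniteDimensional ℝ U]
  [FiniteDimensional ℝ W] (P : PeirceDecomposition μ U W) {ι : Type*} [Fintype ι]

theorem eq_j_of_mul_e {x : V} (h : μ P.e x = (1 / 2 : ℝ) • x) : x = P.j (P.pW x) := by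
  obtain ⟨t, u, w, rfl⟩ := P.exists_eq x
  simp only [map_add, map_smul, P.mul_e_e, P.mul_e_i, P.mul_e_j] at h
  have h1 := congrArg (fun z ↦ inner ℝ z P.e) h
  have h2 := congrArg P.pU h
  simp [inner_add_left, inner_smul_left, P.inner_e_e, P.inner_i_e, P.inner_j_e,
    -inner_self_eq_norm_sq_to_K] at h1
  simp only [map_add, map_neg, map_smul, pU_e, pU_i, pU_j] at h2
  have h3 : t = 0 := by linarith
  have h4 : u = 0 := by
    have : (3 / 2 : ℝ) • u = 0 := by
      rw [h3] at h2
      linear_combination (norm := module) (-1 : ℝ) • h2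
    simpa using this
  simp [h3, h4]

theorem eq_i_of_mul_e {x : V} (h : μ P.e x = -x) : x = P.i (P.pU x) := by
  obtain ⟨t, u, w, rfl⟩ := P.exists_eq x
  simp only [map_add, map_smul, P.mul_e_e, P.mul_e_i, P.mul_e_j] at h
  have h1 := congrArg (fun z ↦ inner ℝ z P.e) h
  have h2 := congrArg P.pW h
  simp [inner_add_left, inner_smul_left, P.inner_e_e, P.inner_i_e, P.inner_j_e,
    -inner_self_eq_norm_sq_to_K] at h1
  simp only [map_add, map_neg, map_smul, pW_e, pW_i, pW_j] at h2
  have h3 : t = 0 := by linarith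
  have h4 : w = 0 := by
    have : (3 / 2 : ℝ) • w = 0 := by
      rw [h3] at h2
      linear_combination (norm := module) h2
    simpa using this
  simp [h3, h4]

theorem apply_e_of_isSkewDerivation {D : Module.End ℝ V} (hD : IsSkewDerivation μ D) :
    D P.e = P.j (P.pW (D P.e)) := by
  have h := hD.leibniz P.e P.e
  rw [P.mul_e_e, P.mul_comm (D P.e)] at h
  exact P.eq_j_of_mul_e (by linear_combination (norm := module) (-1 / 2 : ℝ) • h)

theorem apply_i_of_isSkewDerivation {D : Module.End ℝ V} (hD : IsSkewDerivation μ D)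
    (h0 : D P.e = 0) (u : U) : D (P.i u) = P.i (P.pU (D (P.i u))) := by
  have h := hD.leibniz P.e (P.i u)
  rw [P.mul_e_i, h0, map_zero, LinearMap.zero_apply, zero_add, map_neg] at h
  exact P.eq_i_of_mul_e h.symm

theorem apply_j_of_isSkewDerivation {D : Module.End ℝ V} (hD : IsSkewDerivation μ D)
    (h0 : D P.e = 0) (w : W) : D (P.j w) = P.j (P.pW (D (P.j w))) := by
  have h := hD.leibniz P.e (P.j w)
  rw [P.mul_e_j, h0, map_zero, LinearMap.zero_apply, zero_add, map_smul] at h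
  exact P.eq_j_of_mul_e h.symm

/-- A derivation fixing `e` acts on the Clifford system. -/
theorem bracket_of_isSkewDerivation {D : Module.End ℝ V} (hD : IsSkewDerivation μ D)
    (h0 : D P.e = 0) (u : U) (w : W) :
    P.pW (D (P.j (P.γ u w))) = P.γ (P.pU (D (P.i u))) w + P.γ u (P.pW (D (P.j w))) := by
  have h := hD.leibniz (P.i u) (P.j w)
  rw [P.apply_i_of_isSkewDerivation hD h0, P.apply_j_of_isSkewDerivation hD h0] at h
  simp only [P.mul_i_j, map_smul, ← smul_add] at h
  rw [P.apply_j_of_isSkewDerivation hD h0, ← map_add] at h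
  exact P.j.injective (smul_right_injective V P.κ_ne_zero h)

/-- No nonzero linear family of derivations is totally skew-symmetric. The derivation assigned to
`e` acts on `W` by some `J` in the commutant of `γ`, skew-symmetry propagates `J` to the derivations
assigned to `U` and `W`, and `eq_zero_of_bracket_mul` yields `J = 0`. What remains is an alternating
map `W × W → W` with values in the commutant of `γ`, which vanishes by `eq_zero_of_commute`. -/
theorem derivation_eq_zero (P : PeirceDecomposition μ U W) [Nontrivial W]
    (hι : Fintype.card ι = 2 ∨ Fintype.card ι = 5) (b : OrthonormalBasis ι ℝ U)
    {D : V →ₗ[ℝ] Module.End ℝ V} (hD : ∀ x, IsSkewDerivation μ (D x)) (h0 : ∀ x, D x x = 0) :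
    D = 0 := by
  have hsw : ∀ x y, D x y = -D y x := fun x y ↦ by
    have h1 := h0 (x + y)
    simp only [map_add, LinearMap.add_apply, h0, zero_add, add_zero] at h1
    exact eq_neg_of_add_eq_zero_right h1
  have hie : ∀ u, D (P.i u) P.e = 0 := fun u ↦ by
    have h1 := P.apply_i_of_isSkewDerivation (hD P.e) (h0 P.e) u
    rw [hsw P.e, P.apply_e_of_isSkewDerivation (hD (P.i u))] at h1
    have h2 := congrArg P.pW h1
    simp only [map_neg, pW_j, pW_i] at h2
    rw [P.apply_e_of_isSkewDerivation (hD (P.i u)), neg_inj.1 h2, map_zero]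
  have hei : ∀ u, D P.e (P.i u) = 0 := fun u ↦ by rw [hsw, hie, neg_zero]
  obtain ⟨J, hJ⟩ : ∃ J : Module.End ℝ W, ∀ w, J w = P.pW (D P.e (P.j w)) :=
    ⟨P.pW.comp ((D P.e).comp P.j.toLinearMap), fun _ ↦ rfl⟩
  have hJj : ∀ w, D P.e (P.j w) = P.j (J w) := fun w ↦ by
    rw [hJ, ← P.apply_j_of_isSkewDerivation (hD P.e) (h0 P.e)]
  have hJγ : ∀ u w, J (P.γ u w) = P.γ u (J w) := fun u w ↦ by
    have h1 := P.bracket_of_isSkewDerivation (hD P.e) (h0 P.e) u w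
    rwa [hei, map_zero, map_zero, LinearMap.zero_apply, zero_add, ← hJ, ← hJ] at h1
  obtain ⟨N, hN⟩ : ∃ N : U →ₗ[ℝ] Module.End ℝ W, ∀ u w, N u w = P.pW (D (P.i u) (P.j w)) :=
    ⟨(D.compl₁₂ P.i.toLinearMap P.j.toLinearMap).compr₂ P.pW, fun _ _ ↦ rfl⟩
  have hNj : ∀ u w, D (P.i u) (P.j w) = P.j (N u w) := fun u w ↦ by
    rw [hN, ← P.apply_j_of_isSkewDerivation (hD _) (hie u)]
  have hNJ : ∀ u w, N u w = (-(2 * P.κ / 3)) • P.γ u (J w) := fun u w ↦ by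
    -- Correcting `D (j w)` by a transvection gives a derivation fixing `e`.
    have h1 : IsSkewDerivation μ (D (P.j w) + P.transv (J w)) :=
      (hD _).add (P.isSkewDerivation_transv _)
    have h2 := P.apply_i_of_isSkewDerivation h1 (by simp [hsw _ P.e, hJj]) u
    have h3 := congrArg P.pW h2
    simp only [LinearMap.add_apply, hsw _ (P.i u), hNj, transv_i, map_add, map_neg, pW_i, map_smul,
      pW_j] at h3
    linear_combination (norm := module) (-1 : ℝ) • h3
  have hJ0 : J = 0 := P.eq_zero_of_bracket_mul hι b (fun u ↦ by ext w; simp [hJγ]) fun u v ↦ by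
    refine ⟨(-(3 / (2 * P.κ))) • P.pU (D (P.i u) (P.i v)), ?_⟩
    ext w
    have h1 := P.bracket_of_isSkewDerivation (hD _) (hie u) v w
    have hκ := P.κ_ne_zero
    rw [← hN, ← hN, hNJ, hNJ, hJγ] at h1
    simp only [map_smul, LinearMap.smul_apply, LinearMap.sub_apply, Module.End.mul_apply]
    rw [← sub_eq_iff_eq_add] at h1
    rw [← h1]
    simp only [smul_sub, map_smul, smul_smul]
    have h2 : -(3 / (2 * P.κ)) * -(2 * P.κ / 3) = 1 := by field_simp
    rw [h2, one_smul, one_smul]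
  have hej : ∀ w, D P.e (P.j w) = 0 := fun w ↦ by rw [hJj, hJ0, LinearMap.zero_apply, map_zero]
  have hje : ∀ w, D (P.j w) P.e = 0 := fun w ↦ by rw [hsw, hej, neg_zero]
  have hij : ∀ u w, D (P.i u) (P.j w) = 0 := fun u w ↦ by
    rw [hNj, hNJ, hJ0, LinearMap.zero_apply, map_zero, smul_zero, map_zero]
  have hji : ∀ u w, D (P.j w) (P.i u) = 0 := fun u w ↦ by rw [hsw, hij, neg_zero]
  have hii : ∀ u v, D (P.i u) (P.i v) = 0 := fun u v ↦ by
    rw [P.apply_i_of_isSkewDerivation (hD _) (hie u), P.γ_injective (u := P.pU _), map_zero]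
    ext w
    have h1 := P.bracket_of_isSkewDerivation (hD _) (hie u) v w
    simpa [hij] using h1.symm
  obtain ⟨G, hG⟩ : ∃ G : W →ₗ[ℝ] Module.End ℝ W, ∀ u w, G u w = P.pW (D (P.j u) (P.j w)) :=
    ⟨(D.compl₁₂ P.j.toLinearMap P.j.toLinearMap).compr₂ P.pW, fun _ _ ↦ rfl⟩
  have hG0 : G = 0 := P.eq_zero_of_commute b (by omega)
    (fun w u ↦ by
      ext z
      have h1 := P.bracket_of_isSkewDerivation (hD _) (hje w) u z
      simpa [hji, ← hG] using h1)
    fun w ↦ by rw [hG, h0, map_zero]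
  have hjj : ∀ w z, D (P.j w) (P.j z) = 0 := fun w z ↦ by
    rw [P.apply_j_of_isSkewDerivation (hD _) (hje w), ← hG, hG0]
    simp
  refine P.ext_linear (P.ext_linear (h0 _) hei hej)
    (fun u ↦ P.ext_linear (hie u) (hii u) (hij u)) fun w ↦ P.ext_linear (hje w) ?_ (hjj w)
  exact fun u ↦ hji u w

end PeirceDecomposition

/-! ### Existence of Peirce decompositions -/

section Existence

variable {V : Type*} [NormedAddCommGroup V] [InnerProductSpace ℝ V] {μ : V →ₗ[ℝ] V →ₗ[ℝ] V}

theorem IsCubicProduct.cube_polar (hμ : IsCubicProduct μ) (x y z : V) :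
    μ (μ x y) z + μ (μ y z) x + μ (μ z x) y
      = inner ℝ x y • z + inner ℝ y z • x + inner ℝ z x • y := by
  have h (a : V) := hμ.cube a
  have e1 := h (x + y + z)
  have e2 := h (x + y)
  have e3 := h (x + z)
  have e4 := h (y + z)
  have e5 := h x
  have e6 := h y
  have e7 := h z
  have c1 := hμ.comm x y
  have c2 := hμ.comm x z
  have c3 := hμ.comm y z
  have i1 := real_inner_comm x y
  have i2 := real_inner_comm x z
  have i3 := real_inner_comm y z
  simp only [map_add, LinearMap.add_apply, inner_add_left, inner_add_right, c1, c2, c3, i1, i2,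
    i3] at e1 e2 e3 e4 e5 e6 e7 ⊢
  linear_combination (norm := module) (1 / 2 : ℝ) • (e1 - e2 - e3 - e4 + e5 + e6 + e7)

theorem IsCubicProduct.inner_mul_self (hμ : IsCubicProduct μ) (x : V) :
    inner ℝ (μ x x) (μ x x) = inner ℝ x x * inner ℝ x x := by
  rw [hμ.assoc, hμ.comm x (μ x x), hμ.cube, inner_smul_right]

/-- The square of a unit vector `x` together with `x` spans a subalgebra, in which a unit idempotent
is found as the multiple of some `x + s • x ∘ x`. -/
theorem IsCubicProduct.exists_idempotent [Nontrivial V] (hμ : IsCubicProduct μ) :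
    ∃ e : V, inner ℝ e e = (1 : ℝ) ∧ μ e e = e := by
  obtain ⟨x, hx⟩ := exists_norm_eq V zero_le_one
  have hxx : inner ℝ x x = (1 : ℝ) := by rw [real_inner_self_eq_norm_sq, hx]; norm_num
  set y := μ x x with hy
  have hyy : inner ℝ y y = (1 : ℝ) := by rw [hy, hμ.inner_mul_self, hxx, one_mul]
  have hny : ‖y‖ = 1 := by
    rw [real_inner_self_eq_norm_sq] at hyy
    nlinarith [norm_nonneg y]
  set c := inner ℝ x y with hc
  have hc1 : -1 ≤ c := by
    have := abs_real_inner_le_norm x y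
    rw [hx, hny, one_mul, ← hc] at this
    exact (abs_le.1 this).1
  have hxy : μ y x = x := by rw [hy, hμ.cube, hxx, one_smul]
  have hyx : μ x y = x := by rw [hμ.comm, hxy]
  have hsq : μ y y = (2 * c) • x - y := by
    have h := hμ.cube_polar x x y
    rw [← hy, hyx, hxy, ← hy, hxx, ← hc, real_inner_comm, ← hc] at h
    linear_combination (norm := module) h
  -- `z = x + s y` has `z ∘ z = (2 s + 2 c s²) x + (1 - s²) y`, which is a multiple of `z` if and
  -- only if `2 c s³ + 3 s² - 1 = 0`.
  obtain ⟨s, ⟨hs0, hs1⟩, hs⟩ : (0 : ℝ) ∈ (fun s : ℝ ↦ 2 * c * s ^ 3 + 3 * s ^ 2 - 1) '' Set.Icc 0 1 :=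
    intermediate_value_Icc (by norm_num) (by fun_prop) ⟨by norm_num, by norm_num; linarith⟩
  simp only at hs
  set l := 2 * s + 2 * c * s ^ 2 with hl
  set z := x + s • y with hz
  have hzz : μ z z = l • z := by
    simp only [hz, map_add, map_smul, LinearMap.add_apply, LinearMap.smul_apply, ← hy, hyx, hxy,
      hsq, hl]
    linear_combination (norm := module) -hs • y
  by_cases hz0 : z = 0
  -- If `z = 0`, then `x = -y`, and `y` itself is idempotent.
  · have h1 : inner ℝ z z = (0 : ℝ) := by rw [hz0, inner_zero_left]
    have h2 : inner ℝ z y = (0 : ℝ) := by rw [hz0, inner_zero_left]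
    simp only [hz, inner_add_left, inner_add_right, inner_smul_left, inner_smul_right, hxx, hyy,
      ← hc, real_inner_comm x y, conj_trivial] at h1 h2
    have hs' : s = 1 := by nlinarith
    refine ⟨y, hyy, ?_⟩
    rw [hs', one_smul] at hz
    have h3 : x = -y := eq_neg_of_add_eq_zero_left (hz ▸ hz0)
    have h4 : y = μ (-y) (-y) := h3 ▸ hy
    rw [map_neg, map_neg, LinearMap.neg_apply, neg_neg] at h4
    exact h4.symm
  · have h1 := hμ.inner_mul_self z
    have h2 : inner ℝ z z ≠ (0 : ℝ) := by simpa using hz0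
    rw [hzz, inner_smul_left, inner_smul_right, conj_trivial, ← mul_assoc] at h1
    have h3 := mul_right_cancel₀ h2 h1
    have hl0 : l ≠ 0 := by
      intro h
      rw [h, mul_zero] at h3
      exact h2 h3.symm
    refine ⟨l⁻¹ • z, ?_, ?_⟩
    · rw [inner_smul_left, inner_smul_right, ← h3, conj_trivial]
      field_simp
    · simp only [map_smul, LinearMap.smul_apply, hzz]
      rw [inv_smul_smul₀ hl0]

/-- The Peirce decomposition with respect to a unit idempotent `e`. The polarization of
`(x ∘ x) ∘ x = |x|² x` at `(e, e, y)` is a quadratic equation for multiplication by `e` on the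
orthogonal complement of `e`, with roots `-1` and `1/2`. -/
theorem IsCubicProduct.exists_peirceDecomposition (hμ : IsCubicProduct μ) {e : V}
    (he : inner ℝ e e = (1 : ℝ)) (hee : μ e e = e) :
    ∃ U W : Submodule ℝ V, Nonempty (PeirceDecomposition μ U W) := by
  obtain ⟨κ, hκ⟩ : ∃ κ : ℝ, κ * κ = 3 / 4 := ⟨√(3 / 4), Real.mul_self_sqrt (by norm_num)⟩
  have hκ0 : κ ≠ 0 := by
    rintro rfl
    norm_num at hκ
  set U := LinearMap.ker (μ e + LinearMap.id) with hU
  set W := LinearMap.ker (μ e - (1 / 2 : ℝ) • LinearMap.id) with hW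
  have memU : ∀ x, x ∈ U ↔ μ e x = -x := fun x ↦ by
    simp [hU, add_eq_zero_iff_eq_neg]
  have memW : ∀ x, x ∈ W ↔ μ e x = (1 / 2 : ℝ) • x := fun x ↦ by
    simp [hW, sub_eq_zero]
  have heU : ∀ u ∈ U, inner ℝ e u = (0 : ℝ) := fun u hu ↦ by
    have h := hμ.assoc e e u
    rw [hee, (memU u).1 hu, inner_neg_right] at h
    linarith
  have heW : ∀ w ∈ W, inner ℝ e w = (0 : ℝ) := fun w hw ↦ by
    have h := hμ.assoc e e w
    rw [hee, (memW w).1 hw, inner_smul_right] at h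
    linarith
  have hUW : ∀ u ∈ U, ∀ w ∈ W, inner ℝ u w = (0 : ℝ) := fun u hu w hw ↦ by
    have h := hμ.assoc u e w
    rw [hμ.comm, (memU u).1 hu, (memW w).1 hw, inner_smul_right, inner_neg_left] at h
    linarith
  have hL : ∀ y, (2 : ℝ) • μ e (μ e y) + μ e y = y + (2 * inner ℝ e y : ℝ) • e := fun y ↦ by
    have h := hμ.cube_polar e e y
    rw [hee, he, hμ.comm y e, hμ.comm (μ e y) e, real_inner_comm e y] at h
    linear_combination (norm := module) h
  have hUU : ∀ u ∈ U, ∀ v ∈ U, μ u v = -inner ℝ u v • e := fun u hu v hv ↦ by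
    have h := hμ.cube_polar e u v
    rw [hμ.comm v e, (memU u).1 hu, (memU v).1 hv, heU u hu,
      real_inner_comm e v, heU v hv,
      hμ.comm (μ u v), map_neg, map_neg, LinearMap.neg_apply, LinearMap.neg_apply, hμ.comm v u] at h
    set p := μ u v + inner ℝ u v • e with hp
    have h1 : μ e p = (2 : ℝ) • p := by
      rw [hp, map_add, map_smul, hee]
      linear_combination (norm := module) h
    have h2 := hL p
    have h3 : inner ℝ e p = (0 : ℝ) := by
      have h := hμ.assoc e e p
      rw [hee, h1, inner_smul_right] at h
      linarith
    rw [h1, map_smul, h1, h3] at h2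
    have h4 : (9 : ℝ) • p = 0 := by linear_combination (norm := module) h2
    have h5 : p = 0 := by simpa using h4
    rw [hp] at h5
    linear_combination (norm := module) h5
  have hUW' : ∀ u ∈ U, ∀ w ∈ W, μ u w ∈ W := fun u hu w hw ↦ by
    have h := hμ.cube_polar e u w
    rw [hμ.comm w e, (memU u).1 hu, (memW w).1 hw, heU u hu, hUW u hu w hw, real_inner_comm e w,
      heW w hw, hμ.comm (μ u w), map_neg, map_smul, LinearMap.neg_apply, LinearMap.smul_apply,
      hμ.comm w u] at h
    rw [memW]
    linear_combination (norm := module) h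
  have hWW : ∀ w ∈ W, ∀ z ∈ W, μ w z - (1 / 2 * inner ℝ w z : ℝ) • e ∈ U := fun w hw z hz ↦ by
    have h := hμ.cube_polar e w z
    rw [hμ.comm z e, (memW w).1 hw, (memW z).1 hz, heW w hw,
      real_inner_comm e z, heW z hz,
      hμ.comm (μ w z), map_smul, map_smul, LinearMap.smul_apply, LinearMap.smul_apply,
      hμ.comm z w] at h
    rw [memU, map_sub, map_smul, hee]
    linear_combination (norm := module) h
  obtain ⟨γ, hγ⟩ : ∃ γ : U →ₗ[ℝ] Module.End ℝ W, ∀ u w, (γ u w : V) = κ⁻¹ • μ u w := by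
    refine ⟨LinearMap.mk₂ ℝ (fun u w ↦ ⟨κ⁻¹ • μ u w, W.smul_mem _ (hUW' u u.2 w w.2)⟩)
      ?_ ?_ ?_ ?_, fun _ _ ↦ rfl⟩ <;> intros <;> ext <;>
    simp only [Submodule.coe_add, Submodule.coe_smul, map_add, map_smul, LinearMap.add_apply,
      LinearMap.smul_apply] <;> module
  obtain ⟨q, hq⟩ : ∃ q : W →ₗ[ℝ] W →ₗ[ℝ] U, ∀ w z,
      (q w z : V) = κ⁻¹ • (μ w z - (1 / 2 * inner ℝ (w : V) (z : V) : ℝ) • e) := by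
    refine ⟨LinearMap.mk₂ ℝ (fun w z ↦ ⟨_, U.smul_mem κ⁻¹ (hWW w w.2 z z.2)⟩) ?_ ?_ ?_ ?_,
      fun _ _ ↦ rfl⟩
    · intro x y z
      ext
      simp only [Submodule.coe_add, map_add, LinearMap.add_apply, inner_add_left]
      module
    · intro c x y
      ext
      simp only [Submodule.coe_smul, map_smul, LinearMap.smul_apply, inner_smul_left, conj_trivial]
      module
    · intro x y z
      ext
      simp only [Submodule.coe_add, map_add, inner_add_right]
      module
    · intro c x y
      ext
      simp only [Submodule.coe_smul, map_smul, inner_smul_right]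
      module
  have hmul : ∀ (u : U) (w : W), μ u w = κ • (γ u w : V) := fun u w ↦ by
    rw [hγ, smul_inv_smul₀ hκ0]
  have hmul' : ∀ w z : W, μ w z = (1 / 2 * inner ℝ (w : V) (z : V) : ℝ) • e + κ • (q w z : V) :=
    fun w z ↦ by rw [hq, smul_inv_smul₀ hκ0]; abel
  refine ⟨U, W, ⟨{
    γ := γ
    q := q
    symm := fun u w z ↦ ?_
    sq := fun u w ↦ ?_
    inner_q := fun w z u ↦ ?_
    fierz := fun w ↦ ?_
    e := e
    i := U.subtypeₗᵢ
    j := W.subtypeₗᵢ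
    κ := κ
    κ_sq := hκ
    inner_e_e := he
    inner_e_i := fun u ↦ heU u u.2
    inner_e_j := fun w ↦ heW w w.2
    inner_i_j := fun u w ↦ hUW u u.2 w w.2
    exists_eq := fun x ↦ ?_
    mul_comm := hμ.comm
    mul_e_e := hee
    mul_e_i := fun u ↦ (memU u).1 u.2
    mul_e_j := fun w ↦ (memW w).1 w.2
    mul_i_i := fun u v ↦ hUU u u.2 v v.2
    mul_i_j := hmul
    mul_j_j := hmul' }⟩⟩
  · rw [Submodule.coe_inner, Submodule.coe_inner, hγ, hγ, inner_smul_left, inner_smul_right,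
      hμ.comm, hμ.assoc, conj_trivial]
  · ext
    have h := hμ.cube_polar u u w
    rw [hUU u u.2 u u.2, hμ.comm w u, hμ.comm _ (u : V), hmul] at h
    simp only [map_smul, LinearMap.smul_apply, hmul, (memW w).1 w.2, real_inner_comm (u : V) w,
      hUW u u.2 w w.2] at h
    rw [Submodule.coe_smul, Submodule.coe_inner]
    have h1 : (2 * (κ * κ)) • (γ u (γ u w) : V) = (3 / 2 * inner ℝ (u : V) (u : V) : ℝ) • (w : V) := by
      linear_combination (norm := module) h
    rw [hκ] at h1
    linear_combination (norm := module) (2 / 3 : ℝ) • h1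
  · rw [Submodule.coe_inner, Submodule.coe_inner, hγ, hq, inner_smul_left, inner_smul_left,
      inner_sub_left, inner_smul_left, heU u u.2, mul_zero, sub_zero, hμ.assoc, real_inner_comm,
      hμ.comm, hμ.assoc, hμ.assoc, hμ.comm]
  · ext
    have h := hμ.cube w
    rw [hmul', map_add, LinearMap.add_apply, map_smul, map_smul, LinearMap.smul_apply,
      LinearMap.smul_apply, (memW w).1 w.2, hmul] at h
    rw [Submodule.coe_smul, Submodule.coe_inner]
    have h1 : (κ * κ) • (γ (q w w) w : V) = (3 / 4 * inner ℝ (w : V) (w : V) : ℝ) • (w : V) := by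
      linear_combination (norm := module) h
    rw [hκ] at h1
    linear_combination (norm := module) (4 / 3 : ℝ) • h1
  · set y := x - inner ℝ e x • e with hy
    have h := hL y
    have h0 : inner ℝ e y = (0 : ℝ) := by
      rw [hy, inner_sub_right, inner_smul_right, he]
      ring
    rw [h0] at h
    refine ⟨inner ℝ e x, ⟨(1 / 3 : ℝ) • (y - (2 : ℝ) • μ e y), (memU _).2 ?_⟩,
      ⟨(2 / 3 : ℝ) • (y + μ e y), (memW _).2 ?_⟩, ?_⟩
    · simp only [map_smul, map_sub]
      linear_combination (norm := module) (-1 / 3 : ℝ) • h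
    · simp only [map_smul, map_add]
      linear_combination (norm := module) (1 / 3 : ℝ) • h
    · change x = inner ℝ e x • e + (1 / 3 : ℝ) • (y - (2 : ℝ) • μ e y) + (2 / 3 : ℝ) • (y + μ e y)
      rw [hy]
      module

end Existence

/-- The dimensions of the Peirce spaces follow from
`0 = tr (μ e) = 1 - dim U + dim W / 2`. -/
theorem PeirceDecomposition.finrank_eq {V U W : Type*} [NormedAddCommGroup V]
    [InnerProductSpace ℝ V] [NormedAddCommGroup U] [InnerProductSpace ℝ U] [NormedAddCommGroup W]
    [InnerProductSpace ℝ W] {μ : V →ₗ[ℝ] V →ₗ[ℝ] V} [FiniteDimensional ℝ V]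
    [FiniteDimensional ℝ U] [FiniteDimensional ℝ W] (P : PeirceDecomposition μ U W)
    (htr : LinearMap.trace ℝ V (μ P.e) = 0) :
    3 * Module.finrank ℝ U = Module.finrank ℝ V + 1 ∧
      Module.finrank ℝ V = 1 + Module.finrank ℝ U + Module.finrank ℝ W := by
  set E : Module.End ℝ V := (innerₛₗ ℝ P.e).smulRight P.e with hE
  have h1 : LinearMap.id = E + P.stabU LinearMap.id + P.stabW LinearMap.id := by
    refine P.ext_linear ?_ (fun u ↦ ?_) fun w ↦ ?_ <;>
    simp [hE, stabU_apply, stabW_apply, P.inner_e_e, P.inner_e_i, P.inner_e_j,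
      -inner_self_eq_norm_sq_to_K]
  have h2 : μ P.e = E - P.stabU LinearMap.id + (1 / 2 : ℝ) • P.stabW LinearMap.id := by
    refine P.ext_linear ?_ (fun u ↦ ?_) fun w ↦ ?_ <;>
    simp [hE, stabU_apply, stabW_apply, P.inner_e_e, P.inner_e_i, P.inner_e_j, P.mul_e_e, P.mul_e_i,
      P.mul_e_j, -inner_self_eq_norm_sq_to_K]
  have hu : LinearMap.trace ℝ V (P.stabU LinearMap.id) = Module.finrank ℝ U := by
    change LinearMap.trace ℝ V (P.i.toLinearMap ∘ₗ P.pU) = _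
    rw [LinearMap.trace_comp_comm', ← LinearMap.trace_id]
    congr 1
    ext u
    simp
  have hw : LinearMap.trace ℝ V (P.stabW LinearMap.id) = Module.finrank ℝ W := by
    change LinearMap.trace ℝ V (P.j.toLinearMap ∘ₗ P.pW) = _
    rw [LinearMap.trace_comp_comm', ← LinearMap.trace_id]
    congr 1
    ext u
    simp
  have he : LinearMap.trace ℝ V E = 1 := by
    rw [hE, LinearMap.trace_smulRight]
    exact P.inner_e_e
  have h3 := congrArg (LinearMap.trace ℝ V) h1
  have h4 := congrArg (LinearMap.trace ℝ V) h2
  simp only [map_add, map_sub, map_smul, hu, hw, he, htr, LinearMap.trace_id, smul_eq_mul] at h3 h4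
  constructor
  · have : (3 * Module.finrank ℝ U : ℝ) = Module.finrank ℝ V + 1 := by linarith
    exact_mod_cast this
  · exact_mod_cast h3

/-! ### Skew families on a space with cubic product -/

section Algebra

variable {V : Type*} [NormedAddCommGroup V] [InnerProductSpace ℝ V] [FiniteDimensional ℝ V]
  {μ : V →ₗ[ℝ] V →ₗ[ℝ] V}

theorem IsCubicProduct.exists_peirceDecomposition_finrank (hμ : IsCubicProduct μ)
    (hV : Module.finrank ℝ V = 5 ∨ Module.finrank ℝ V = 14) :
    ∃ U W : Submodule ℝ V, Nonempty (PeirceDecomposition μ U W) ∧ Nontrivial W ∧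
      (Module.finrank ℝ U = 2 ∨ Module.finrank ℝ U = 5) := by
  have : Nontrivial V := Module.nontrivial_of_finrank_pos (R := ℝ) (by omega)
  obtain ⟨e, he, hee⟩ := hμ.exists_idempotent
  obtain ⟨U, W, ⟨P⟩⟩ := hμ.exists_peirceDecomposition he hee
  obtain ⟨h1, h2⟩ := P.finrank_eq (hμ.trace _)
  exact ⟨U, W, ⟨P⟩, Module.nontrivial_of_finrank_pos (R := ℝ) (by omega), by omega⟩

theorem IsSkewDerivation.of_deform_eq_zero {F : Module.End ℝ V} (hF : IsSkewMap F)
    (h : deform μ F = 0) : IsSkewDerivation μ F where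
  skew := hF
  leibniz x y := by
    have := LinearMap.congr_fun₂ h x y
    rw [deform_apply] at this
    exact (sub_eq_zero.1 this).symm

/-- The algebraic form of the uniqueness of the characteristic connection: no nonzero 3-form acts
trivially on the product. -/
theorem IsCubicProduct.skew_eq_zero (hμ : IsCubicProduct μ)
    (hV : Module.finrank ℝ V = 5 ∨ Module.finrank ℝ V = 14) {T : V →ₗ[ℝ] Module.End ℝ V}
    (hT : ∀ v, IsSkewMap (T v)) (hT0 : ∀ v, T v v = 0) (h : ∀ v, deform μ (T v) = 0) : T = 0 := by
  obtain ⟨U, W, ⟨P⟩, hW, hU⟩ := hμ.exists_peirceDecomposition_finrank hV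
  exact P.derivation_eq_zero (by simpa using hU) (stdOrthonormalBasis ℝ U)
    (fun v ↦ .of_deform_eq_zero (hT v) (h v)) hT0

/-- The algebraic form of the existence of the characteristic connection: a family of tangent
products satisfying the nearly integrable condition is the infinitesimal action of a 3-form. -/
theorem IsCubicProduct.exists_skew (hμ : IsCubicProduct μ)
    (hV : Module.finrank ℝ V = 5 ∨ Module.finrank ℝ V = 14) {B : V →ₗ[ℝ] V →ₗ[ℝ] V →ₗ[ℝ] V}
    (hB : ∀ v, IsTangentProduct μ (B v)) (hB0 : ∀ v, inner ℝ (B v v v) v = 0) :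
    ∃ T : V →ₗ[ℝ] Module.End ℝ V, (∀ v, IsSkewMap (T v)) ∧ (∀ v, T v v = 0) ∧
      ∀ v, B v = deform μ (T v) := by
  obtain ⟨U, W, ⟨P⟩, hW, hU⟩ := hμ.exists_peirceDecomposition_finrank hV
  obtain ⟨F, hF, hBF⟩ : ∃ F : V →ₗ[ℝ] Module.End ℝ V, (∀ v, IsSkewMap (F v)) ∧
      ∀ v, B v = deform μ (F v) := by
    -- Choose `F` on a basis to make it linear.
    let b := Module.finBasis ℝ V
    choose f hf hbf using fun i ↦ P.exists_deform (stdOrthonormalBasis ℝ U) hμ (hB (b i))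
    refine ⟨b.constr ℝ f, fun v ↦ ?_, fun v ↦ ?_⟩
    · rw [b.constr_apply_fintype (S := ℝ)]
      refine Finset.sum_induction _ IsSkewMap (fun _ _ h h' ↦ h.add h') (fun x y ↦ by simp)
        fun i _ ↦ (hf i).smul _
    · refine LinearMap.congr_fun (g := (deform μ).comp (b.constr ℝ f : V →ₗ[ℝ] Module.End ℝ V))
        (b.ext fun i ↦ ?_) v
      rw [LinearMap.comp_apply, b.constr_basis, hbf]
  -- Subtract from `F` a family of derivations with the same symmetric part.
  have hβ : IsTangentField μ (symmPart F) :=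
    { comm := fun x y ↦ by rw [symmPart_apply, symmPart_apply, add_comm]
      inner_self := fun x ↦ by
        simp [symmPart_apply, inner_add_left, inner_smul_left, (hF x).inner_self]
      quartic := fun x ↦ by
        have h1 := hB0 x
        have h2 := hF x (μ x x) x
        rw [hBF, deform_apply, hμ.comm x (F x x), inner_sub_left, inner_add_left, hμ.assoc,
          h2] at h1
        have h3 := real_inner_comm (F x x) (μ x x)
        have h4 : inner ℝ (F x x) (μ x x) = 0 := by linarith
        simp [symmPart_apply, inner_add_left, inner_smul_left, h4] }
  obtain ⟨D, hD, h⟩ := P.exists_derivation (by simpa using hU) (stdOrthonormalBasis ℝ U) hμ hβ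
  refine ⟨F - D, fun v ↦ (hF v).sub (hD v).skew, fun v ↦ ?_, fun v ↦ ?_⟩
  · have h1 := LinearMap.congr_fun₂ h v v
    rw [symmPart_apply, symmPart_apply] at h1
    rw [LinearMap.sub_apply, LinearMap.sub_apply]
    linear_combination (norm := module) h1
  · have h1 : deform μ (D v) = 0 := by
      ext x y
      rw [deform_apply, (hD v).leibniz]
      simp
    rw [LinearMap.sub_apply, map_sub, h1, sub_zero, hBF]

end Algebra

/-! ### Smooth dependence of solutions of linear systems -/

section Solve

variable {E : Type*} [NormedAddCommGroup E] [NormedSpace ℝ E]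
  {H : Type*} [TopologicalSpace H] {I : ModelWithCorners ℝ E H}
  {M : Type*} [TopologicalSpace M] [ChartedSpace H M]
  {P Q : Type*} [NormedAddCommGroup P] [NormedSpace ℝ P] [FiniteDimensional ℝ P]
  [NormedAddCommGroup Q] [NormedSpace ℝ Q]

/-- A family of linear maps on a finite-dimensional space is smooth if it is smooth at each
vector. -/
theorem contMDiffAt_of_forall_clm_apply {L : M → P →L[ℝ] Q} {x₀ : M}
    (hL : ∀ p, CMDiffAt ∞ (fun x ↦ L x p) x₀) : CMDiffAt ∞ L x₀ := by
  let e₁ : P ≃L[ℝ] (Fin (Module.finrank ℝ P) → ℝ) :=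
    ContinuousLinearEquiv.ofFinrankEq (Module.finrank_fin_fun ℝ).symm
  let e₂ : (P →L[ℝ] Q) ≃L[ℝ] (Fin (Module.finrank ℝ P) → Q) :=
    (e₁.arrowCongr (1 : Q ≃L[ℝ] Q)).trans (ContinuousLinearEquiv.piRing (Fin _))
  rw [← Function.id_comp L, ← e₂.symm_comp_self, Function.comp_assoc]
  exact e₂.symm.contDiff.contMDiff.contMDiffAt.comp x₀ (contMDiffAt_pi_space.2 fun i ↦ hL _)

/-- A solution `t` of an overdetermined linear system `L x (t x) = b x` with smooth data is smooth
wherever `L x` is injective. -/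
theorem contMDiffAt_of_linearMap_apply_eq [FiniteDimensional ℝ Q] {L : M → P →ₗ[ℝ] Q} {b : M → Q}
    {t : M → P} {x₀ : M} (hL : ∀ p, CMDiffAt ∞ (fun x ↦ L x p) x₀) (hb : CMDiffAt ∞ b x₀)
    (hinj : ∀ p, L x₀ p = 0 → p = 0) (ht : ∀ᶠ x in nhds x₀, L x (t x) = b x) :
    CMDiffAt ∞ t x₀ := by
  have : CompleteSpace P := FiniteDimensional.complete ℝ P
  -- Compose with a fixed left inverse `K` of `L x₀`.
  obtain ⟨K, hK⟩ := LinearMap.exists_leftInverse_of_injective (L x₀) (LinearMap.ker_eq_bot'.2 hinj)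
  set K' : Q →L[ℝ] P := LinearMap.toContinuousLinearMap K
  set N : M → P →L[ℝ] P := fun x ↦ LinearMap.toContinuousLinearMap (K ∘ₗ L x) with hN
  have h1 : CMDiffAt ∞ N x₀ := contMDiffAt_of_forall_clm_apply fun p ↦
    (contMDiffAt_const (c := K')).clm_apply (hL p)
  have hu : IsUnit (N x₀) := by
    have : N x₀ = 1 := by
      ext p
      exact LinearMap.congr_fun hK p
    exact this ▸ isUnit_one
  have h2 : CMDiffAt ∞ (fun x ↦ Ring.inverse (N x)) x₀ := by
    obtain ⟨u, hu⟩ := hu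
    have h3 := contDiffAt_ringInverse ℝ (n := ∞) u
    rw [hu] at h3
    exact h3.contMDiffAt.comp x₀ h1
  have h3 : CMDiffAt ∞ (fun x ↦ Ring.inverse (N x) (K' (b x))) x₀ :=
    h2.clm_apply (contMDiffAt_const.clm_apply hb)
  refine h3.congr_of_eventuallyEq ?_
  have h4 : ∀ᶠ x in nhds x₀, IsUnit (N x) :=
    h1.continuousAt.eventually (Units.isOpen.mem_nhds hu)
  filter_upwards [ht, h4] with x hx hx'
  rw [← hx]
  exact (DFunLike.congr_fun (Ring.inverse_mul_cancel _ hx') (t x)).symm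

end Solve

/-! ### Smooth frames -/

section Frames

variable {E : Type*} [NormedAddCommGroup E] [NormedSpace ℝ E] [FiniteDimensional ℝ E]
  {H : Type*} [TopologicalSpace H] {I : ModelWithCorners ℝ E H}
  {M : Type*} [TopologicalSpace M] [T2Space M] [ChartedSpace H M] [IsManifold I ∞ M]

/-- Near every point, there are global smooth vector fields forming a local frame, with smooth
coefficient functions. -/
theorem exists_frame (x₀ : M) :
    ∃ (X : Fin (Module.finrank ℝ E) → Π x : M, TangentSpace I x)
      (c : Fin (Module.finrank ℝ E) → Π x : M, TangentSpace I x →ₗ[ℝ] ℝ),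
      (∀ a, CMDiff ∞ (T% (X a))) ∧ LinearIndependent ℝ (fun a ↦ X a x₀) ∧
      (∀ᶠ x in nhds x₀, ∀ v : TangentSpace I x, v = ∑ a, c a x v • X a x) ∧
      (∀ Y : Π x : M, TangentSpace I x, CMDiffAt ∞ (T% Y) x₀ →
        ∀ a, CMDiffAt ∞ (fun x ↦ c a x (Y x)) x₀) ∧
      ∀ Y : Π x : M, TangentSpace I x, MDiffAt (T% Y) x₀ →
        ∀ a, MDiffAt (fun x ↦ c a x (Y x)) x₀ := by
  have : IsManifold I 1 M := .of_le (n := ∞) (by simp)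
  set e := trivializationAt E (TangentSpace I : M → Type _) x₀ with he
  set b := Module.finBasis ℝ E
  obtain ⟨f⟩ : Nonempty (SmoothBumpFunction I x₀) := inferInstance
  have hx₀ : x₀ ∈ e.baseSet := FiberBundle.mem_baseSet_trivializationAt' x₀
  have hframe : ∀ a, CMDiff[e.baseSet] ∞ (T% (e.localFrame b a)) := fun a ↦
    e.contMDiffOn_localFrame_baseSet ∞ b a
  refine ⟨fun a x ↦ f x • e.localFrame b a x, fun a ↦ e.localFrameCoeff I b a, fun a ↦ ?_, ?_, ?_,
    fun Y hY a ↦ contMDiffAt_localFrameCoeff b hx₀ hY a,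
    fun Y hY a ↦ mdifferentiableAt_localFrameCoeff b hx₀ hY a⟩
  · refine ContMDiffOn.smul_section_of_tsupport (u := e.baseSet) f.contMDiff.contMDiffOn
      e.open_baseSet ?_ (hframe a)
    exact f.tsupport_subset_chartAt_source
  · simp only [f.eq_one, one_smul]
    exact (e.isLocalFrameOn_localFrame_baseSet I ∞ b).linearIndependent hx₀
  · filter_upwards [f.eventuallyEq_one, e.open_baseSet.mem_nhds hx₀] with x hx hx' v
    simp only [hx, Pi.one_apply, one_smul]
    have := e.eq_sum_localFrameCoeff_smul (I := I) (b := b) (s := extend E v) hx'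
    simpa using this

/-- A field of endomorphisms of the tangent bundle is smooth if it maps smooth vector fields to
smooth vector fields. -/
theorem contMDiff_hom_of_forall_apply {φ : Π x : M, TangentSpace I x →L[ℝ] TangentSpace I x}
    (hφ : ∀ X : Π x : M, TangentSpace I x, CMDiff ∞ (T% X) → CMDiff ∞ (T% (fun x ↦ φ x (X x)))) :
    ContMDiff I (I.prod 𝓘(ℝ, E →L[ℝ] E)) ∞ (fun x ↦ TotalSpace.mk' (E →L[ℝ] E)
      (E := fun x : M ↦ TangentSpace I x →L[ℝ] TangentSpace I x) x (φ x)) := by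
  have : IsManifold I 1 M := .of_le (n := ∞) (by simp)
  intro x₀
  rw [contMDiffAt_hom_bundle]
  refine ⟨contMDiffAt_id, contMDiffAt_of_forall_clm_apply fun p ↦ ?_⟩
  set e := trivializationAt E (TangentSpace I : M → Type _) x₀ with he
  obtain ⟨f⟩ : Nonempty (SmoothBumpFunction I x₀) := inferInstance
  have hx₀ : x₀ ∈ e.baseSet := FiberBundle.mem_baseSet_trivializationAt' x₀
  have hs : CMDiff[e.baseSet] ∞ (T% (fun x : M ↦ e.symmL ℝ x p)) := by
    rw [e.contMDiffOn_section_baseSet_iff]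
    refine (contMDiffOn_const (c := p)).congr fun y hy ↦ ?_
    simp [hy]
  have hX : CMDiff ∞ (T% (fun x : M ↦ f x • e.symmL ℝ x p)) :=
    ContMDiffOn.smul_section_of_tsupport (u := e.baseSet) f.contMDiff.contMDiffOn
      e.open_baseSet f.tsupport_subset_chartAt_source hs
  have h1 := (hφ _ hX) x₀
  rw [contMDiffAt_totalSpace] at h1
  refine h1.2.congr_of_eventuallyEq ?_
  filter_upwards [f.eventuallyEq_one, e.open_baseSet.mem_nhds hx₀] with x hx hx'
  simp only [ContinuousLinearMap.inCoordinates, ContinuousLinearMap.comp_apply, hx, Pi.one_apply,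
    one_smul]
  rw [Trivialization.continuousLinearMapAt_apply, Trivialization.linearMapAt_apply, if_pos hx']

end Frames

/-! ### Smoothness of the Levi-Civita connection -/

section LeviCivita

variable {E : Type*} [NormedAddCommGroup E] [NormedSpace ℝ E] [FiniteDimensional ℝ E]
  {H : Type*} [TopologicalSpace H] {I : ModelWithCorners ℝ E H}
  {M : Type*} [TopologicalSpace M] [T2Space M] [ChartedSpace H M] [IsManifold I ∞ M]

theorem contMDiff_mvfderiv_apply {f : M → ℝ} (hf : CMDiff ∞ f) {X : Π x : M, TangentSpace I x}
    (hX : CMDiff ∞ (T% X)) : CMDiff ∞ (fun x ↦ mvfderiv I f x (X x)) := by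
  have : IsManifold I 1 M := .of_le (n := ∞) (by simp)
  exact (contMDiff_snd_tangentBundle_modelSpace ℝ 𝓘(ℝ, ℝ)).comp
    ((hf.contMDiff_tangentMap (m := ∞) le_rfl).comp hX)

variable [RiemannianBundle (fun x : M ↦ TangentSpace I x)]
  [IsContMDiffRiemannianBundle I ∞ E (fun x : M ↦ TangentSpace I x)]

theorem contMDiff_inner {X Y : Π x : M, TangentSpace I x} (hX : CMDiff ∞ (T% X))
    (hY : CMDiff ∞ (T% Y)) : CMDiff ∞ (fun x ↦ inner ℝ (X x) (Y x)) :=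
  ContMDiff.inner_bundle (F := E) (E := fun x : M ↦ TangentSpace I x) (b := id) hX hY

/-- A vector field is smooth if its inner products with smooth vector fields are. -/
theorem contMDiff_of_forall_inner {A : Π x : M, TangentSpace I x}
    (hA : ∀ Z : Π x : M, TangentSpace I x, CMDiff ∞ (T% Z) →
      CMDiff ∞ (fun x ↦ inner ℝ (A x) (Z x))) : CMDiff ∞ (T% A) := by
  intro x₀
  obtain ⟨X, c, hX, hli, hc, -, -⟩ := exists_frame (I := I) x₀
  let L : M → (Fin (Module.finrank ℝ E) → ℝ) →ₗ[ℝ] (Fin (Module.finrank ℝ E) → ℝ) := fun x ↦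
    LinearMap.pi fun b ↦ ∑ a, (inner ℝ (X a x) (X b x) : ℝ) • LinearMap.proj a
  have hL : ∀ x p b, L x p b = ∑ a, inner ℝ (X a x) (X b x) * p a := fun x p b ↦ by
    simp [L]
  have ht : ContMDiffAt I 𝓘(ℝ, Fin (Module.finrank ℝ E) → ℝ) ∞ (fun x a ↦ c a x (A x)) x₀ := by
    refine contMDiffAt_of_linearMap_apply_eq (L := L) (b := fun x b ↦ inner ℝ (A x) (X b x))
      (fun p ↦ ?_) ?_ (fun p hp ↦ ?_) ?_
    · refine contMDiffAt_pi_space.2 fun b ↦ ?_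
      simp only [hL]
      exact contMDiffAt_finsetSum fun a _ ↦
        ((contMDiff_inner (hX a) (hX b)) x₀).mul contMDiffAt_const
    · exact contMDiffAt_pi_space.2 fun b ↦ (hA _ (hX b)) x₀
    · have h1 : ∀ b, inner ℝ (∑ a, p a • X a x₀) (X b x₀) = 0 := fun b ↦ by
        refine Eq.trans ?_ ((hL x₀ p b).symm.trans (congrFun hp b))
        rw [sum_inner]
        exact Finset.sum_congr rfl fun a _ ↦ by rw [inner_smul_left, conj_trivial, mul_comm]
      have h2 : inner ℝ (∑ a, p a • X a x₀) (∑ b, p b • X b x₀) = 0 := by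
        rw [inner_sum]
        exact Finset.sum_eq_zero fun b _ ↦ by rw [inner_smul_right, h1, mul_zero]
      rw [inner_self_eq_zero] at h2
      exact funext (Fintype.linearIndependent_iff.1 hli p h2)
    · filter_upwards [hc] with x hx
      ext b
      rw [hL]
      conv_rhs => rw [hx (A x)]
      rw [sum_inner]
      exact Finset.sum_congr rfl fun a _ ↦ by rw [inner_smul_left, conj_trivial, mul_comm]
  have h1 : CMDiffAt ∞ (T% (fun x ↦ ∑ a, c a x (A x) • X a x)) x₀ :=
    ContMDiffAt.sum_section fun a _ ↦ ((contMDiffAt_pi_space.1 ht a).smul_section (hX a x₀))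
  refine h1.congr_of_eventuallyEq ?_
  filter_upwards [hc] with x hx
  exact congrArg (TotalSpace.mk' E x) (hx (A x))

theorem contMDiff_mlieBracket {X Y : Π x : M, TangentSpace I x} (hX : CMDiff ∞ (T% X))
    (hY : CMDiff ∞ (T% Y)) : CMDiff ∞ (T% (mlieBracket I X Y)) := by
  have : IsManifold I (minSmoothness ℝ 2) M :=
    .of_le (n := ∞) (by simpa using ENat.LEInfty.out)
  have : IsManifold I (minSmoothness ℝ 3) M :=
    .of_le (n := ∞) (by simpa using ENat.LEInfty.out)
  have : IsManifold I ((⊤ : ℕ∞) + 1) M := inferInstanceAs (IsManifold I ∞ M)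
  exact fun x ↦ (hX x).mlieBracket_vectorField (n := ⊤) (m := ⊤) (hY x) (by simp)

theorem contMDiff_koszulForm {X Y Z : Π x : M, TangentSpace I x} (hX : CMDiff ∞ (T% X))
    (hY : CMDiff ∞ (T% Y)) (hZ : CMDiff ∞ (T% Z)) : CMDiff ∞ (fun x ↦ koszulForm X Y Z x) := by
  have h1 := contMDiff_mvfderiv_apply (contMDiff_inner hY hZ) hX
  have h2 := contMDiff_mvfderiv_apply (contMDiff_inner hX hZ) hY
  have h3 := contMDiff_mvfderiv_apply (contMDiff_inner hX hY) hZ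
  have h4 := contMDiff_inner (contMDiff_mlieBracket hX hY) hZ
  have h5 := contMDiff_inner (contMDiff_mlieBracket hX hZ) hY
  have h6 := contMDiff_inner (contMDiff_mlieBracket hY hZ) hX
  exact (((((h1.add h2).sub h3).add h4).sub h5).sub h6).div_const 2

theorem contMDiff_leviCivita_apply {X Y : Π x : M, TangentSpace I x} (hX : CMDiff ∞ (T% X))
    (hY : CMDiff ∞ (T% Y)) : CMDiff ∞ (T% (fun x ↦ leviCivita Y x (X x))) := by
  refine contMDiff_of_forall_inner fun Z hZ ↦ ?_
  have h : ∀ {X : Π x : M, TangentSpace I x}, CMDiff ∞ (T% X) → ∀ x, MDiffAt (T% X) x :=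
    fun hX x ↦ (hX x).mdifferentiableAt (by simp)
  simpa only [inner_leviCivita (h hX _) (h hY _) (h hZ _)] using contMDiff_koszulForm hX hY hZ

end LeviCivita

/-! ### The product on the tangent spaces -/

section Pointwise

variable {V : Type*} [NormedAddCommGroup V] [InnerProductSpace ℝ V] [FiniteDimensional ℝ V]
  {μ : V →ₗ[ℝ] V →ₗ[ℝ] V} {n : ℕ}

/-- The polarization of `|x ∘ x|² = |x|⁴` is `(x ∘ x) ∘ x = |x|² x`. -/
theorem cube_of_inner_sq (comm : ∀ x y, μ x y = μ y x)
    (assoc : ∀ x y z, inner ℝ (μ x y) z = inner ℝ x (μ y z))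
    (h : ∀ x, inner ℝ (μ x x) (μ x x) = inner ℝ x x ^ 2) (x : V) :
    μ (μ x x) x = inner ℝ x x • x := by
  refine ext_inner_right ℝ fun y ↦ ?_
  have h1 := h (x + y)
  have h2 := h (x - y)
  have h3 := h (x + (2 : ℝ) • y)
  have h4 := h (x - (2 : ℝ) • y)
  have e1 := real_inner_comm x y
  have e2 := real_inner_comm (μ x y) (μ x x)
  have e3 := real_inner_comm (μ x y) (μ y y)
  have e4 := real_inner_comm (μ y y) (μ x x)
  simp only [map_add, map_sub, map_smul, LinearMap.add_apply, LinearMap.sub_apply,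
    LinearMap.smul_apply, inner_add_left, inner_add_right, inner_sub_left, inner_sub_right,
    inner_smul_left, inner_smul_right, conj_trivial, comm y x, e1, e2, e3, e4] at h1 h2 h3 h4
  rw [assoc, inner_smul_left, conj_trivial]
  linarith

/-- An identity holding for the members of all orthonormal bases holds for all unit vectors, hence
by homogeneity for all vectors. -/
theorem inner_sq_of_orthonormalBasis (hn : Module.finrank ℝ V = n)
    (h : ∀ (e : OrthonormalBasis (Fin n) ℝ V) (j),
      ∑ i, inner ℝ (μ (e j) (e j)) (e i) * inner ℝ (μ (e j) (e j)) (e i) = 1) (x : V) :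
    inner ℝ (μ x x) (μ x x) = inner ℝ x x ^ 2 := by
  rcases eq_or_ne x 0 with rfl | hx
  · simp
  have hn0 : 0 < n := hn ▸ Module.finrank_pos_iff_exists_ne_zero.2 ⟨x, hx⟩
  have hx' : ‖x‖ ≠ 0 := norm_ne_zero_iff.2 hx
  set u : V := ‖x‖⁻¹ • x with hu
  have hxu : x = ‖x‖ • u := by rw [hu, smul_inv_smul₀ hx']
  obtain ⟨e, he⟩ := Orthonormal.exists_orthonormalBasis_extension_of_card_eq (𝕜 := ℝ)
    (ι := Fin n) (by simpa using hn) (v := fun _ ↦ u) (s := {⟨0, hn0⟩}) (by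
      refine ⟨fun i ↦ ?_, fun i j hij ↦ (hij (Subsingleton.elim i j)).elim⟩
      simp [hu, norm_smul, hx'])
  have h1 := h e ⟨0, hn0⟩
  rw [he ⟨0, hn0⟩ rfl] at h1
  have h2 : inner ℝ (μ u u) (μ u u) = (1 : ℝ) := by
    rw [← e.sum_inner_mul_inner, ← h1]
    exact Finset.sum_congr rfl fun i _ ↦ by rw [real_inner_comm (μ u u) (e i)]
  rw [real_inner_self_eq_norm_sq x]
  conv_lhs => rw [hxu]
  simp only [map_smul, LinearMap.smul_apply, inner_smul_left, inner_smul_right, conj_trivial, h2]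
  ring

theorem trace_eq_zero_of_orthonormalBasis (hn : Module.finrank ℝ V = n)
    (h : ∀ (e : OrthonormalBasis (Fin n) ℝ V) (i),
      ∑ j, inner ℝ (μ (e i) (e j)) (e j) = (0 : ℝ)) (x : V) : LinearMap.trace ℝ V (μ x) = 0 := by
  let e : OrthonormalBasis (Fin n) ℝ V :=
    (stdOrthonormalBasis ℝ V).reindex (finCongr hn)
  have : LinearMap.trace ℝ V ∘ₗ μ = 0 := by
    refine e.toBasis.ext fun i ↦ ?_
    rw [LinearMap.comp_apply, OrthonormalBasis.coe_toBasis, LinearMap.trace_eq_sum_inner _ e,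
      LinearMap.zero_apply, ← h e i]
    exact Finset.sum_congr rfl fun j _ ↦ real_inner_comm _ _
  exact LinearMap.congr_fun this x

end Pointwise

section TangentProduct

variable {E : Type*} [NormedAddCommGroup E] [NormedSpace ℝ E] [FiniteDimensional ℝ E]
  {H : Type*} [TopologicalSpace H] {I : ModelWithCorners ℝ E H}
  {M : Type*} [TopologicalSpace M] [ChartedSpace H M]

instance finiteDimensional_tangentSpace (x : M) : FiniteDimensional ℝ (TangentSpace I x) :=
  inferInstanceAs (FiniteDimensional ℝ E)

theorem finrank_tangentSpace (x : M) :
    Module.finrank ℝ (TangentSpace I x) = Module.finrank ℝ E := rfl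

variable [IsManifold I ∞ M] [RiemannianBundle (fun x : M ↦ TangentSpace I x)]
  [IsContMDiffRiemannianBundle I ∞ E (fun x : M ↦ TangentSpace I x)]

/-- The product on `T_x M` obtained by raising the last index of a trilinear form. -/
noncomputable def TrilinearField.mul (S : TrilinearField I M) (x : M) :
    TangentSpace I x →ₗ[ℝ] TangentSpace I x →ₗ[ℝ] TangentSpace I x :=
  LinearMap.mk₂ ℝ (fun u v ↦ tangentSharp x (S x u) v)
    (fun u u' v ↦ ext_inner_right ℝ fun w ↦ by
      simp only [inner_tangentSharp, inner_add_left, ContinuousLinearMap.map_add, add_apply])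
    (fun c u v ↦ ext_inner_right ℝ fun w ↦ by
      simp only [inner_tangentSharp, inner_smul_left, conj_trivial, ContinuousLinearMap.map_smul,
        smul_apply, smul_eq_mul])
    (fun u v v' ↦ map_add _ v v') (fun c u v ↦ map_smul _ c v)

theorem TrilinearField.inner_mul (S : TrilinearField I M) (x : M) (u v w : TangentSpace I x) :
    inner ℝ (S.mul x u v) w = S x u v w :=
  inner_tangentSharp x (S x u) v w

theorem IsHkStructure.isCubicProduct {Υ : TrilinearField I M} (hΥ : IsHkStructure Υ) (x : M) :
    IsCubicProduct (Υ.mul x) := by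
  have comm : ∀ u v, Υ.mul x u v = Υ.mul x v u := fun u v ↦ ext_inner_right ℝ fun w ↦ by
    rw [Υ.inner_mul, Υ.inner_mul, hΥ.symm_left]
  have assoc : ∀ u v w, inner ℝ (Υ.mul x u v) w = inner ℝ u (Υ.mul x v w) := fun u v w ↦ by
    rw [← real_inner_comm u, Υ.inner_mul, Υ.inner_mul, hΥ.symm_left, hΥ.symm_right]
  refine ⟨comm, assoc, cube_of_inner_sq comm assoc
    (inner_sq_of_orthonormalBasis (finrank_tangentSpace x) fun e j ↦ ?_),
    trace_eq_zero_of_orthonormalBasis (finrank_tangentSpace x) fun e i ↦ ?_⟩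
  · have h := hΥ.quadratic x e j j j j
    have h1 : inner ℝ (e j) (e j) = (1 : ℝ) := by simp
    simp only [Υ.inner_mul]
    rw [h1, Finset.sum_add_distrib, Finset.sum_add_distrib] at h
    linarith
  · simpa only [Υ.inner_mul] using hΥ.trace_free x e i

end TangentProduct

/-! ### Tensoriality of the covariant derivative of a tensor field -/

section Tensoriality

variable {E : Type*} [NormedAddCommGroup E] [NormedSpace ℝ E] [FiniteDimensional ℝ E]
  {H : Type*} [TopologicalSpace H] {I : ModelWithCorners ℝ E H}
  {M : Type*} [TopologicalSpace M] [T2Space M] [ChartedSpace H M] [IsManifold I ∞ M]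

theorem exists_smooth_extension (x : M) (v : TangentSpace I x) :
    ∃ V : Π x : M, TangentSpace I x, CMDiff ∞ (T% V) ∧ V x = v := by
  obtain ⟨X, c, hX, -, hc, -, -⟩ := exists_frame (I := I) x
  refine ⟨fun y ↦ ∑ a, c a x v • X a y, ContMDiff.sum_section fun a _ ↦ ?_, ?_⟩
  · exact contMDiff_const.smul_section (hX a)
  · exact (hc.self_of_nhds v).symm

/-- A field of linear forms which is smooth on smooth vector fields is differentiable on vector
fields which are merely differentiable at a point. -/
theorem mdifferentiableAt_apply_of_smooth {Φ : Π x : M, TangentSpace I x →ₗ[ℝ] ℝ} {x : M}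
    (hΦ : ∀ X : Π x : M, TangentSpace I x, CMDiff ∞ (T% X) → MDiffAt (fun y ↦ Φ y (X y)) x)
    {X : Π x : M, TangentSpace I x} (hX : MDiffAt (T% X) x) : MDiffAt (fun y ↦ Φ y (X y)) x := by
  obtain ⟨Y, c, hY, -, hc, -, hcY⟩ := exists_frame (I := I) x
  have h1 : MDiffAt (∑ a, fun y ↦ c a y (X y) * Φ y (Y a y)) x :=
    MDifferentiableAt.sum fun a _ ↦ (hcY X hX a).mul (hΦ _ (hY a))
  refine h1.congr_of_eventuallyEq ?_
  filter_upwards [hc] with y hy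
  conv_lhs => rw [hy (X y)]
  simp

theorem TrilinearField.IsSmooth.mdifferentiableAt {S : TrilinearField I M} (hS : S.IsSmooth)
    {X Y Z : Π x : M, TangentSpace I x} {x : M} (hX : MDiffAt (T% X) x) (hY : MDiffAt (T% Y) x)
    (hZ : MDiffAt (T% Z) x) : MDiffAt (fun y ↦ S y (X y) (Y y) (Z y)) x := by
  refine mdifferentiableAt_apply_of_smooth (Φ := fun y ↦ (S y (X y) (Y y)).toLinearMap)
    (fun Z hZ ↦ ?_) hZ
  refine mdifferentiableAt_apply_of_smooth
    (Φ := fun y ↦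
    { toFun u := S y (X y) u (Z y)
      map_add' u u' := by simp only [ContinuousLinearMap.map_add, add_apply]
      map_smul' a u := by simp only [ContinuousLinearMap.map_smul, smul_apply, RingHom.id_apply] })
    (fun Y hY ↦ ?_) hY
  refine mdifferentiableAt_apply_of_smooth
    (Φ := fun y ↦
    { toFun u := S y u (Y y) (Z y)
      map_add' u u' := by simp only [ContinuousLinearMap.map_add, add_apply]
      map_smul' a u := by simp only [ContinuousLinearMap.map_smul, smul_apply, RingHom.id_apply] })
    (fun X hX ↦ ?_) hX
  exact (hS X Y Z hX hY hZ x).mdifferentiableAt (by simp)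

variable [RiemannianBundle (fun x : M ↦ TangentSpace I x)]
  [IsContMDiffRiemannianBundle I ∞ E (fun x : M ↦ TangentSpace I x)]
  {D : CovariantDerivative I E (fun x : M ↦ TangentSpace I x)} {S : TrilinearField I M}

theorem TrilinearField.covDeriv_comm_left (hS : ∀ x u v w, S x u v w = S x v u w)
    (X Y Z : Π x : M, TangentSpace I x) (x : M) (v : TangentSpace I x) :
    S.covDeriv D X Y Z x v = S.covDeriv D Y X Z x v := by
  have h : (fun p ↦ S p (X p) (Y p) (Z p)) = fun p ↦ S p (Y p) (X p) (Z p) :=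
    funext fun p ↦ hS _ _ _ _
  rw [covDeriv, covDeriv, h, hS x (D X x v), hS x (X x) (D Y x v), hS x (X x) (Y x)]
  ring

theorem TrilinearField.covDeriv_comm_right (hS : ∀ x u v w, S x u v w = S x u w v)
    (X Y Z : Π x : M, TangentSpace I x) (x : M) (v : TangentSpace I x) :
    S.covDeriv D X Y Z x v = S.covDeriv D X Z Y x v := by
  have h : (fun p ↦ S p (X p) (Y p) (Z p)) = fun p ↦ S p (X p) (Z p) (Y p) :=
    funext fun p ↦ hS _ _ _ _
  rw [covDeriv, covDeriv, h, hS x (D X x v), hS x (X x) (D Y x v), hS x (X x) (Y x)]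
  ring

theorem TrilinearField.IsSmooth.tensorialAt_covDeriv (hS : S.IsSmooth)
    {Y Z : Π x : M, TangentSpace I x} {x : M} (hY : MDiffAt (T% Y) x) (hZ : MDiffAt (T% Z) x)
    (v : TangentSpace I x) : TensorialAt I E (fun X ↦ S.covDeriv D X Y Z x v) x where
  smul {f X} hf hX := by
    have h1 := mvfderiv_fun_mul hf (hS.mdifferentiableAt hX hY hZ)
    have h2 := D.isCovariantDerivativeOnUniv.leibniz hX hf
    simp only [covDeriv, Pi.smul_apply', ContinuousLinearMap.map_smul, smul_apply, smul_eq_mul, h1, h2,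
      ContinuousLinearMap.map_add,
      add_apply, ContinuousLinearMap.smulRight_apply]
    ring
  add {X X'} hX hX' := by
    have h1 := mvfderiv_fun_add (hS.mdifferentiableAt hX hY hZ) (hS.mdifferentiableAt hX' hY hZ)
    have h2 := D.isCovariantDerivativeOnUniv.add hX hX'
    simp only [covDeriv, Pi.add_apply, ContinuousLinearMap.map_add, add_apply, h1, h2]
    ring

end Tensoriality

/-! ### The covariant derivative of the structure tensor -/

/-- A quadrilinear form on a Euclidean space is represented by a trilinear map. -/
theorem exists_linearMap_of_inner {V : Type*} [NormedAddCommGroup V] [InnerProductSpace ℝ V]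
    [FiniteDimensional ℝ V] {t : V → V → V → V → ℝ} (h₁ : ∀ u w z, IsLinearMap ℝ (t · u w z))
    (h₂ : ∀ v w z, IsLinearMap ℝ (t v · w z)) (h₃ : ∀ v u z, IsLinearMap ℝ (t v u · z))
    (h₄ : ∀ v u w, IsLinearMap ℝ (t v u w)) :
    ∃ B : V →ₗ[ℝ] V →ₗ[ℝ] V →ₗ[ℝ] V, ∀ v u w z, inner ℝ (B v u w) z = t v u w z := by
  have : CompleteSpace V := FiniteDimensional.complete ℝ V
  let b : V → V → V → V := fun v u w ↦ (InnerProductSpace.toDual ℝ V).symm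
    (LinearMap.toContinuousLinearMap ((h₄ v u w).mk' _))
  have hb : ∀ v u w z, inner ℝ (b v u w) z = t v u w z := fun v u w z ↦
    InnerProductSpace.toDual_symm_apply
  refine ⟨LinearMap.mk₂ ℝ (fun v u ↦
    { toFun w := b v u w
      map_add' w w' := ext_inner_right ℝ fun z ↦ by
        simp only [inner_add_left, hb, (h₃ _ _ _).map_add]
      map_smul' c w := ext_inner_right ℝ fun z ↦ by
        simp only [inner_smul_left, conj_trivial, hb, (h₃ _ _ _).map_smul, smul_eq_mul,
          RingHom.id_apply] })
    ?_ ?_ ?_ ?_, fun v u w z ↦ hb v u w z⟩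
  · exact fun v v' u ↦ LinearMap.ext fun w ↦ ext_inner_right ℝ fun z ↦ by
      simp [inner_add_left, hb, (h₁ _ _ _).map_add]
  · exact fun c v u ↦ LinearMap.ext fun w ↦ ext_inner_right ℝ fun z ↦ by
      simp [inner_smul_left, hb, (h₁ _ _ _).map_smul]
  · exact fun v u u' ↦ LinearMap.ext fun w ↦ ext_inner_right ℝ fun z ↦ by
      simp [inner_add_left, hb, (h₂ _ _ _).map_add]
  · exact fun c v u ↦ LinearMap.ext fun w ↦ ext_inner_right ℝ fun z ↦ by
      simp [inner_smul_left, hb, (h₂ _ _ _).map_smul]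

section Structure

variable {E : Type*} [NormedAddCommGroup E] [NormedSpace ℝ E] [FiniteDimensional ℝ E]
  {H : Type*} [TopologicalSpace H] {I : ModelWithCorners ℝ E H}
  {M : Type*} [TopologicalSpace M] [T2Space M] [ChartedSpace H M] [IsManifold I ∞ M]
  [RiemannianBundle (fun x : M ↦ TangentSpace I x)]
  [IsContMDiffRiemannianBundle I ∞ E (fun x : M ↦ TangentSpace I x)]
  {Υ : TrilinearField I M}

namespace IsHkStructure

/-- `(∇_v Υ)(X, Y, Z)` depends on `X`, `Y`, `Z` only through their values at the point. -/
theorem covDeriv_congr (hΥ : IsHkStructure Υ)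
    (D : CovariantDerivative I E (fun x : M ↦ TangentSpace I x))
    {X X' Y Y' Z Z' : Π x : M, TangentSpace I x} {x : M}
    (hX : MDiffAt (T% X) x) (hX' : MDiffAt (T% X') x) (hXX' : X x = X' x)
    (hY : MDiffAt (T% Y) x) (hY' : MDiffAt (T% Y') x) (hYY' : Y x = Y' x)
    (hZ : MDiffAt (T% Z) x) (hZ' : MDiffAt (T% Z') x) (hZZ' : Z x = Z' x)
    (v : TangentSpace I x) : Υ.covDeriv D X Y Z x v = Υ.covDeriv D X' Y' Z' x v := by
  have h1 := (hΥ.smooth.tensorialAt_covDeriv (D := D) hY hZ v).pointwise hX hX' hXX'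
  have h2 := (hΥ.smooth.tensorialAt_covDeriv (D := D) hX' hZ v).pointwise hY hY' hYY'
  have h3 := (hΥ.smooth.tensorialAt_covDeriv (D := D) hX' hY' v).pointwise hZ hZ' hZZ'
  rw [h1, Υ.covDeriv_comm_left hΥ.symm_left, h2, Υ.covDeriv_comm_left hΥ.symm_left,
    Υ.covDeriv_comm_right hΥ.symm_right, Υ.covDeriv_comm_left hΥ.symm_left, h3,
    Υ.covDeriv_comm_left hΥ.symm_left, Υ.covDeriv_comm_right hΥ.symm_right]

/-- The covariant derivative of `Υ` at a point, as a family of products on the tangent space. -/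
theorem exists_covDeriv_product (hΥ : IsHkStructure Υ)
    (D : CovariantDerivative I E (fun x : M ↦ TangentSpace I x)) (x : M) :
    ∃ B : TangentSpace I x →ₗ[ℝ] TangentSpace I x →ₗ[ℝ] TangentSpace I x →ₗ[ℝ] TangentSpace I x,
      ∀ X Y Z : Π x : M, TangentSpace I x, MDiffAt (T% X) x → MDiffAt (T% Y) x →
        MDiffAt (T% Z) x → ∀ v, inner ℝ (B v (X x) (Y x)) (Z x) = Υ.covDeriv D X Y Z x v := by
  have he : ∀ u : TangentSpace I x, MDiffAt (T% (extend E u)) x := mdifferentiableAt_extend I E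
  let t : TangentSpace I x → TangentSpace I x → TangentSpace I x → TangentSpace I x → ℝ :=
    fun v u w z ↦ Υ.covDeriv D (extend E u) (extend E w) (extend E z) x v
  have h₂ : ∀ v w z, IsLinearMap ℝ (fun u ↦ t v u w z) := by
    intro v w z
    have h := hΥ.smooth.tensorialAt_covDeriv (D := D) (he w) (he z) v
    let φ := TensorialAt.mkHom _ x h
    have h' : ∀ u, t v u w z = φ u := fun u ↦
      (TensorialAt.mkHom_apply_eq_extend h u).symm
    refine ⟨fun u u' ↦ ?_, fun c u ↦ ?_⟩
    · exact (h' _).trans ((φ.map_add u u').trans (congrArg₂ _ (h' u) (h' u').symm))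
    · exact (h' _).trans ((φ.map_smul c u).trans (congrArg _ (h' u).symm))
  have h₃ : ∀ v u z, IsLinearMap ℝ (fun w ↦ t v u w z) := by
    intro v u z
    simpa only [t, Υ.covDeriv_comm_left hΥ.symm_left (extend E u)] using h₂ v u z
  have h₄ : ∀ v u w, IsLinearMap ℝ (fun z ↦ t v u w z) := by
    intro v u w
    simpa only [t, Υ.covDeriv_comm_right hΥ.symm_right (extend E u) (extend E w)] using h₃ v u w
  have h₁ : ∀ u w z, IsLinearMap ℝ (fun v ↦ t v u w z) := by
    refine fun u w z ↦ ⟨fun v v' ↦ ?_, fun c v ↦ ?_⟩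
    · simp only [t, TrilinearField.covDeriv, ContinuousLinearMap.map_add, add_apply]
      ring
    · simp only [t, TrilinearField.covDeriv, ContinuousLinearMap.map_smul, smul_apply, smul_eq_mul]
      ring
  obtain ⟨B, hB⟩ := exists_linearMap_of_inner h₁ h₂ h₃ h₄
  refine ⟨B, fun X Y Z hX hY hZ v ↦ ?_⟩
  rw [hB]
  exact hΥ.covDeriv_congr D (he _) hX (extend_apply_self ..) (he _) hY (extend_apply_self ..)
    (he _) hZ (extend_apply_self ..) v

theorem contMDiff_mul (hΥ : IsHkStructure Υ) {X Y : Π x : M, TangentSpace I x}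
    (hX : CMDiff ∞ (T% X)) (hY : CMDiff ∞ (T% Y)) :
    CMDiff ∞ (T% (fun x ↦ Υ.mul x (X x) (Y x))) :=
  contMDiff_of_forall_inner fun Z hZ ↦ by
    simpa only [Υ.inner_mul] using hΥ.smooth X Y Z hX hY hZ

theorem inner_mul_self (hΥ : IsHkStructure Υ) (x : M) (u : TangentSpace I x) :
    inner ℝ (Υ.mul x u u) (Υ.mul x u u) = inner ℝ u u * inner ℝ u u := by
  rw [(hΥ.isCubicProduct x).assoc, (hΥ.isCubicProduct x).comm, (hΥ.isCubicProduct x).cube,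
    inner_smul_right]

/-- Differentiating `|X ∘ X|² = |X|⁴` shows that `∇_v Υ` is tangent to the space of products
satisfying this identity. -/
theorem covDeriv_mul_self (hΥ : IsHkStructure Υ) {X : Π x : M, TangentSpace I x}
    (hX : CMDiff ∞ (T% X)) (x : M) (v : TangentSpace I x) :
    Υ.covDeriv leviCivita X X (fun y ↦ Υ.mul y (X y) (X y)) x v = 0 := by
  set Z : Π x : M, TangentSpace I x := fun y ↦ Υ.mul y (X y) (X y) with hZ
  have hX' : MDiffAt (T% X) x := (hX x).mdifferentiableAt (by simp)
  have hZ' : MDiffAt (T% Z) x := (hΥ.contMDiff_mul hX hX x).mdifferentiableAt (by simp)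
  have he : MDiffAt (T% (extend E v)) x := mdifferentiableAt_extend I E v
  have h1 := leviCivita_metric he hX' hX'
  have h2 := leviCivita_metric he hZ' hZ'
  rw [extend_apply_self] at h1 h2
  have h3 : (fun p ↦ Υ p (X p) (X p) (Z p)) = fun p ↦ inner ℝ (Z p) (Z p) :=
    funext fun p ↦ (Υ.inner_mul ..).symm
  have h4 : (fun p ↦ inner ℝ (Z p) (Z p)) = fun p ↦ inner ℝ (X p) (X p) * inner ℝ (X p) (X p) :=
    funext fun p ↦ hΥ.inner_mul_self p (X p)
  have h5 := mvfderiv_fun_mul (mdifferentiableAt_inner hX' hX') (mdifferentiableAt_inner hX' hX')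
  have h6 : Υ x (X x) (X x) (leviCivita Z x v) = inner ℝ (Z x) (leviCivita Z x v) :=
    (Υ.inner_mul ..).symm
  have h7 : Υ x (leviCivita X x v) (X x) (Z x)
      = inner ℝ (X x) (X x) * inner ℝ (leviCivita X x v) (X x) := by
    rw [← Υ.inner_mul, (hΥ.isCubicProduct x).assoc, (hΥ.isCubicProduct x).comm (X x),
      (hΥ.isCubicProduct x).cube, inner_smul_right]
  have h8 := congrArg (fun f ↦ mvfderiv I f x v) h4
  have h9 := real_inner_comm (leviCivita X x v) (X x)
  have h10 := real_inner_comm (leviCivita Z x v) (Z x)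
  simp only [h5, add_apply, smul_apply, smul_eq_mul, h1, h2, h9, h10] at h8
  rw [TrilinearField.covDeriv, hΥ.symm_left x (X x), h6, h7, h3, h2, h10]
  linarith

theorem isTangentProduct (hΥ : IsHkStructure Υ) {x : M} {B : TangentSpace I x →ₗ[ℝ]
      TangentSpace I x →ₗ[ℝ] TangentSpace I x →ₗ[ℝ] TangentSpace I x}
    (hB : ∀ X Y Z : Π x : M, TangentSpace I x, MDiffAt (T% X) x → MDiffAt (T% Y) x →
      MDiffAt (T% Z) x → ∀ v, inner ℝ (B v (X x) (Y x)) (Z x) = Υ.covDeriv leviCivita X Y Z x v)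
    (v : TangentSpace I x) : IsTangentProduct (Υ.mul x) (B v) := by
  have he : ∀ u : TangentSpace I x, MDiffAt (T% (extend E u)) x := mdifferentiableAt_extend I E
  have hB' : ∀ u w z, inner ℝ (B v u w) z
      = Υ.covDeriv leviCivita (extend E u) (extend E w) (extend E z) x v := fun u w z ↦ by
    rw [← hB _ _ _ (he u) (he w) (he z), extend_apply_self, extend_apply_self, extend_apply_self]
  refine ⟨fun u w ↦ ext_inner_right ℝ fun z ↦ ?_, fun u w z ↦ ?_, fun u ↦ ?_⟩
  · rw [hB', hB', Υ.covDeriv_comm_left hΥ.symm_left]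
  · rw [← real_inner_comm u, hB', hB', Υ.covDeriv_comm_left hΥ.symm_left,
      Υ.covDeriv_comm_right hΥ.symm_right]
  · obtain ⟨X, hX, rfl⟩ := exists_smooth_extension (I := I) x u
    have h := (hX x).mdifferentiableAt (show (∞ : ℕ∞ω) ≠ 0 by simp)
    rw [hB X X (fun y ↦ Υ.mul y (X y) (X y)) h h
      ((hΥ.contMDiff_mul hX hX x).mdifferentiableAt (by simp)), hΥ.covDeriv_mul_self hX]

end IsHkStructure

end Structure

/-! ### Smoothness of the torsion -/

section Basis

variable {V ι : Type*} [NormedAddCommGroup V] [InnerProductSpace ℝ V] [FiniteDimensional ℝ V]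
  {μ : V →ₗ[ℝ] V →ₗ[ℝ] V}

theorem Module.Basis.forall_eq_zero {N : Type*} [AddCommGroup N] [Module ℝ N]
    (b : Module.Basis ι ℝ V) {f : V → N} (hf : IsLinearMap ℝ f) (h : ∀ i, f (b i) = 0) (v : V) :
    f v = 0 :=
  LinearMap.congr_fun (b.ext h : hf.mk' f = 0) v

/-- It suffices to check the hypotheses of the uniqueness theorem on a basis. -/
theorem IsCubicProduct.skew_eq_zero_of_basis (hμ : IsCubicProduct μ)
    (hV : Module.finrank ℝ V = 5 ∨ Module.finrank ℝ V = 14) (b : Module.Basis ι ℝ V)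
    {T : V →ₗ[ℝ] Module.End ℝ V}
    (h₁ : ∀ d i j, inner ℝ (T (b d) (b i)) (b j) + inner ℝ (b i) (T (b d) (b j)) = 0)
    (h₂ : ∀ d i, T (b d) (b i) + T (b i) (b d) = 0)
    (h₃ : ∀ d i j k, inner ℝ (μ (T (b d) (b i)) (b j)) (b k)
      + inner ℝ (μ (b i) (T (b d) (b j))) (b k) + inner ℝ (μ (b i) (b j)) (T (b d) (b k)) = 0) :
    T = 0 := by
  have h₁' : ∀ v x y, inner ℝ (T v x) y + inner ℝ x (T v y) = 0 := by
    intro v x y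
    refine b.forall_eq_zero (f := fun v ↦ inner ℝ (T v x) y + inner ℝ x (T v y))
      ⟨fun _ _ ↦ ?_, fun _ _ ↦ ?_⟩ (fun d ↦ ?_) v
    · simp [inner_add_left, inner_add_right]; ring
    · simp [inner_smul_left, inner_smul_right]; ring
    refine b.forall_eq_zero (f := fun x ↦ inner ℝ (T (b d) x) y + inner ℝ x (T (b d) y))
      ⟨fun _ _ ↦ ?_, fun _ _ ↦ ?_⟩ (fun i ↦ ?_) x
    · simp [inner_add_left]; ring
    · simp [inner_smul_left]; ring
    refine b.forall_eq_zero (f := fun y ↦ inner ℝ (T (b d) (b i)) y + inner ℝ (b i) (T (b d) y))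
      ⟨fun _ _ ↦ ?_, fun _ _ ↦ ?_⟩ (fun j ↦ h₁ d i j) y
    · simp [inner_add_right]; ring
    · simp [inner_smul_right]; ring
  have h₂' : ∀ v x, T v x + T x v = 0 := by
    intro v x
    refine b.forall_eq_zero (f := fun v ↦ T v x + T x v)
      ⟨fun _ _ ↦ ?_, fun _ _ ↦ ?_⟩ (fun d ↦ ?_) v
    · simp; abel
    · simp
    refine b.forall_eq_zero (f := fun x ↦ T (b d) x + T x (b d))
      ⟨fun _ _ ↦ ?_, fun _ _ ↦ ?_⟩ (fun i ↦ h₂ d i) x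
    · simp; abel
    · simp
  have h₃' : ∀ v x y z, inner ℝ (μ (T v x) y) z + inner ℝ (μ x (T v y)) z
      + inner ℝ (μ x y) (T v z) = 0 := by
    intro v x y z
    refine b.forall_eq_zero (f := fun v ↦ inner ℝ (μ (T v x) y) z + inner ℝ (μ x (T v y)) z
      + inner ℝ (μ x y) (T v z)) ⟨fun _ _ ↦ ?_, fun _ _ ↦ ?_⟩ (fun d ↦ ?_) v
    · simp [inner_add_left, inner_add_right]; ring
    · simp [inner_smul_left, inner_smul_right]; ring
    refine b.forall_eq_zero (f := fun x ↦ inner ℝ (μ (T (b d) x) y) z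
      + inner ℝ (μ x (T (b d) y)) z + inner ℝ (μ x y) (T (b d) z))
      ⟨fun _ _ ↦ ?_, fun _ _ ↦ ?_⟩ (fun i ↦ ?_) x
    · simp [inner_add_left]; ring
    · simp [inner_smul_left]; ring
    refine b.forall_eq_zero (f := fun y ↦ inner ℝ (μ (T (b d) (b i)) y) z
      + inner ℝ (μ (b i) (T (b d) y)) z + inner ℝ (μ (b i) y) (T (b d) z))
      ⟨fun _ _ ↦ ?_, fun _ _ ↦ ?_⟩ (fun j ↦ ?_) y
    · simp [inner_add_left]; ring
    · simp [inner_smul_left]; ring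
    refine b.forall_eq_zero (f := fun z ↦ inner ℝ (μ (T (b d) (b i)) (b j)) z
      + inner ℝ (μ (b i) (T (b d) (b j))) z + inner ℝ (μ (b i) (b j)) (T (b d) z))
      ⟨fun _ _ ↦ ?_, fun _ _ ↦ ?_⟩ (fun k ↦ h₃ d i j k) z
    · simp [inner_add_right]; ring
    · simp [inner_smul_right]; ring
  refine hμ.skew_eq_zero hV (fun v x y ↦ eq_neg_of_add_eq_zero_left (h₁' v x y)) (fun v ↦ ?_)
    fun v ↦ LinearMap.ext₂ fun x y ↦ ext_inner_right ℝ fun z ↦ ?_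
  · have h := h₂' v v
    rwa [← two_smul ℝ, smul_eq_zero_iff_right two_ne_zero] at h
  · rw [deform_apply, inner_sub_left, inner_add_left, LinearMap.zero_apply, LinearMap.zero_apply,
      inner_zero_left]
    linarith [h₃' v x y z, h₁' v (μ x y) z]

end Basis

section Smooth

variable {E : Type*} [NormedAddCommGroup E] [NormedSpace ℝ E] [FiniteDimensional ℝ E]
  {H : Type*} [TopologicalSpace H] {I : ModelWithCorners ℝ E H}
  {M : Type*} [TopologicalSpace M] [T2Space M] [ChartedSpace H M] [IsManifold I ∞ M]
  [RiemannianBundle (fun x : M ↦ TangentSpace I x)]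
  [IsContMDiffRiemannianBundle I ∞ E (fun x : M ↦ TangentSpace I x)]
  {Υ : TrilinearField I M}

/-- A field of skew-symmetric, alternating endomorphism-valued forms is smooth if its infinitesimal
action on `Υ` is: in a smooth frame its components are the unique solution of a linear system. -/
theorem IsHkStructure.contMDiff_inner_skew (hΥ : IsHkStructure Υ)
    (hdim : Module.finrank ℝ E = 5 ∨ Module.finrank ℝ E = 14)
    {τ : Π x : M, TangentSpace I x →ₗ[ℝ] Module.End ℝ (TangentSpace I x)}
    (hτ : ∀ x v, IsSkewMap (τ x v)) (hτ0 : ∀ x v, τ x v v = 0)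
    (hτΥ : ∀ V X Y Z : Π x : M, TangentSpace I x, CMDiff ∞ (T% V) → CMDiff ∞ (T% X) →
      CMDiff ∞ (T% Y) → CMDiff ∞ (T% Z) →
      CMDiff ∞ (fun x ↦ inner ℝ (deform (Υ.mul x) (τ x (V x)) (X x) (Y x)) (Z x)))
    {X Y Z : Π x : M, TangentSpace I x} (hX : CMDiff ∞ (T% X)) (hY : CMDiff ∞ (T% Y))
    (hZ : CMDiff ∞ (T% Z)) : CMDiff ∞ (fun x ↦ inner ℝ (τ x (X x) (Y x)) (Z x)) := by
  intro x₀
  obtain ⟨W, c, hW, hli, hc, hcs, -⟩ := exists_frame (I := I) x₀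
  let n := Module.finrank ℝ E
  -- A family of coefficients `p` represents the form mapping `W d`, `W a` to `w p d a`.
  let w : (Fin n → Fin n → Fin n → ℝ) → Fin n → Fin n → Π x : M, TangentSpace I x :=
    fun p d a x ↦ ∑ e, p d a e • W e x
  have hw : ∀ p d a, CMDiff ∞ (T% (w p d a)) := fun p d a ↦
    ContMDiff.sum_section fun e _ ↦ contMDiff_const.smul_section (hW e)
  have hw_add : ∀ p q d a x, w (p + q) d a x = w p d a x + w q d a x := fun p q d a x ↦ by
    simp [w, add_smul, Finset.sum_add_distrib]
  have hw_smul : ∀ (r : ℝ) p d a x, w (r • p) d a x = r • w p d a x := fun r p d a x ↦ by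
    simp [w, mul_smul, Finset.smul_sum]
  -- The linear system for `p` expresses skewness, alternation and the prescribed action on `Υ`.
  let L : M → (Fin n → Fin n → Fin n → ℝ) →ₗ[ℝ]
      (Fin n → Fin n → Fin n → ℝ) × (Fin n → Fin n → Fin n → ℝ) ×
        (Fin n → Fin n → Fin n → Fin n → ℝ) := fun x ↦
    { toFun p :=
        (fun d i j ↦ inner ℝ (w p d i x) (W j x) + inner ℝ (W i x) (w p d j x),
          fun d i j ↦ p d i j + p i d j,
          fun d i j k ↦ Υ x (w p d i x) (W j x) (W k x) + Υ x (W i x) (w p d j x) (W k x)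
            + Υ x (W i x) (W j x) (w p d k x))
      map_add' p q := by
        ext <;> simp only [hw_add, inner_add_left, inner_add_right, ContinuousLinearMap.map_add,
          add_apply, Pi.add_apply, Prod.fst_add, Prod.snd_add] <;> ring
      map_smul' r p := by
        ext <;> simp only [hw_smul, inner_smul_left, inner_smul_right, conj_trivial,
          ContinuousLinearMap.map_smul, smul_apply, Pi.smul_apply, Prod.smul_fst, Prod.smul_snd,
          smul_eq_mul, RingHom.id_apply] <;> ring }
  let t : M → Fin n → Fin n → Fin n → ℝ := fun x d a e ↦ c e x (τ x (W d x) (W a x))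
  let r : M → (Fin n → Fin n → Fin n → ℝ) × (Fin n → Fin n → Fin n → ℝ) ×
        (Fin n → Fin n → Fin n → Fin n → ℝ) := fun x ↦
    (0, 0, fun d i j k ↦ inner ℝ (deform (Υ.mul x) (τ x (W d x)) (W i x) (W j x)) (W k x))
  have ht : ContMDiffAt I 𝓘(ℝ, Fin n → Fin n → Fin n → ℝ) ∞ t x₀ := by
    refine contMDiffAt_of_linearMap_apply_eq (L := L) (b := r) (fun p ↦ ?_) ?_ (fun p hp ↦ ?_) ?_
    · refine ContMDiffAt.prodMk_space ?_ (ContMDiffAt.prodMk_space contMDiffAt_const ?_)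
      · refine contMDiffAt_pi_space.2 fun d ↦ contMDiffAt_pi_space.2 fun i ↦
          contMDiffAt_pi_space.2 fun j ↦ ?_
        exact ((contMDiff_inner (hw p d i) (hW j)).add (contMDiff_inner (hW i) (hw p d j))) x₀
      · refine contMDiffAt_pi_space.2 fun d ↦ contMDiffAt_pi_space.2 fun i ↦
          contMDiffAt_pi_space.2 fun j ↦ contMDiffAt_pi_space.2 fun k ↦ ?_
        exact (((hΥ.smooth _ _ _ (hw p d i) (hW j) (hW k)).add
          (hΥ.smooth _ _ _ (hW i) (hw p d j) (hW k))).add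
          (hΥ.smooth _ _ _ (hW i) (hW j) (hw p d k))) x₀
    · refine ContMDiffAt.prodMk_space contMDiffAt_const
        (ContMDiffAt.prodMk_space contMDiffAt_const ?_)
      refine contMDiffAt_pi_space.2 fun d ↦ contMDiffAt_pi_space.2 fun i ↦
          contMDiffAt_pi_space.2 fun j ↦ contMDiffAt_pi_space.2 fun k ↦ ?_
      exact hτΥ _ _ _ _ (hW d) (hW i) (hW j) (hW k) x₀
    -- Injectivity at `x₀` is the uniqueness theorem for the form with coefficients `p`.
    · obtain ⟨hp1, hp2⟩ := Prod.mk.inj hp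
      obtain ⟨hp2, hp3⟩ := Prod.mk.inj hp2
      have : Nonempty (Fin n) := Fin.pos_iff_nonempty.1 (by omega)
      let b := basisOfLinearIndependentOfCardEqFinrank hli (by simp [finrank_tangentSpace])
      have hb : ∀ a, b a = W a x₀ := fun a ↦
        congrFun (coe_basisOfLinearIndependentOfCardEqFinrank hli _) a
      let T : TangentSpace I x₀ →ₗ[ℝ] Module.End ℝ (TangentSpace I x₀) :=
        b.constr ℝ fun d ↦ b.constr ℝ fun a ↦ w p d a x₀
      have hT : ∀ d a, T (b d) (b a) = w p d a x₀ := fun d a ↦ by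
        simp only [T, Module.Basis.constr_basis]
      have hT0 : T = 0 := by
        refine (hΥ.isCubicProduct x₀).skew_eq_zero_of_basis hdim b (fun d i j ↦ ?_) (fun d i ↦ ?_)
          fun d i j k ↦ ?_
        · rw [hT, hT, hb, hb]
          exact congrFun (congrFun (congrFun hp1 d) i) j
        · rw [hT, hT]
          have : ∀ j, p d i j + p i d j = 0 := fun j ↦ congrFun (congrFun (congrFun hp2 d) i) j
          simp only [w, ← Finset.sum_add_distrib, ← add_smul, this, zero_smul,
            Finset.sum_const_zero]
        · rw [hT, hT, hT, Υ.inner_mul, Υ.inner_mul, Υ.inner_mul, hb, hb, hb]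
          exact congrFun (congrFun (congrFun (congrFun hp3 d) i) j) k
      ext d a e
      refine Fintype.linearIndependent_iff.1 hli (p d a) ?_ e
      have := hT d a
      rw [hT0] at this
      exact this.symm
    · filter_upwards [hc] with x hx
      have hwt : ∀ d a, w (t x) d a x = τ x (W d x) (W a x) := fun d a ↦ (hx _).symm
      refine Prod.ext ?_ (Prod.ext ?_ ?_)
      · ext d i j
        change inner ℝ (w (t x) d i x) (W j x) + inner ℝ (W i x) (w (t x) d j x) = 0
        rw [hwt, hwt, hτ]
        ring
      · ext d i j
        change c j x (τ x (W d x) (W i x)) + c j x (τ x (W i x) (W d x)) = 0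
        have h := hτ0 x (W d x + W i x)
        simp only [map_add, LinearMap.add_apply, hτ0, zero_add, add_zero] at h
        rw [← map_add, add_comm, h, map_zero]
      · ext d i j k
        change Υ x (w (t x) d i x) (W j x) (W k x) + Υ x (W i x) (w (t x) d j x) (W k x)
            + Υ x (W i x) (W j x) (w (t x) d k x)
          = inner ℝ (deform (Υ.mul x) (τ x (W d x)) (W i x) (W j x)) (W k x)
        rw [hwt, hwt, hwt, deform_apply, inner_sub_left, inner_add_left, hτ, ← Υ.inner_mul,
          ← Υ.inner_mul, ← Υ.inner_mul]
        ring
  have hs : CMDiffAt ∞ (fun x ↦ ∑ a, ∑ d, ∑ e, c a x (Y x) * (c d x (X x) * (t x d a e *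
      inner ℝ (W e x) (Z x)))) x₀ := by
    refine contMDiffAt_finsetSum fun a _ ↦ contMDiffAt_finsetSum fun d _ ↦
      contMDiffAt_finsetSum fun e _ ↦ ?_
    refine (hcs _ (hY x₀) a).mul ((hcs _ (hX x₀) d).mul (ContMDiffAt.mul ?_
      (contMDiff_inner (hW e) hZ x₀)))
    exact contMDiffAt_pi_space.1 (contMDiffAt_pi_space.1 (contMDiffAt_pi_space.1 ht d) a) e
  refine hs.congr_of_eventuallyEq ?_
  filter_upwards [hc] with x hx
  have h1 : τ x (X x) (Y x) = ∑ a, ∑ d, ∑ e, c a x (Y x) • c d x (X x) • t x d a e • W e x := by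
    conv_lhs => rw [hx (X x), hx (Y x)]
    simp only [map_sum, map_smul, LinearMap.sum_apply, LinearMap.smul_apply, Finset.smul_sum]
    refine Finset.sum_congr rfl fun a _ ↦ Finset.sum_congr rfl fun d _ ↦ ?_
    rw [← Finset.smul_sum, ← Finset.smul_sum]
    congr 2
    exact hx _
  rw [h1]
  simp only [sum_inner, inner_smul_left, conj_trivial]

end Smooth

/-! ### Characteristic connections -/

/-- On a finite-dimensional space, algebraic trilinear forms are continuous. -/
theorem exists_continuousLinearMap_eq {V : Type*} [AddCommGroup V] [Module ℝ V]
    [TopologicalSpace V] [IsTopologicalAddGroup V] [ContinuousSMul ℝ V] [T2Space V]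
    [FiniteDimensional ℝ V] (t : V →ₗ[ℝ] V →ₗ[ℝ] V →ₗ[ℝ] ℝ) :
    ∃ T : V →L[ℝ] V →L[ℝ] V →L[ℝ] ℝ, ∀ u v w, T u v w = t u v w :=
  ⟨LinearMap.toContinuousLinearMap
    { toFun u := LinearMap.toContinuousLinearMap
        (LinearMap.toContinuousLinearMap.toLinearMap ∘ₗ t u)
      map_add' u u' := by ext; simp
      map_smul' c u := by ext; simp }, fun _ _ _ ↦ rfl⟩

section Characteristic

variable {E : Type*} [NormedAddCommGroup E] [NormedSpace ℝ E] [FiniteDimensional ℝ E]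
  {H : Type*} [TopologicalSpace H] {I : ModelWithCorners ℝ E H}
  {M : Type*} [TopologicalSpace M] [T2Space M] [ChartedSpace H M] [IsManifold I ∞ M]
  [RiemannianBundle (fun x : M ↦ TangentSpace I x)]
  [IsContMDiffRiemannianBundle I ∞ E (fun x : M ↦ TangentSpace I x)]
  {Υ : TrilinearField I M} {D D' : CovariantDerivative I E (fun x : M ↦ TangentSpace I x)}
  {T T' : TrilinearField I M}

theorem TrilinearField.IsSmooth.contMDiff_covDeriv_leviCivita (hΥ : Υ.IsSmooth)
    {V X Y Z : Π x : M, TangentSpace I x} (hV : CMDiff ∞ (T% V)) (hX : CMDiff ∞ (T% X))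
    (hY : CMDiff ∞ (T% Y)) (hZ : CMDiff ∞ (T% Z)) :
    CMDiff ∞ (fun x ↦ Υ.covDeriv leviCivita X Y Z x (V x)) :=
  (((contMDiff_mvfderiv_apply (hΥ X Y Z hX hY hZ) hV).sub
    (hΥ _ _ _ (contMDiff_leviCivita_apply hV hX) hY hZ)).sub
    (hΥ _ _ _ hX (contMDiff_leviCivita_apply hV hY) hZ)).sub
    (hΥ _ _ _ hX hY (contMDiff_leviCivita_apply hV hZ))

/-- Adding a skew-symmetric endomorphism to a connection changes the covariant derivative of `Υ` by
the infinitesimal action of this endomorphism on the product. -/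
theorem TrilinearField.covDeriv_eq_sub_deform {x : M} {v : TangentSpace I x}
    {F : Module.End ℝ (TangentSpace I x)} (hF : IsSkewMap F) {X Y Z : Π x : M, TangentSpace I x}
    (hX : D' X x v = D X x v + F (X x)) (hY : D' Y x v = D Y x v + F (Y x))
    (hZ : D' Z x v = D Z x v + F (Z x)) :
    Υ.covDeriv D' X Y Z x v
      = Υ.covDeriv D X Y Z x v - inner ℝ (deform (Υ.mul x) F (X x) (Y x)) (Z x) := by
  rw [deform_apply, inner_sub_left, inner_add_left, hF, Υ.inner_mul, Υ.inner_mul, Υ.inner_mul]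
  simp only [covDeriv, hX, hY, hZ, ContinuousLinearMap.map_add, add_apply]
  ring

namespace IsHkStructure

/-- If the structure is nearly integrable, the covariant derivative of `Υ` is at each point the
infinitesimal action of a 3-form. -/
theorem exists_skew (hΥ : IsHkStructure Υ)
    (hdim : Module.finrank ℝ E = 5 ∨ Module.finrank ℝ E = 14) (h : IsNearlyIntegrable Υ) (x : M) :
    ∃ τ : TangentSpace I x →ₗ[ℝ] Module.End ℝ (TangentSpace I x), (∀ v, IsSkewMap (τ v)) ∧
      (∀ v, τ v v = 0) ∧ ∀ X Y Z : Π x : M, TangentSpace I x, CMDiff ∞ (T% X) → CMDiff ∞ (T% Y) →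
        CMDiff ∞ (T% Z) → ∀ v,
          Υ.covDeriv leviCivita X Y Z x v = inner ℝ (deform (Υ.mul x) (τ v) (X x) (Y x)) (Z x) := by
  obtain ⟨B, hB⟩ := hΥ.exists_covDeriv_product leviCivita x
  have hs : ∀ {X : Π x : M, TangentSpace I x}, CMDiff ∞ (T% X) → MDiffAt (T% X) x := fun hX ↦
    (hX x).mdifferentiableAt (by simp)
  obtain ⟨τ, h1, h2, h3⟩ := (hΥ.isCubicProduct x).exists_skew hdim (hΥ.isTangentProduct hB)
    fun v ↦ by
      obtain ⟨V, hV, rfl⟩ := exists_smooth_extension (I := I) x v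
      rw [hB V V V (hs hV) (hs hV) (hs hV), h V hV]
  exact ⟨τ, h1, h2, fun X Y Z hX hY hZ v ↦ by rw [← h3, hB X Y Z (hs hX) (hs hY) (hs hZ)]⟩

/-- A nearly integrable structure has the characteristic connection `∇^{LC} + τ` with torsion `2τ`,
where `τ` is the family of `exists_skew`. -/
theorem exists_isCharacteristicConnection (hΥ : IsHkStructure Υ)
    (hdim : Module.finrank ℝ E = 5 ∨ Module.finrank ℝ E = 14) (h : IsNearlyIntegrable Υ) :
    ∃ (D : CovariantDerivative I E (fun x : M ↦ TangentSpace I x)) (T : TrilinearField I M),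
      IsCharacteristicConnection Υ D T := by
  have : IsManifold I 1 M := .of_le (n := ∞) (by simp)
  choose τ hτ hτ0 hτΥ using fun x : M ↦ hΥ.exists_skew hdim h x
  have hτ_swap : ∀ x u v, τ x u v = -τ x v u := fun x u v ↦ by
    have h1 := hτ0 x (u + v)
    simp only [map_add, LinearMap.add_apply, hτ0, zero_add, add_zero] at h1
    exact eq_neg_of_add_eq_zero_right h1
  have hsmooth : ∀ X Y Z : Π x : M, TangentSpace I x, CMDiff ∞ (T% X) → CMDiff ∞ (T% Y) →
      CMDiff ∞ (T% Z) → CMDiff ∞ (fun x ↦ inner ℝ (τ x (X x) (Y x)) (Z x)) :=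
    fun X Y Z hX hY hZ ↦ hΥ.contMDiff_inner_skew hdim hτ hτ0 (fun V X Y Z hV hX hY hZ ↦ by
      simpa only [hτΥ _ X Y Z hX hY hZ] using
        hΥ.smooth.contMDiff_covDeriv_leviCivita hV hX hY hZ) hX hY hZ
  -- The connection is `∇_v Y = ∇^{LC}_v Y + τ_v Y`.
  let A : Π x : M, TangentSpace I x →L[ℝ] TangentSpace I x →L[ℝ] TangentSpace I x := fun x ↦
    LinearMap.toContinuousLinearMap
      (LinearMap.toContinuousLinearMap.toLinearMap ∘ₗ (τ x).flip)
  let D : CovariantDerivative I E (fun x : M ↦ TangentSpace I x) := leviCivita.addOneForm A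
  have hD : ∀ (Y : Π x : M, TangentSpace I x) x v, D Y x v = leviCivita Y x v + τ x v (Y x) :=
    fun _ _ _ ↦ rfl
  choose T hT' using fun x : M ↦ exists_continuousLinearMap_eq
    (LinearMap.compr₂ (τ x) ((2 : ℝ) • innerₗ (TangentSpace I x)))
  have hT : ∀ x u v w, T x u v w = 2 * inner ℝ (τ x u v) w := fun x u v w ↦ hT' x u v w
  refine ⟨D, T, ⟨⟨⟨fun {σ} hσ ↦ ?_⟩⟩, fun Y Z hY hZ x v ↦ ?_, fun X Y Z hX hY hZ x v ↦ ?_⟩,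
    fun X Y Z hX hY hZ ↦ ?_, fun x u v w ↦ ?_, fun x u v w ↦ ?_, fun x Y hY u w ↦ ?_⟩
  · have hσ' : CMDiff ∞ (T% σ) := contMDiffOn_univ.1 hσ
    refine contMDiffOn_univ.2 (contMDiff_hom_of_forall_apply fun X hX ↦ ?_)
    refine contMDiff_of_forall_inner fun Z hZ ↦ ?_
    simp only [hD, inner_add_left]
    exact (contMDiff_inner (contMDiff_leviCivita_apply hX hσ') hZ).add (hsmooth X σ Z hX hσ' hZ)
  · have h1 := leviCivita_metric (mdifferentiableAt_extend I E v)
      ((hY x).mdifferentiableAt (by simp)) ((hZ x).mdifferentiableAt (by simp))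
    rw [extend_apply_self] at h1
    rw [h1, hD, hD, inner_add_left, inner_add_right, hτ]
    ring
  · rw [Υ.covDeriv_eq_sub_deform (D := leviCivita) (hτ x v) (hD X x v) (hD Y x v) (hD Z x v),
      hτΥ _ X Y Z hX hY hZ, sub_self]
  · simp only [hT]
    exact contMDiff_const.mul (hsmooth X Y Z hX hY hZ)
  · rw [hT, hT, hτ_swap, inner_neg_left, mul_neg]
  · rw [hT, hT, hτ, real_inner_comm, mul_neg]
  · rw [hD, inner_add_right, hT, hτ_swap x w, inner_neg_left, hτ, hτ_swap x (Y x) u, inner_neg_right]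
    ring

end IsHkStructure

namespace IsCharacteristicConnection

theorem isSkewMap (hD : IsCharacteristicConnection Υ D T) (x : M) (v : TangentSpace I x) :
    IsSkewMap (T.mul x v) := fun u w ↦ by
  rw [T.inner_mul, ← real_inner_comm u, T.inner_mul, hD.skew_right]

theorem mul_self (hD : IsCharacteristicConnection Υ D T) (x : M) (v : TangentSpace I x) :
    T.mul x v v = 0 := ext_inner_right ℝ fun w ↦ by
  rw [T.inner_mul, inner_zero_left]
  linarith [hD.skew_left x v v w]

/-- The relation `∇^{LC}_v Y = ∇_v Y - T(v, Y) / 2`. The sign differs from that in the definition of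
a characteristic connection because `T(w, Y, v) = -T(v, Y, w)`. -/
theorem leviCivita_eq (hD : IsCharacteristicConnection Υ D T) {Y : Π x : M, TangentSpace I x}
    {x : M} (hY : MDiffAt (T% Y) x) (v : TangentSpace I x) :
    leviCivita Y x v = D Y x v + ((-1 / 2 : ℝ) • T.mul x v) (Y x) := by
  refine ext_inner_left ℝ fun w ↦ ?_
  rw [hD.decomposition x Y hY v w, inner_add_right, LinearMap.smul_apply, inner_smul_right,
    real_inner_comm (T.mul x v (Y x)) w, T.inner_mul, hD.skew_left x w, hD.skew_right x _ w,
    hD.skew_left x _ v]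
  ring

theorem covDeriv_leviCivita (hD : IsCharacteristicConnection Υ D T)
    {X Y Z : Π x : M, TangentSpace I x} (hX : CMDiff ∞ (T% X)) (hY : CMDiff ∞ (T% Y))
    (hZ : CMDiff ∞ (T% Z)) (x : M) (v : TangentSpace I x) :
    Υ.covDeriv leviCivita X Y Z x v
      = 1 / 2 * inner ℝ (deform (Υ.mul x) (T.mul x v) (X x) (Y x)) (Z x) := by
  have hs : ∀ {X : Π x : M, TangentSpace I x}, CMDiff ∞ (T% X) → MDiffAt (T% X) x := fun hX ↦
    (hX x).mdifferentiableAt (by simp)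
  rw [Υ.covDeriv_eq_sub_deform ((hD.isSkewMap x v).smul _) (hD.leviCivita_eq (hs hX) v)
    (hD.leviCivita_eq (hs hY) v) (hD.leviCivita_eq (hs hZ) v),
    hD.isHkConnection.preserves_tensor X Y Z hX hY hZ, map_smul, LinearMap.smul_apply,
    LinearMap.smul_apply, inner_smul_left, conj_trivial]
  ring

theorem isNearlyIntegrable (hD : IsCharacteristicConnection Υ D T) : IsNearlyIntegrable Υ :=
    fun V hV x ↦ by
  rw [hD.covDeriv_leviCivita hV hV hV, deform_apply, hD.mul_self, map_zero, map_zero,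
    LinearMap.zero_apply, zero_add, zero_sub, inner_neg_left, hD.isSkewMap, hD.mul_self,
    inner_zero_right, neg_zero, neg_zero, mul_zero]

theorem torsion_unique (hΥ : IsHkStructure Υ)
    (hdim : Module.finrank ℝ E = 5 ∨ Module.finrank ℝ E = 14)
    (hD : IsCharacteristicConnection Υ D T) (hD' : IsCharacteristicConnection Υ D' T') :
    T = T' := by
  funext x
  have h : T.mul x - T'.mul x = 0 := by
    refine (hΥ.isCubicProduct x).skew_eq_zero hdim (T := T.mul x - T'.mul x)
      (fun v ↦ (hD.isSkewMap x v).sub (hD'.isSkewMap x v)) (fun v ↦ ?_) fun v ↦ ?_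
    · rw [LinearMap.sub_apply, LinearMap.sub_apply, hD.mul_self, hD'.mul_self, sub_zero]
    · refine LinearMap.ext₂ fun u w ↦ ext_inner_right ℝ fun z ↦ ?_
      obtain ⟨X, hX, rfl⟩ := exists_smooth_extension (I := I) x u
      obtain ⟨Y, hY, rfl⟩ := exists_smooth_extension (I := I) x w
      obtain ⟨Z, hZ, rfl⟩ := exists_smooth_extension (I := I) x z
      have h1 := hD.covDeriv_leviCivita hX hY hZ x v
      have h2 := hD'.covDeriv_leviCivita hX hY hZ x v
      rw [LinearMap.sub_apply, map_sub, LinearMap.sub_apply, LinearMap.sub_apply, inner_sub_left,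
        LinearMap.zero_apply, LinearMap.zero_apply, inner_zero_left]
      linarith
  ext u v w
  rw [← T.inner_mul, ← T'.inner_mul, sub_eq_zero.1 h]

theorem unique (hΥ : IsHkStructure Υ) (hdim : Module.finrank ℝ E = 5 ∨ Module.finrank ℝ E = 14)
    (hD : IsCharacteristicConnection Υ D T) (hD' : IsCharacteristicConnection Υ D' T')
    {x : M} {Y : Π x : M, TangentSpace I x} (hY : MDiffAt (T% Y) x) : D Y x = D' Y x := by
  ext1 v
  have h1 := hD.leviCivita_eq hY v
  rw [hD'.leviCivita_eq hY v, torsion_unique hΥ hdim hD hD'] at h1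
  exact (add_right_cancel h1).symm

end IsCharacteristicConnection

end Characteristic

theorem mainTheorem6
    {E : Type*} [NormedAddCommGroup E] [NormedSpace ℝ E] [FiniteDimensional ℝ E]
    {H : Type*} [TopologicalSpace H] {I : ModelWithCorners ℝ E H} [I.Boundaryless]
    {M : Type*} [TopologicalSpace M] [T2Space M] [ChartedSpace H M] [IsManifold I ∞ M]
    [RiemannianBundle (fun x : M ↦ TangentSpace I x)]
    [IsContMDiffRiemannianBundle I ∞ E (fun x : M ↦ TangentSpace I x)]
    (hdim : Module.finrank ℝ E = 5 ∨ Module.finrank ℝ E = 14)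
    (Υ : TrilinearField I M) (hΥ : IsHkStructure Υ) :
    ((∃ (D : CovariantDerivative I E (fun x : M ↦ TangentSpace I x)) (T : TrilinearField I M),
        IsCharacteristicConnection Υ D T) ↔ IsNearlyIntegrable Υ) ∧
    ∀ (D D' : CovariantDerivative I E (fun x : M ↦ TangentSpace I x)) (T T' : TrilinearField I M),
      IsCharacteristicConnection Υ D T → IsCharacteristicConnection Υ D' T' →
        T = T' ∧ ∀ (x : M) (Y : Π x : M, TangentSpace I x), MDiffAt (T% Y) x → D Y x = D' Y x :=
  ⟨⟨fun ⟨_, _, hD⟩ ↦ hD.isNearlyIntegrable, hΥ.exists_isCharacteristicConnection hdim⟩,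
    fun _ _ _ _ hD hD' ↦ ⟨hD.torsion_unique hΥ hdim hD',
      fun _ _ hY ↦ hD.unique hΥ hdim hD' hY⟩⟩
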